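/- **Setting.** Let $A,N_1,\dots,N_m\in\mathbb R^{n\times n}$, $B\in\mathbb R^{n\times m}$, $X_0\in\mathbb R^{n\times q}$, $C\in\mathbb R^{p\times n}$, where $A$ is Hurwitz (all eigenvalues have negative real part). For $v_0\in\mathbb R^q$ and $u=(u_1,\dots,u_m)^\top\in L^2([0,\infty);\mathbb R^m)$ let $$\dot x=Ax+Bu+\sum_{k=1}^m N_kx\,u_k,\quad x(0)=X_0v_0,\qquad y=Cx. \tag{1}$$ Differential equations with control are understood in integrated form with continuous solutions, and $\|\cdot\|_{L^2}$ is the norm of $L^2([0,\infty))$ with respect to the Euclidean norm. Let $\gamma>0$ be (large enough) such that all eigenvalues of $A\otimes I+I\otimes A+\gamma^{-2}\sum_k N_k\otimes N_k$ have negative real part. **Gramians.** Let $P_0=\int_0^\infty Z(s)\,ds$ and $Q=\int_0^\infty Z^*(s)\,ds$, where $\dot Z=AZ+ZA^\top+\gamma^{-2}\sum_kN_kZN_k^\top$, $Z(0)=X_0X_0^\top$, and $\dot Z^*=A^\top Z^*+Z^*A+\gamma^{-2}\sum_kN_k^\top Z^*N_k$, $Z^*(0)=C^\top C$. Let $P_B$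 be any symmetric positive definite matrix with $$A^\top P_B^{-1}+P_B^{-1}A+\gamma^{-2}\sum_kN_k^\top P_B^{-1}N_k\le -P_B^{-1}BB^\top P_B^{-1}.$$ **Balancing.** Let $\mathcal S,S\in\mathbb R^{n\times n}$ be invertible with $$\mathcal SP_0\mathcal S^\top=\mathcal S^{-\top}Q\mathcal S^{-1}=\Theta=\operatorname{diag}(\theta_1,\dots,\theta_n),\qquad SP_BS^\top=S^{-\top}QS^{-1}=\Sigma=\operatorname{diag}(\sigma_1,\dots,\sigma_n),$$ $\theta_1\ge\dots\ge\theta_n$, $\sigma_1\ge\dots\ge\sigma_n$. (The $\theta_i$, $\sigma_i$ are the Hankel singular values of the homogeneous subsystem, that is (1) with $B=0$, and of the inhomogeneous subsystem, that is (1) with $X_0=0$.) Let $0\le r_{x_0},r_B\le n$ and assume $\Theta_1=\operatorname{diag}(\theta_1,\dots,\theta_{r_{x_0}})>0$; put $\Theta_2=\operatorname{diag}(\theta_{r_{x_0}+1},\dots,\theta_n)$. Partition, with leading blocks of size $r_{x_0}$, $$\mathcal SA\mathcal S^{-1}=\begin{bmatrix}\mathcal A_{11}&\mathcal A_{12}\\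 \mathcal A_{21}&\mathcal A_{22}\end{bmatrix},\quad \mathcal SN_k\mathcal S^{-1}=\begin{bmatrix}\mathcal N_{k,11}&\mathcal N_{k,12}\\ \mathcal N_{k,21}&\mathcal N_{k,22}\end{bmatrix},\quad \mathcal SX_0=\begin{bmatrix}X_{0,1}\\X_{0,2}\end{bmatrix},\quad C\mathcal S^{-1}=[\mathcal C_1\ \mathcal C_2],$$ and, with leading blocks of size $r_B$, likewise $SAS^{-1}=(A_{ij})$, $SN_kS^{-1}=(N_{k,ij})$, $SB=\begin{bmatrix}B_1\\B_2\end{bmatrix}$, $CS^{-1}=[C_1\ C_2]$. **Reduced models.** The homogeneous subsystem is reduced to $$\dot{\tilde x}_{x_0}=\tilde A_{x_0}\tilde x_{x_0}+\sum_k\tilde N_{x_0,k}\tilde x_{x_0}u_k,\quad \tilde x_{x_0}(0)=X_{0,1}v_0,\qquad \tilde y_{x_0}=\tilde C_{x_0}\tilde x_{x_0},$$ where $(\tilde A_{x_0},\tilde C_{x_0},\tilde N_{x_0,k})$ is either $(\mathcal A_{11},\mathcal C_1,\mathcal N_{k,11})$ (BT) or $(\mathcal A_{11}-\mathcal A_{12}\mathcal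 A_{22}^{-1}\mathcal A_{21},\ \mathcal C_1-\mathcal C_2\mathcal A_{22}^{-1}\mathcal A_{21},\ \mathcal N_{k,11}-\mathcal N_{k,12}\mathcal A_{22}^{-1}\mathcal A_{21})$ (SPA, for which $\mathcal A_{22}$ is assumed invertible). The inhomogeneous subsystem is reduced, by a scheme chosen independently of the first, to $$\dot{\tilde x}_B=\tilde A_B\tilde x_B+\tilde Bu+\sum_k(\tilde N_{B,k}\tilde x_B+\tilde E_ku)u_k,\quad \tilde x_B(0)=0,\qquad \tilde y_B=\tilde C_B\tilde x_B+\tilde Du,$$ where $(\tilde A_B,\tilde B,\tilde C_B,\tilde D,\tilde E_k,\tilde N_{B,k})$ is either $(A_{11},B_1,C_1,0,0,N_{k,11})$ (BT) or $(A_{11}-A_{12}A_{22}^{-1}A_{21},\ B_1-A_{12}A_{22}^{-1}B_2,\ C_1-C_2A_{22}^{-1}A_{21},\ -C_2A_{22}^{-1}B_2,\ -N_{k,12}A_{22}^{-1}B_2,\ N_{k,11}-N_{k,12}A_{22}^{-1}A_{21})$ (SPA, for which $A_{22}$ is assumed invertible). Put $\tilde y=\tilde y_{x_0}+\tilde y_B$.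 Let $\tilde P=\int_0^\infty\tilde Z(s)\,ds$ with $\dot{\tilde Z}=\tilde A_{x_0}\tilde Z+\tilde Z\tilde A_{x_0}^\top+\gamma^{-2}\sum_k\tilde N_{x_0,k}\tilde Z\tilde N_{x_0,k}^\top$, $\tilde Z(0)=X_{0,1}X_{0,1}^\top$. If SPA is used for the homogeneous subsystem, the existence of $\tilde P$ (convergence of this integral) is assumed. **Theorem 4.5.** The integral $\tilde P$ exists for BT as well, there is exactly one solution $Y=\begin{bmatrix}Y_1\\Y_2\end{bmatrix}\in\mathbb R^{n\times r_{x_0}}$, with $Y_1\in\mathbb R^{r_{x_0}\times r_{x_0}}$, of $$\mathcal SA\mathcal S^{-1}Y+Y\tilde A_{x_0}^\top+\gamma^{-2}\sum_k\mathcal SN_k\mathcal S^{-1}Y\tilde N_{x_0,k}^\top=-\mathcal SX_0X_{0,1}^\top ,$$ and with the matrix (independent of $u$ and $v_0$) $$\mathcal W_{x_0}=X_{0,2}X_{0,2}^\top+2Y_2\mathbf A_{21}^\top+2[\mathcal A_{21}\ \mathcal A_{22}]Y\bar{\mathbf A}_{21}^\top+\gamma^{-2}\sum_{k=1}^m\Big(2[\mathcal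 N_{k,21}\ \mathcal N_{k,22}]Y\mathbf N_{k,21}^\top-\mathbf N_{k,21}\tilde P\mathbf N_{k,21}^\top\Big),$$ where $(\mathbf A_{21},\bar{\mathbf A}_{21},\mathbf N_{k,21})=(\mathcal A_{21},0,\mathcal N_{k,21})$ if BT and $(0,-\mathcal A_{22}^{-1}\mathcal A_{21},\mathcal N_{k,21}-\mathcal N_{k,22}\mathcal A_{22}^{-1}\mathcal A_{21})$ if SPA is used for the homogeneous subsystem, one has $\operatorname{tr}(\Theta_2\mathcal W_{x_0})\ge0$ and, for all $v_0\in\mathbb R^q$ and $u\in L^2$, $y-\tilde y\in L^2$ and $$\|y-\tilde y\|_{L^2}\le\Big[\big(\operatorname{tr}(\Theta_2\mathcal W_{x_0})\big)^{1/2}\|v_0\|_2+\Big(2\sum_{i=r_B+1}^n\sigma_i\Big)\|u\|_{L^2}\Big]\exp\Big\{\tfrac12\|\gamma u^0\|_{L^2}^2\Big\},$$ where $u^0_k=0$ if $N_k=0$ and $u^0_k=u_k$ otherwise. -/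

import Mathlib

open scoped Matrix Kronecker
open MeasureTheory

noncomputable section

namespace BilinearMOR

/-- Coefficients of the bilinear system
`x' = A x + B u + ∑ k, N k x (u k)`, `x 0 = X₀ v₀`, `y = C x`,
with state dimension `n`, `m` controls, `q` initial directions and `p` outputs. -/
structure BilinearSystem (n m q p : ℕ) where
  A : Matrix (Fin n) (Fin n) ℝ
  N : Fin m → Matrix (Fin n) (Fin n) ℝ
  B : Matrix (Fin n) (Fin m) ℝ
  X₀ : Matrix (Fin n) (Fin q) ℝ
  C : Matrix (Fin p) (Fin n) ℝ

/-- The realization obtained from the change of state coordinates `x ↦ T x`. -/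
def BilinearSystem.transform {n m q p : ℕ} (G : BilinearSystem n m q p)
    (T : Matrix (Fin n) (Fin n) ℝ) : BilinearSystem n m q p where
  A := T * G.A * T⁻¹
  N := fun k => T * G.N k * T⁻¹
  B := T * G.B
  X₀ := T * G.X₀
  C := G.C * T⁻¹

/-- All complex eigenvalues of the real matrix `M` lie in the open left half plane. -/
def IsHurwitz {ι : Type*} [Fintype ι] [DecidableEq ι] (M : Matrix ι ι ℝ) : Prop :=
  ∀ z ∈ spectrum ℂ (M.map (algebraMap ℝ ℂ)), z.re < 0

/-- `σ(A ⊗ I + I ⊗ A + γ⁻² ∑ k, N k ⊗ N k) ⊂ ℂ₋`. -/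
def MeanSquareStable {n m : ℕ} (γ : ℝ) (A : Matrix (Fin n) (Fin n) ℝ)
    (N : Fin m → Matrix (Fin n) (Fin n) ℝ) : Prop :=
  IsHurwitz (A ⊗ₖ (1 : Matrix (Fin n) (Fin n) ℝ) + (1 : Matrix (Fin n) (Fin n) ℝ) ⊗ₖ A
    + (1 / γ ^ 2) • ∑ k, N k ⊗ₖ N k)

/-- The matrix function `Z` solves, on `[0, ∞)`,
`Z' = A Z + Z Aᵀ + γ⁻² ∑ k, N k Z (N k)ᵀ`, `Z 0 = K`. -/
def IsLyapunovFlow {n m : ℕ} (γ : ℝ) (A : Matrix (Fin n) (Fin n) ℝ)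
    (N : Fin m → Matrix (Fin n) (Fin n) ℝ) (K : Matrix (Fin n) (Fin n) ℝ)
    (Z : ℝ → Matrix (Fin n) (Fin n) ℝ) : Prop :=
  Z 0 = K ∧ ∀ t : ℝ, 0 ≤ t → ∀ i j : Fin n,
    HasDerivWithinAt (fun s => Z s i j)
      ((A * Z t + Z t * Aᵀ + (1 / γ ^ 2) • ∑ k, N k * Z t * (N k)ᵀ) i j) (Set.Ici 0) t

/-- The integral `∫₀^∞ Z(s) ds` of the flow started in `K` exists and equals `P`. -/
def IsGramian {n m : ℕ} (γ : ℝ) (A : Matrix (Fin n) (Fin n) ℝ)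
    (N : Fin m → Matrix (Fin n) (Fin n) ℝ) (K P : Matrix (Fin n) (Fin n) ℝ) : Prop :=
  ∃ Z : ℝ → Matrix (Fin n) (Fin n) ℝ, IsLyapunovFlow γ A N K Z ∧
    ∀ i j : Fin n, IntegrableOn (fun s => Z s i j) (Set.Ioi 0) ∧
      P i j = ∫ s in Set.Ioi (0 : ℝ), Z s i j

/-- `P > 0` and
`Aᵀ P⁻¹ + P⁻¹ A + γ⁻² ∑ k, (N k)ᵀ P⁻¹ N k ≤ - P⁻¹ B Bᵀ P⁻¹` in the Loewner order. -/
def IsLMIGramian {n m : ℕ} (γ : ℝ) (A : Matrix (Fin n) (Fin n) ℝ)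
    (N : Fin m → Matrix (Fin n) (Fin n) ℝ) (B : Matrix (Fin n) (Fin m) ℝ)
    (P : Matrix (Fin n) (Fin n) ℝ) : Prop :=
  P.PosDef ∧
    (-(P⁻¹ * B * Bᵀ * P⁻¹)
      - (Aᵀ * P⁻¹ + P⁻¹ * A + (1 / γ ^ 2) • ∑ k, (N k)ᵀ * P⁻¹ * N k)).PosSemidef

/-- `T` is a state space transformation that balances the pair `(P, Q)`, i.e.
`T P Tᵀ = T⁻ᵀ Q T⁻¹ = diag(θ)`, with the entries of `θ` in non-increasing order.
The `θ i` are then the square roots of the eigenvalues of `P * Q`. -/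
structure IsBalancing {n : ℕ} (T P Q : Matrix (Fin n) (Fin n) ℝ) (θ : Fin n → ℝ) : Prop where
  isUnit_det : IsUnit T.det
  reach : T * P * Tᵀ = Matrix.diagonal θ
  obs : (T⁻¹)ᵀ * Q * T⁻¹ = Matrix.diagonal θ
  antitone : Antitone θ

/-- The splitting of the `n` coordinates into the first `r` and the last `n - r`. -/
def splitIdx {n r : ℕ} (h : r ≤ n) : Fin r ⊕ Fin (n - r) ≃ Fin n :=
  finSumFinEquiv.trans (finCongr (Nat.add_sub_of_le h))

/-- The first `r` coordinates. -/
def idx₁ {n r : ℕ} (h : r ≤ n) (i : Fin r) : Fin n := splitIdx h (Sum.inl i)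

/-- The last `n - r` coordinates. -/
def idx₂ {n r : ℕ} (h : r ≤ n) (i : Fin (n - r)) : Fin n := splitIdx h (Sum.inr i)

def block₁₁ {n r : ℕ} (h : r ≤ n) (M : Matrix (Fin n) (Fin n) ℝ) :
    Matrix (Fin r) (Fin r) ℝ := M.submatrix (idx₁ h) (idx₁ h)

def block₁₂ {n r : ℕ} (h : r ≤ n) (M : Matrix (Fin n) (Fin n) ℝ) :
    Matrix (Fin r) (Fin (n - r)) ℝ := M.submatrix (idx₁ h) (idx₂ h)

def block₂₁ {n r : ℕ} (h : r ≤ n) (M : Matrix (Fin n) (Fin n) ℝ) :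
    Matrix (Fin (n - r)) (Fin r) ℝ := M.submatrix (idx₂ h) (idx₁ h)

def block₂₂ {n r : ℕ} (h : r ≤ n) (M : Matrix (Fin n) (Fin n) ℝ) :
    Matrix (Fin (n - r)) (Fin (n - r)) ℝ := M.submatrix (idx₂ h) (idx₂ h)

def rows₁ {n r : ℕ} {κ : Type*} (h : r ≤ n) (M : Matrix (Fin n) κ ℝ) :
    Matrix (Fin r) κ ℝ := M.submatrix (idx₁ h) id

def rows₂ {n r : ℕ} {κ : Type*} (h : r ≤ n) (M : Matrix (Fin n) κ ℝ) :
    Matrix (Fin (n - r)) κ ℝ := M.submatrix (idx₂ h) id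

def cols₁ {n r : ℕ} {κ : Type*} (h : r ≤ n) (M : Matrix κ (Fin n) ℝ) :
    Matrix κ (Fin r) ℝ := M.submatrix id (idx₁ h)

def cols₂ {n r : ℕ} {κ : Type*} (h : r ≤ n) (M : Matrix κ (Fin n) ℝ) :
    Matrix κ (Fin (n - r)) ℝ := M.submatrix id (idx₂ h)

/-- The two reduction schemes: balanced truncation and singular perturbation approximation. -/
inductive Method where
  | bt
  | spa

/-- Coefficients of a reduced model
`x' = A x + ∑ k, N k x (u k)`, `x 0 = X₀ v₀`, `y = C x`. -/
structure HomogeneousROM (r m q p : ℕ) where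
  A : Matrix (Fin r) (Fin r) ℝ
  N : Fin m → Matrix (Fin r) (Fin r) ℝ
  X₀ : Matrix (Fin r) (Fin q) ℝ
  C : Matrix (Fin p) (Fin r) ℝ

/-- Coefficients of a reduced model
`x' = A x + B u + ∑ k, (N k x + E k u) (u k)`, `x 0 = 0`, `y = C x + D u`. -/
structure InhomogeneousROM (r m p : ℕ) where
  A : Matrix (Fin r) (Fin r) ℝ
  N : Fin m → Matrix (Fin r) (Fin r) ℝ
  B : Matrix (Fin r) (Fin m) ℝ
  E : Fin m → Matrix (Fin r) (Fin m) ℝ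
  C : Matrix (Fin p) (Fin r) ℝ
  D : Matrix (Fin p) (Fin m) ℝ

/-- The reduced model of dimension `r` of the homogeneous subsystem with the balanced
realization `G`. -/
def homogeneousROM {n m q p r : ℕ} (h : r ≤ n) (G : BilinearSystem n m q p) :
    Method → HomogeneousROM r m q p
  | .bt =>
    { A := block₁₁ h G.A
      N := fun k => block₁₁ h (G.N k)
      X₀ := rows₁ h G.X₀
      C := cols₁ h G.C }
  | .spa =>
    { A := block₁₁ h G.A - block₁₂ h G.A * (block₂₂ h G.A)⁻¹ * block₂₁ h G.A
      N := fun k => block₁₁ h (G.N k) - block₁₂ h (G.N k) * (block₂₂ h G.A)⁻¹ * block₂₁ h G.A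
      X₀ := rows₁ h G.X₀
      C := cols₁ h G.C - cols₂ h G.C * (block₂₂ h G.A)⁻¹ * block₂₁ h G.A }

/-- The reduced model of dimension `r` of the inhomogeneous subsystem with the balanced
realization `G`. -/
def inhomogeneousROM {n m q p r : ℕ} (h : r ≤ n) (G : BilinearSystem n m q p) :
    Method → InhomogeneousROM r m p
  | .bt =>
    { A := block₁₁ h G.A
      N := fun k => block₁₁ h (G.N k)
      B := rows₁ h G.B
      E := fun _ => 0
      C := cols₁ h G.C
      D := 0 }
  | .spa =>
    { A := block₁₁ h G.A - block₁₂ h G.A * (block₂₂ h G.A)⁻¹ * block₂₁ h G.A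
      N := fun k => block₁₁ h (G.N k) - block₁₂ h (G.N k) * (block₂₂ h G.A)⁻¹ * block₂₁ h G.A
      B := rows₁ h G.B - block₁₂ h G.A * (block₂₂ h G.A)⁻¹ * rows₂ h G.B
      E := fun k => -(block₁₂ h (G.N k) * (block₂₂ h G.A)⁻¹ * rows₂ h G.B)
      C := cols₁ h G.C - cols₂ h G.C * (block₂₂ h G.A)⁻¹ * block₂₁ h G.A
      D := -(cols₂ h G.C * (block₂₂ h G.A)⁻¹ * rows₂ h G.B) }

/-- The mixed equation
`A Y + Y Ãᵀ + γ⁻² ∑ k, N k Y (Ñ k)ᵀ = - X₀ X̃₀ᵀ`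
between a balanced realization `G` and a reduced model `R`. -/
def MixedEquation {n m q p r : ℕ} (γ : ℝ) (G : BilinearSystem n m q p)
    (R : HomogeneousROM r m q p) (Y : Matrix (Fin n) (Fin r) ℝ) : Prop :=
  G.A * Y + Y * R.Aᵀ + (1 / γ ^ 2) • ∑ k, G.N k * Y * (R.N k)ᵀ = -(G.X₀ * R.X₀ᵀ)

/-- The matrix denoted by a bold `A₂₁` (which is `A₂₁` for BT and `0` for SPA). -/
def boldA₂₁ {n m q p r : ℕ} (h : r ≤ n) (G : BilinearSystem n m q p) :
    Method → Matrix (Fin (n - r)) (Fin r) ℝ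
  | .bt => block₂₁ h G.A
  | .spa => 0

/-- The matrix denoted by a bold `Ā₂₁` (which is `0` for BT and `- A₂₂⁻¹ A₂₁` for SPA). -/
def boldAbar₂₁ {n m q p r : ℕ} (h : r ≤ n) (G : BilinearSystem n m q p) :
    Method → Matrix (Fin (n - r)) (Fin r) ℝ
  | .bt => 0
  | .spa => -((block₂₂ h G.A)⁻¹ * block₂₁ h G.A)

/-- The matrix denoted by a bold `N_{k,21}` (which is `N_{k,21}` for BT and
`N_{k,21} - N_{k,22} A₂₂⁻¹ A₂₁` for SPA). -/
def boldN₂₁ {n m q p r : ℕ} (h : r ≤ n) (G : BilinearSystem n m q p) :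
    Method → Fin m → Matrix (Fin (n - r)) (Fin r) ℝ
  | .bt, k => block₂₁ h (G.N k)
  | .spa, k => block₂₁ h (G.N k) - block₂₂ h (G.N k) * (block₂₂ h G.A)⁻¹ * block₂₁ h G.A

/-- The weight in the error bound for the homogeneous subsystem; `G` is the balanced
realization, `Y` the solution of the mixed equation, `Pt` the reduced Gramian. -/
def weight {n m q p r : ℕ} (h : r ≤ n) (γ : ℝ) (G : BilinearSystem n m q p) (μ : Method)
    (Y : Matrix (Fin n) (Fin r) ℝ) (Pt : Matrix (Fin r) (Fin r) ℝ) :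
    Matrix (Fin (n - r)) (Fin (n - r)) ℝ :=
  rows₂ h G.X₀ * (rows₂ h G.X₀)ᵀ
    + (2 : ℝ) • (rows₂ h Y * (boldA₂₁ h G μ)ᵀ)
    + (2 : ℝ) • (rows₂ h G.A * Y * (boldAbar₂₁ h G μ)ᵀ)
    + (1 / γ ^ 2) • ∑ k, ((2 : ℝ) • (rows₂ h (G.N k) * Y * (boldN₂₁ h G μ k)ᵀ)
        - boldN₂₁ h G μ k * Pt * (boldN₂₁ h G μ k)ᵀ)

/-- `diag(θ_{r+1}, …, θ_n)`. -/
def truncatedDiag {n r : ℕ} (h : r ≤ n) (θ : Fin n → ℝ) :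
    Matrix (Fin (n - r)) (Fin (n - r)) ℝ :=
  Matrix.diagonal fun i => θ (idx₂ h i)

/-- `x` is continuous on `[0, ∞)` and solves there, in integrated form,
`x' = A x + B u + ∑ k, (N k x + E k u) (u k)`, `x 0 = x₀`. -/
def IsSolution {n m : ℕ} (A : Matrix (Fin n) (Fin n) ℝ) (B : Matrix (Fin n) (Fin m) ℝ)
    (N : Fin m → Matrix (Fin n) (Fin n) ℝ) (E : Fin m → Matrix (Fin n) (Fin m) ℝ)
    (x₀ : Fin n → ℝ) (u : ℝ → Fin m → ℝ) (x : ℝ → Fin n → ℝ) : Prop :=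
  ContinuousOn x (Set.Ici 0) ∧ ∀ t : ℝ, 0 ≤ t →
    x t = x₀ + ∫ s in (0 : ℝ)..t,
      (A *ᵥ x s + B *ᵥ u s + ∑ k, u s k • (N k *ᵥ x s + E k *ᵥ u s))

/-- `f ∈ L²([0, ∞); ℝᵈ)` with respect to the Euclidean norm. -/
def SquareIntegrable {d : ℕ} (f : ℝ → Fin d → ℝ) : Prop :=
  MemLp (fun t => WithLp.toLp 2 (f t)) 2 (volume.restrict (Set.Ioi (0 : ℝ)))

/-- The norm of `L²([0, ∞); ℝᵈ)`. -/
def l2Norm {d : ℕ} (f : ℝ → Fin d → ℝ) : ℝ :=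
  (eLpNorm (fun t => WithLp.toLp 2 (f t)) 2 (volume.restrict (Set.Ioi (0 : ℝ)))).toReal

open Classical in
/-- The controls that enter the bilinear part: `u k` is replaced by `0` where `N k = 0`. -/
def bilinearControl {n m : ℕ} (N : Fin m → Matrix (Fin n) (Fin n) ℝ) (u : ℝ → Fin m → ℝ) :
    ℝ → Fin m → ℝ :=
  fun t k => if N k = 0 then 0 else u t k

end BilinearMOR

end

open BilinearMOR

open BilinearMOR

noncomputable section

namespace BilinearMOR

open Filter Topology

/-! ### Linear flows in finite dimension -/

section LinearFlow

variable {V : Type*} [NormedAddCommGroup V] [NormedSpace ℝ V]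

/-! For a fixed control the state equation is affine in the state. Hence `y` is the sum of the
output of the homogeneous system started in `X₀ v₀` and the output of the inhomogeneous system
started in `0`, both driven by the same `u`. Each part is compared with its own reduced model on a
finite horizon `[0, T]`. Minkowski's inequality adds the two bounds, and since they do not depend on
`T`, letting `T → ∞` gives square integrability and the estimate.

The exponential has the same origin in both parts. For a quadratic storage function `V = xᵀ S x`
with `S ≥ 0`, Young's inequality bounds `2 u_k xᵀ S N_k x` by `γ⁻² (N_k x)ᵀ S (N_k x) + γ² u_k² xᵀ S
x`. The first term is absorbed by the Gramian (in)equality, the second leaves `γ² |u⁰|² V`, and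
Gronwall's lemma (`integral_le_of_dissipation`) turns this into the factor `exp ‖γ u⁰‖²` for the
squared error.

Homogeneous part. The error system has block diagonal coefficients and reachability Gramian `𝒫 = [Θ,
Y; Yᵀ, P̃]`. The storage function `xᵀ Φ(T - t) x`, with `Φ` the observability Gramian of a finite
horizon, bounds the squared error by `exp(..) tr(𝒞 𝒫 𝒞ᵀ) |v₀|²` (`homogeneous_energy_le`); no
infinite-horizon Gramian of the error system is needed. Both schemes compress the full coefficients
with `J = [1; Ā₂₁]`. Pairing the reachability equations with the observability equations of `Θ` and
`Θ₁` makes all contributions of `Θ₁` cancel and leaves `tr(Θ₂ W)` (`IsCompression.trace_eq`). That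
`𝒫 ≥ 0` and that `Y` exists uniquely follow from positivity of Lyapunov flows
(`lyap_flow_posSemidef`) and from the decay of the mixed flow (`mixed_flow_tendsto_zero`), where one
diagonal block tends to zero and the other stays bounded.

Inhomogeneous part. BT and SPA are the cases `(α, β) = (1, 0)` and `(0, 1)` of the relation `α x₂ =
β (A x + B u)₂` for the trailing coordinates. Coordinates are removed one at a time. With `x` and
`y` the signals before and after the removal of `κ`, the observability inequality applied to `x - y`
and `σ_κ²` times the reachability inequality applied to `x + y` show that the step costs at most `2
σ_κ ‖u‖` (`sum_stepRate_le`). Intermediate models exist if `α > 0`, because `A` is dissipative in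
the `Σ` inner product. For SPA they might be singular, so `α = ε β` is used and `ε → 0`
(`reduction_error_le`). -/

theorem hasDerivAt_exp_smul_apply [CompleteSpace V] (F : V →L[ℝ] V) (v : V) (t : ℝ) :
    HasDerivAt (fun s : ℝ => NormedSpace.exp (s • F) v) (F (NormedSpace.exp (t • F) v)) t := by
  have h := hasDerivAt_exp_smul_const' (𝕂 := ℝ) F t
  exact (ContinuousLinearMap.apply ℝ V v).hasFDerivAt.comp_hasDerivAt t h

theorem exists_linear_flow [CompleteSpace V] (F : V →L[ℝ] V) (v : V) :
    ∃ z : ℝ → V, z 0 = v ∧ ∀ t, HasDerivAt z (F (z t)) t := by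
  refine ⟨fun t => NormedSpace.exp (t • F) v, ?_, hasDerivAt_exp_smul_apply F v⟩
  change NormedSpace.exp ((0 : ℝ) • F) v = v
  rw [zero_smul ℝ F, NormedSpace.exp_zero]; rfl

theorem linear_flow_unique (F : V →L[ℝ] V) {f g : ℝ → V}
    (hf : ∀ t, 0 ≤ t → HasDerivWithinAt f (F (f t)) (Set.Ici 0) t)
    (hg : ∀ t, 0 ≤ t → HasDerivWithinAt g (F (g t)) (Set.Ici 0) t) (h0 : f 0 = g 0)
    {t : ℝ} (ht : 0 ≤ t) : f t = g t := by
  have key : Set.EqOn f g (Set.Icc 0 t) := by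
    refine ODE_solution_unique (v := fun _ => F) (K := ‖F‖₊) (fun _ => F.lipschitz) ?_ ?_ ?_ ?_ h0
    · exact fun s hs => ((hf s hs.1).continuousWithinAt).mono Set.Icc_subset_Ici_self
    · exact fun s hs => (hf s hs.1).mono (Set.Ici_subset_Ici.2 hs.1)
    · exact fun s hs => ((hg s hs.1).continuousWithinAt).mono Set.Icc_subset_Ici_self
    · exact fun s hs => (hg s hs.1).mono (Set.Ici_subset_Ici.2 hs.1)
  exact key ⟨ht, le_rfl⟩

end LinearFlow

theorem tendsto_pow_mul_cexp_nhds_zero (j : ℕ) {μ : ℂ} (hμ : μ.re < 0) :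
    Tendsto (fun t : ℝ => (t : ℂ) ^ j * Complex.exp (t * μ)) atTop (𝓝 0) := by
  rw [tendsto_zero_iff_norm_tendsto_zero]
  have h := Real.tendsto_pow_mul_exp_neg_atTop_nhds_zero j
  have hb : 0 < -μ.re := by linarith
  have h2 := (h.comp (tendsto_id.const_mul_atTop hb)).const_mul ((-μ.re)⁻¹ ^ j)
  rw [mul_zero] at h2
  refine h2.congr' ?_
  filter_upwards [eventually_ge_atTop 0] with t ht
  have h3 : (-μ.re)⁻¹ * (-μ.re * t) = t := by
    rw [← mul_assoc, inv_mul_cancel₀ hb.ne', one_mul]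
  simp only [Function.comp, id, norm_mul, norm_pow, Complex.norm_exp, Complex.norm_real,
    Real.norm_of_nonneg ht]
  rw [← mul_assoc, ← mul_pow, h3]
  congr 2
  simp
  ring

/-- The initial vectors whose trajectory decays form a complex subspace. It contains every
generalized eigenspace, on which the flow is a polynomial in `t` times `exp (t μ)`, and these spaces
span. -/
theorem flow_tendsto_zero_of_spectrum {ι : Type*} [Fintype ι] [DecidableEq ι]
    (M : Matrix ι ι ℂ) (hM : ∀ μ ∈ spectrum ℂ M, μ.re < 0) {z : ℝ → ι → ℂ}
    (hz : ∀ t, 0 ≤ t → HasDerivWithinAt z (M *ᵥ z t) (Set.Ici 0) t) :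
    Tendsto z atTop (𝓝 0) := by
  classical
  set f : Module.End ℂ (ι → ℂ) := Matrix.toLin' M with hf
  set F : (ι → ℂ) →L[ℝ] (ι → ℂ) := (LinearMap.toContinuousLinearMap f).restrictScalars ℝ with hF
  have hFf : ∀ v, F v = f v := fun v => rfl
  let E : ℝ → (ι → ℂ) → (ι → ℂ) := fun t v => NormedSpace.exp (t • F) v
  have hE : ∀ v t, HasDerivAt (fun s => E s v) (F (E t v)) t := fun v t =>
    hasDerivAt_exp_smul_apply F v t
  have hE0 : ∀ v, E 0 v = v := fun v => by
    change NormedSpace.exp ((0 : ℝ) • F) v = v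
    rw [zero_smul ℝ F, NormedSpace.exp_zero]; rfl
  have huniq : ∀ (g : ℝ → ι → ℂ), (∀ t, 0 ≤ t → HasDerivWithinAt g (F (g t)) (Set.Ici 0) t) →
      ∀ t, 0 ≤ t → g t = E t (g 0) := fun g hg t ht =>
    linear_flow_unique F hg (fun s _ => (hE _ s).hasDerivWithinAt) (hE0 _).symm ht
  let S : Submodule ℂ (ι → ℂ) :=
    { carrier := {v | Tendsto (fun t => E t v) atTop (𝓝 0)}
      zero_mem' := by simp [E]
      add_mem' := by
        intro a b ha hb
        have := ha.add hb
        simpa [E] using this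
      smul_mem' := by
        intro c a ha
        have h1 := ha.const_smul c
        rw [smul_zero] at h1
        refine h1.congr' ?_
        filter_upwards [eventually_ge_atTop 0] with t ht
        -- The exponential is taken over `ℝ`, so complex homogeneity in the initial vector is
        -- derived from uniqueness.
        have := huniq (fun t => c • E t a) (fun s _ => by
          have := ((hE a s).const_smul c).hasDerivWithinAt (s := Set.Ici 0)
          rw [hFf] at this ⊢
          rw [map_smul]
          exact this) t ht
        simpa [hE0] using this }
  have hS : S = ⊤ := by
    rw [eq_top_iff, ← Module.End.iSup_maxGenEigenspace_eq_top f]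
    refine iSup_le fun μ => ?_
    intro v hv
    by_cases hv0 : v = 0
    · rw [hv0]; exact S.zero_mem
    obtain ⟨k, hk⟩ := Module.End.mem_maxGenEigenspace f μ v |>.1 hv
    have hμ : μ.re < 0 := by
      apply hM
      rw [← Matrix.spectrum_toLin', ← Module.End.hasEigenvalue_iff_mem_spectrum]
      by_contra hne
      have : f.maxGenEigenspace μ = ⊥ := by
        rw [Module.End.maxGenEigenspace]
        by_contra h2
        exact hne (Module.End.hasEigenvalue_of_hasGenEigenvalue
          (k := Module.End.maxGenEigenspaceIndex f μ) (by
            rw [Module.End.HasGenEigenvalue, Module.End.HasUnifEigenvalue]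
            rw [← Module.End.maxGenEigenspace, Module.End.maxGenEigenspace_eq] at h2
            exact h2))
      rw [this] at hv
      exact hv0 hv
    set g : Module.End ℂ (ι → ℂ) := f - algebraMap ℂ _ μ with hg
    have hgk : (g ^ k) v = 0 := hk
    -- This is `exp (t μ) exp (t (f - μ)) v`; the series stops because `(f - μ)^k v = 0`.
    let w : ℝ → ι → ℂ := fun t =>
      ∑ j ∈ Finset.range k, ((t : ℂ) ^ j * Complex.exp (t * μ)) • (((j.factorial : ℂ)⁻¹) • (g ^ j) v)
    have hw0 : k ≠ 0 → w 0 = v := by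
      intro hk0
      obtain ⟨k', rfl⟩ := Nat.exists_eq_succ_of_ne_zero hk0
      simp [w, Finset.sum_range_succ']
    have hk0 : k ≠ 0 := by
      rintro rfl
      simp at hgk
      exact hv0 hgk
    have hwlim : Tendsto w atTop (𝓝 0) := by
      have : Tendsto w atTop (𝓝 (∑ j ∈ Finset.range k, (0 : ℂ) •
          (((j.factorial : ℂ)⁻¹) • (g ^ j) v))) :=
        tendsto_finsetSum _ fun j _ => (tendsto_pow_mul_cexp_nhds_zero j hμ).smul_const _
      simpa using this
    have hwd : ∀ t, HasDerivAt w (F (w t)) t := by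
      intro t
      have hofReal : HasDerivAt (fun s : ℝ => (s : ℂ)) 1 t := Complex.ofRealCLM.hasDerivAt
      have hexp : HasDerivAt (fun s : ℝ => Complex.exp (s * μ)) (Complex.exp (t * μ) * μ) t := by
        have := (hofReal.mul_const μ).cexp
        simpa using this
      have h1 : HasDerivAt w (∑ j ∈ Finset.range k,
          ((j : ℂ) * (t : ℂ) ^ (j - 1) * 1 * Complex.exp (t * μ)
            + (t : ℂ) ^ j * (Complex.exp (t * μ) * μ)) •
            (((j.factorial : ℂ)⁻¹) • (g ^ j) v)) t := by
        have := HasDerivAt.fun_sum (u := Finset.range k) (x := t)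
          (A := fun j (t : ℝ) => ((t : ℂ) ^ j * Complex.exp (t * μ)) •
            (((j.factorial : ℂ)⁻¹) • (g ^ j) v))
          (A' := fun j => ((j : ℂ) * (t : ℂ) ^ (j - 1) * 1 * Complex.exp (t * μ)
            + (t : ℂ) ^ j * (Complex.exp (t * μ) * μ)) • (((j.factorial : ℂ)⁻¹) • (g ^ j) v))
          (fun j _ => (((hofReal.pow j).mul hexp).smul_const _))
        exact this
      convert! h1 using 1
      rw [hFf]
      have hfg : f = g + algebraMap ℂ _ μ := by rw [hg]; abel
      rw [hfg, LinearMap.add_apply, Module.algebraMap_end_apply]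
      have hgw : g (w t) = ∑ j ∈ Finset.range k, ((t : ℂ) ^ j * Complex.exp (t * μ)) •
          (((j.factorial : ℂ)⁻¹) • (g ^ (j + 1)) v) := by
        simp only [w, map_sum, map_smul]
        refine Finset.sum_congr rfl fun j _ => ?_
        rw [pow_succ', Module.End.mul_apply]
      have hμw : μ • w t = ∑ j ∈ Finset.range k, ((t : ℂ) ^ j * (Complex.exp (t * μ) * μ)) •
            (((j.factorial : ℂ)⁻¹) • (g ^ j) v) := by
        simp only [w, Finset.smul_sum, smul_smul]
        refine Finset.sum_congr rfl fun j _ => ?_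
        ring_nf
      rw [hgw, hμw]
      simp only [add_smul, Finset.sum_add_distrib]
      congr 1
      -- Index shift: the top term of one sum contains `g ^ k v = 0`, the bottom term of the other
      -- carries the factor `j = 0`.
      obtain ⟨k', rfl⟩ := Nat.exists_eq_succ_of_ne_zero hk0
      rw [Finset.sum_range_succ, hgk, smul_zero, smul_zero, add_zero, Finset.sum_range_succ']
      simp only [Nat.cast_zero, zero_mul, zero_smul, add_zero, smul_smul]
      refine Finset.sum_congr rfl fun j _ => ?_
      congr 1
      rw [Nat.factorial_succ]
      have : ((j : ℂ) + 1) ≠ 0 := by exact_mod_cast Nat.succ_ne_zero j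
      push_cast
      field_simp
    have hwE : ∀ t, 0 ≤ t → w t = E t v := fun t ht => by
      rw [huniq w (fun s _ => (hwd s).hasDerivWithinAt) t ht, hw0 hk0]
    refine hwlim.congr' ?_
    filter_upwards [eventually_ge_atTop 0] with t ht using hwE t ht
  have hz0 : z 0 ∈ S := by rw [hS]; trivial
  refine Tendsto.congr' ?_ (show Tendsto (fun t => E t (z 0)) atTop (𝓝 0) from hz0)
  filter_upwards [eventually_ge_atTop 0] with t ht
  exact (huniq z (fun s hs => by simpa [hFf, hf] using hz s hs) t ht).symm

/-! ### Quadratic forms -/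

section QuadForm

variable {ι : Type*} [Fintype ι]

theorem posSemidef_iff_quadForm {M : Matrix ι ι ℝ} :
    M.PosSemidef ↔ Mᵀ = M ∧ ∀ v : ι → ℝ, 0 ≤ v ⬝ᵥ (M *ᵥ v) := by
  constructor
  · intro h
    refine ⟨by simpa [Matrix.IsHermitian] using h.isHermitian, fun v => ?_⟩
    simpa using h.dotProduct_mulVec_nonneg v
  · rintro ⟨h1, h2⟩
    refine Matrix.PosSemidef.of_dotProduct_mulVec_nonneg ?_ fun v => by simpa using h2 v
    simpa [Matrix.IsHermitian] using h1

theorem quadForm_eq_sum (M : Matrix ι ι ℝ) (v : ι → ℝ) :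
    v ⬝ᵥ (M *ᵥ v) = ∑ i, ∑ j, v i * M i j * v j := by
  simp only [dotProduct, Matrix.mulVec, Finset.mul_sum, mul_assoc]

theorem abs_mul_le_dotProduct_self (v : ι → ℝ) (i j : ι) : |v i| * |v j| ≤ v ⬝ᵥ v := by
  have h : ∀ i, v i * v i ≤ v ⬝ᵥ v := fun i =>
    Finset.single_le_sum (f := fun i => v i * v i) (fun _ _ => mul_self_nonneg _)
      (Finset.mem_univ i)
  have h1 := h i
  have h2 := h j
  rw [← abs_mul_abs_self] at h1 h2
  nlinarith [sq_nonneg (|v i| - |v j|)]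

theorem dotProduct_self_nonneg' (v : ι → ℝ) : 0 ≤ v ⬝ᵥ v :=
  Finset.sum_nonneg fun _ _ => mul_self_nonneg _

theorem abs_quadForm_le {M : Matrix ι ι ℝ} {b : ℝ} (hb : ∀ i j, |M i j| ≤ b) (v : ι → ℝ) :
    |v ⬝ᵥ (M *ᵥ v)| ≤ (∑ _i : ι, ∑ _j : ι, b) * (v ⬝ᵥ v) := by
  rw [quadForm_eq_sum, Finset.sum_mul]
  refine (Finset.abs_sum_le_sum_abs _ _).trans (Finset.sum_le_sum fun i _ => ?_)
  rw [Finset.sum_mul]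
  refine (Finset.abs_sum_le_sum_abs _ _).trans (Finset.sum_le_sum fun j _ => ?_)
  rw [abs_mul, abs_mul, mul_comm |v i|, mul_assoc]
  exact mul_le_mul (hb i j) (abs_mul_le_dotProduct_self v i j) (by positivity)
    ((abs_nonneg _).trans (hb i j))

theorem exists_quadForm_bound (M : Matrix ι ι ℝ) :
    ∃ c : ℝ, 0 ≤ c ∧ ∀ v : ι → ℝ, |v ⬝ᵥ (M *ᵥ v)| ≤ c * (v ⬝ᵥ v) := by
  have hb : ∀ i j, |M i j| ≤ ∑ i, ∑ j, |M i j| := fun i j =>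
    (Finset.single_le_sum (f := fun j => |M i j|) (fun j _ => abs_nonneg _)
      (Finset.mem_univ j)).trans
    (Finset.single_le_sum (f := fun i => ∑ j, |M i j|)
      (fun i _ => Finset.sum_nonneg fun j _ => abs_nonneg _) (Finset.mem_univ i))
  refine ⟨_, ?_, abs_quadForm_le hb⟩
  positivity

theorem dotProduct_transpose_mulVec_comm (M : Matrix ι ι ℝ) (v w : ι → ℝ) :
    v ⬝ᵥ (M *ᵥ w) = (Mᵀ *ᵥ v) ⬝ᵥ w := by
  rw [Matrix.dotProduct_mulVec, Matrix.mulVec_transpose]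

/-- The form at `e_i + s e_j` is a nonnegative quadratic polynomial in `s`, so its discriminant is
not positive. -/
theorem sq_apply_le_of_posSemidef {M : Matrix ι ι ℝ} (hM : M.PosSemidef) (i j : ι) :
    M i j ^ 2 ≤ M i i * M j j := by
  classical
  obtain ⟨hs, hq⟩ := posSemidef_iff_quadForm.1 hM
  have hsym : M j i = M i j := congrFun (congrFun hs i) j
  have h : ∀ s : ℝ, 0 ≤ M j j * (s * s) + (2 * M i j) * s + M i i := by
    intro s
    have := hq (Pi.single i 1 + s • Pi.single j 1)
    simp only [Matrix.mulVec_add, Matrix.mulVec_smul, add_dotProduct, smul_dotProduct,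
      dotProduct_add, dotProduct_smul, Matrix.mulVec_single_one, single_one_dotProduct,
      Matrix.col_apply, smul_eq_mul, hsym] at this
    linarith
  have := discrim_le_zero h
  rw [discrim] at this
  linarith

theorem diag_nonneg_of_posSemidef {M : Matrix ι ι ℝ} (hM : M.PosSemidef) (i : ι) :
    0 ≤ M i i := by
  classical
  have := (posSemidef_iff_quadForm.1 hM).2 (Pi.single i 1)
  simpa using this

theorem hasDerivWithinAt_quadForm {x : ℝ → ι → ℝ} {x' : ι → ℝ} {Φ : ℝ → Matrix ι ι ℝ}
    {Φ' : Matrix ι ι ℝ} {s : Set ℝ} {t : ℝ}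
    (hx : ∀ i, HasDerivWithinAt (fun τ => x τ i) (x' i) s t)
    (hΦ : ∀ i j, HasDerivWithinAt (fun τ => Φ τ i j) (Φ' i j) s t) :
    HasDerivWithinAt (fun τ => x τ ⬝ᵥ (Φ τ *ᵥ x τ))
      (x' ⬝ᵥ (Φ t *ᵥ x t) + x t ⬝ᵥ (Φ' *ᵥ x t) + x t ⬝ᵥ (Φ t *ᵥ x')) s t := by
  have h : HasDerivWithinAt (fun τ => ∑ i, ∑ j, x τ i * Φ τ i j * x τ j)
      (∑ i, ∑ j, ((x' i * Φ t i j + x t i * Φ' i j) * x t j + x t i * Φ t i j * x' j)) s t :=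
    HasDerivWithinAt.fun_sum fun i _ => HasDerivWithinAt.fun_sum fun j _ =>
      ((hx i).mul (hΦ i j)).mul (hx j)
  simp only [quadForm_eq_sum]
  convert! h using 1
  simp only [dotProduct, Matrix.mulVec, Finset.mul_sum, ← Finset.sum_add_distrib]
  refine Finset.sum_congr rfl fun i _ => Finset.sum_congr rfl fun j _ => ?_
  ring

theorem hasDerivAt_quadForm {x : ℝ → ι → ℝ} {x' : ι → ℝ} {Φ : ℝ → Matrix ι ι ℝ}
    {Φ' : Matrix ι ι ℝ} {t : ℝ} (hx : ∀ i, HasDerivAt (fun τ => x τ i) (x' i) t)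
    (hΦ : ∀ i j, HasDerivAt (fun τ => Φ τ i j) (Φ' i j) t) :
    HasDerivAt (fun τ => x τ ⬝ᵥ (Φ τ *ᵥ x τ))
      (x' ⬝ᵥ (Φ t *ᵥ x t) + x t ⬝ᵥ (Φ' *ᵥ x t) + x t ⬝ᵥ (Φ t *ᵥ x')) t := by
  simp only [← hasDerivWithinAt_univ] at hx hΦ ⊢
  exact hasDerivWithinAt_quadForm hx hΦ

end QuadForm

/-! ### Flows of generalized Sylvester operators -/

section MatrixFlow

variable {ι ι' κ : Type*} [Fintype ι] [Fintype ι'] [Fintype κ]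

/-- The operator `X ↦ A X + X A'ᵀ + γ⁻² ∑ k, N k X (N' k)ᵀ`. -/
def sylv (γ : ℝ) (A : Matrix ι ι ℝ) (N : κ → Matrix ι ι ℝ) (A' : Matrix ι' ι' ℝ)
    (N' : κ → Matrix ι' ι' ℝ) : Matrix ι ι' ℝ →ₗ[ℝ] Matrix ι ι' ℝ where
  toFun X := A * X + X * A'ᵀ + (1 / γ ^ 2) • ∑ k, N k * X * (N' k)ᵀ
  map_add' X Y := by
    simp only [Matrix.mul_add, Matrix.add_mul, Finset.sum_add_distrib, smul_add]
    abel
  map_smul' c X := by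
    simp only [Matrix.mul_smul, Matrix.smul_mul, ← Finset.smul_sum, smul_add, RingHom.id_apply]
    rw [smul_comm c]

theorem sylv_apply (γ : ℝ) (A : Matrix ι ι ℝ) (N : κ → Matrix ι ι ℝ) (A' : Matrix ι' ι' ℝ)
    (N' : κ → Matrix ι' ι' ℝ) (X : Matrix ι ι' ℝ) :
    sylv γ A N A' N' X = A * X + X * A'ᵀ + (1 / γ ^ 2) • ∑ k, N k * X * (N' k)ᵀ := rfl

/-- `Z' = L Z` on `[0, ∞)`, entrywise. -/
def IsMatrixFlow (L : Matrix ι ι' ℝ →ₗ[ℝ] Matrix ι ι' ℝ) (Z : ℝ → Matrix ι ι' ℝ) : Prop :=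
  ∀ t : ℝ, 0 ≤ t → ∀ i j, HasDerivWithinAt (fun s => Z s i j) (L (Z t) i j) (Set.Ici 0) t

section
open scoped Matrix.Norms.Elementwise

theorem exists_matrixFlow (L : Matrix ι ι' ℝ →ₗ[ℝ] Matrix ι ι' ℝ) (K : Matrix ι ι' ℝ) :
    ∃ Z : ℝ → Matrix ι ι' ℝ, Z 0 = K ∧
      ∀ t i j, HasDerivAt (fun s => Z s i j) (L (Z t) i j) t := by
  obtain ⟨Z, h0, hZ⟩ := exists_linear_flow (LinearMap.toContinuousLinearMap L) K
  exact ⟨Z, h0, fun t i j => hasDerivAt_pi.1 (hasDerivAt_pi.1 (hZ t) i) j⟩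

theorem IsMatrixFlow.unique {L : Matrix ι ι' ℝ →ₗ[ℝ] Matrix ι ι' ℝ} {Z W : ℝ → Matrix ι ι' ℝ}
    (hZ : IsMatrixFlow L Z) (hW : IsMatrixFlow L W) (h0 : Z 0 = W 0) {t : ℝ} (ht : 0 ≤ t) :
    Z t = W t := by
  set F := LinearMap.toContinuousLinearMap L
  refine linear_flow_unique F (fun s hs => ?_) (fun s hs => ?_) h0 ht
  · exact hasDerivWithinAt_pi.2 fun i => hasDerivWithinAt_pi.2 fun j => hZ s hs i j
  · exact hasDerivWithinAt_pi.2 fun i => hasDerivWithinAt_pi.2 fun j => hW s hs i j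

theorem hasDerivWithinAt_linearMap_apply {ι₂ ι₂' : Type*} [Fintype ι₂] [Fintype ι₂']
    (L : Matrix ι ι' ℝ →ₗ[ℝ] Matrix ι₂ ι₂' ℝ) {Z : ℝ → Matrix ι ι' ℝ} {Z' : Matrix ι ι' ℝ}
    {s : Set ℝ} {t : ℝ} (hZ : ∀ i j, HasDerivWithinAt (fun τ => Z τ i j) (Z' i j) s t) (i : ι₂)
    (j : ι₂') : HasDerivWithinAt (fun τ => L (Z τ) i j) (L Z' i j) s t := by
  have h : HasDerivWithinAt Z Z' s t :=
    hasDerivWithinAt_pi.2 fun i => hasDerivWithinAt_pi.2 fun j => hZ i j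
  have := (LinearMap.toContinuousLinearMap L).hasFDerivAt.comp_hasDerivWithinAt t h
  exact hasDerivWithinAt_pi.1 (hasDerivWithinAt_pi.1 this i) j

end

theorem exists_vectorFlow (M : Matrix ι ι ℝ) (w : ι → ℝ) :
    ∃ z : ℝ → ι → ℝ, z 0 = w ∧ ∀ t i, HasDerivAt (fun s => z s i) ((M *ᵥ z t) i) t := by
  obtain ⟨z, h0, hz⟩ := exists_linear_flow
    (LinearMap.toContinuousLinearMap (Matrix.mulVecLin M)) w
  exact ⟨z, h0, fun t i => hasDerivAt_pi.1 (hz t) i⟩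

theorem IsMatrixFlow.continuousOn {L : Matrix ι ι' ℝ →ₗ[ℝ] Matrix ι ι' ℝ}
    {Z : ℝ → Matrix ι ι' ℝ} (hZ : IsMatrixFlow L Z) (i : ι) (j : ι') :
    ContinuousOn (fun s => Z s i j) (Set.Ici 0) := fun t ht =>
  (hZ t ht i j).continuousWithinAt

theorem isMatrixFlow_of_hasDerivAt {L : Matrix ι ι' ℝ →ₗ[ℝ] Matrix ι ι' ℝ}
    {Z : ℝ → Matrix ι ι' ℝ} (hZ : ∀ t i j, HasDerivAt (fun s => Z s i j) (L (Z t) i j) t) :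
    IsMatrixFlow L Z := fun t _ i j => (hZ t i j).hasDerivWithinAt

theorem IsMatrixFlow.apply_linear {L : Matrix ι ι' ℝ →ₗ[ℝ] Matrix ι ι' ℝ}
    {Z : ℝ → Matrix ι ι' ℝ} (hZ : IsMatrixFlow L Z) : IsMatrixFlow L (fun t => L (Z t)) :=
  fun t ht i j => hasDerivWithinAt_linearMap_apply L (hZ t ht) i j

theorem sylv_transpose (γ : ℝ) (A : Matrix ι ι ℝ) (N : κ → Matrix ι ι ℝ) (A' : Matrix ι' ι' ℝ)
    (N' : κ → Matrix ι' ι' ℝ) (X : Matrix ι ι' ℝ) :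
    (sylv γ A N A' N' X)ᵀ = sylv γ A' N' A N Xᵀ := by
  simp only [sylv_apply, Matrix.transpose_add, Matrix.transpose_mul, Matrix.transpose_transpose,
    Matrix.transpose_smul, Matrix.transpose_sum, Matrix.mul_assoc]
  abel

/-- Along `y' = -Aᵀ y` the drift terms cancel and `yᵀ Z y` has derivative `γ⁻² ∑ (N_kᵀ y)ᵀ Z (N_kᵀ
y)`. A lower bound `-c exp (l s) |w|²` for all forms on `[0, t]` therefore improves itself to the
same bound with `c / 2`. Iteration drives the constant to zero. -/
theorem lyap_flow_quadForm_nonneg {γ : ℝ} {A : Matrix ι ι ℝ} {N : κ → Matrix ι ι ℝ}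
    {Z : ℝ → Matrix ι ι ℝ} (hZ : IsMatrixFlow (sylv γ A N A N) Z)
    (h0 : ∀ v : ι → ℝ, 0 ≤ v ⬝ᵥ (Z 0 *ᵥ v)) {t : ℝ} (ht : 0 ≤ t) (v : ι → ℝ) :
    0 ≤ v ⬝ᵥ (Z t *ᵥ v) := by
  obtain ⟨α, hα0, hα⟩ := exists_quadForm_bound A
  obtain ⟨ν, hν0, hν⟩ := exists_quadForm_bound ((1 / γ ^ 2) • ∑ k, N k * (N k)ᵀ)
  -- Half of this rate pays for the growth `α` of `|y|²` and for the bound `ν` on the `N_k` terms;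
  -- this balance is what produces the factor `1 / 2`.
  set l : ℝ := 2 * α + 2 * ν with hl
  let P : ℝ → Prop := fun c => ∀ s ∈ Set.Icc 0 t, ∀ w : ι → ℝ,
    -(c * Real.exp (l * s) * (w ⬝ᵥ w)) ≤ w ⬝ᵥ (Z s *ᵥ w)
  have hstep : ∀ c, 0 ≤ c → P c → P (c / 2) := by
    intro c hc hP s hs w
    -- The adjoint trajectory is shifted so that it passes through `w` at time `s`.
    obtain ⟨z, hz0, hz⟩ := exists_vectorFlow (-Aᵀ) w
    set y : ℝ → ι → ℝ := fun τ => z (τ - s) with hy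
    have hyd : ∀ τ i, HasDerivAt (fun τ => y τ i) ((-Aᵀ *ᵥ y τ) i) τ := fun τ i =>
      HasDerivAt.comp_sub_const (f := fun s => z s i) τ s (hz (τ - s) i)
    have hys : y s = w := by simp [hy, hz0]
    let h : ℝ → ℝ := fun τ => y τ ⬝ᵥ (Z τ *ᵥ y τ)
      + c / 2 * (Real.exp (l * τ) * (y τ ⬝ᵥ y τ))
    have hd : ∀ τ, 0 ≤ τ → HasDerivWithinAt h
        (((-Aᵀ *ᵥ y τ) ⬝ᵥ (Z τ *ᵥ y τ) + y τ ⬝ᵥ (sylv γ A N A N (Z τ) *ᵥ y τ)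
          + y τ ⬝ᵥ (Z τ *ᵥ (-Aᵀ *ᵥ y τ)))
          + c / 2 * (Real.exp (l * τ) * l * (y τ ⬝ᵥ y τ)
            + Real.exp (l * τ) * (2 * (y τ ⬝ᵥ (-Aᵀ *ᵥ y τ))))) (Set.Ici 0) τ := by
      intro τ hτ
      have h1 := hasDerivWithinAt_quadForm (fun i => (hyd τ i).hasDerivWithinAt (s := Set.Ici 0))
        (hZ τ hτ)
      have h2 : HasDerivAt (fun τ => Real.exp (l * τ)) (Real.exp (l * τ) * l) τ := by
        simpa using ((hasDerivAt_id τ).const_mul l).exp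
      have h3 : HasDerivAt (fun τ => y τ ⬝ᵥ y τ) (2 * (y τ ⬝ᵥ (-Aᵀ *ᵥ y τ))) τ := by
        have := HasDerivAt.fun_sum (u := Finset.univ) (x := τ) (A := fun i τ => y τ i * y τ i)
          (fun i _ => (hyd τ i).mul (hyd τ i))
        convert! this using 1
        rw [dotProduct, Finset.mul_sum]
        refine Finset.sum_congr rfl fun i _ => ?_
        ring
      exact h1.add ((h2.mul h3).const_mul (c / 2)).hasDerivWithinAt
    have hmono : MonotoneOn h (Set.Icc 0 s) := by
      refine monotoneOn_of_deriv_nonneg (convex_Icc 0 s)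
        (fun τ hτ => ((hd τ hτ.1).continuousWithinAt).mono Set.Icc_subset_Ici_self) ?_ ?_
      · intro τ hτ
        rw [interior_Icc] at hτ
        exact (((hd τ hτ.1.le).hasDerivAt (Ici_mem_nhds hτ.1)).differentiableAt).differentiableWithinAt
      · intro τ hτ
        rw [interior_Icc] at hτ
        rw [((hd τ hτ.1.le).hasDerivAt (Ici_mem_nhds hτ.1)).deriv]
        have e1 : (-Aᵀ *ᵥ y τ) ⬝ᵥ (Z τ *ᵥ y τ) + y τ ⬝ᵥ (sylv γ A N A N (Z τ) *ᵥ y τ)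
            + y τ ⬝ᵥ (Z τ *ᵥ (-Aᵀ *ᵥ y τ))
            = (1 / γ ^ 2) * ∑ k, ((N k)ᵀ *ᵥ y τ) ⬝ᵥ (Z τ *ᵥ ((N k)ᵀ *ᵥ y τ)) := by
          rw [sylv_apply, Matrix.add_mulVec, Matrix.add_mulVec, dotProduct_add, dotProduct_add,
            Matrix.smul_mulVec, Matrix.sum_mulVec, dotProduct_smul, dotProduct_sum,
            ← Matrix.mulVec_mulVec, dotProduct_transpose_mulVec_comm A, Matrix.neg_mulVec,
            neg_dotProduct, Matrix.mulVec_neg, dotProduct_neg, smul_eq_mul]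
          have : ∀ k, y τ ⬝ᵥ ((N k * Z τ * (N k)ᵀ) *ᵥ y τ)
              = ((N k)ᵀ *ᵥ y τ) ⬝ᵥ (Z τ *ᵥ ((N k)ᵀ *ᵥ y τ)) := fun k => by
            rw [Matrix.mul_assoc, ← Matrix.mulVec_mulVec, dotProduct_transpose_mulVec_comm,
              ← Matrix.mulVec_mulVec]
          simp only [this]
          simp only [← Matrix.mulVec_mulVec]
          ring
        have e2 : (1 / γ ^ 2) * ∑ k, ((N k)ᵀ *ᵥ y τ) ⬝ᵥ ((N k)ᵀ *ᵥ y τ) ≤ ν * (y τ ⬝ᵥ y τ) := by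
          refine le_trans (le_of_eq ?_) ((le_abs_self _).trans (hν (y τ)))
          rw [Matrix.smul_mulVec, Matrix.sum_mulVec, dotProduct_smul, dotProduct_sum, smul_eq_mul]
          congr 1
          refine Finset.sum_congr rfl fun k _ => ?_
          rw [← Matrix.mulVec_mulVec, dotProduct_transpose_mulVec_comm (N k)]
        have e3 : -(c * Real.exp (l * τ)) * ((1 / γ ^ 2) *
              ∑ k, ((N k)ᵀ *ᵥ y τ) ⬝ᵥ ((N k)ᵀ *ᵥ y τ))
            ≤ (1 / γ ^ 2) * ∑ k, ((N k)ᵀ *ᵥ y τ) ⬝ᵥ (Z τ *ᵥ ((N k)ᵀ *ᵥ y τ)) := by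
          rw [mul_left_comm, Finset.mul_sum]
          refine mul_le_mul_of_nonneg_left (Finset.sum_le_sum fun k _ => ?_) (by positivity)
          have := hP τ ⟨hτ.1.le, hτ.2.le.trans hs.2⟩ ((N k)ᵀ *ᵥ y τ)
          linarith
        have e4 : -(α * (y τ ⬝ᵥ y τ)) ≤ y τ ⬝ᵥ (-Aᵀ *ᵥ y τ) := by
          rw [Matrix.neg_mulVec, dotProduct_neg, dotProduct_transpose_mulVec_comm,
            Matrix.transpose_transpose, dotProduct_comm (A *ᵥ y τ)]
          exact neg_le_neg ((le_abs_self _).trans (hα (y τ)))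
        have hE : 0 ≤ c * Real.exp (l * τ) := by positivity
        rw [e1]
        have e5 := mul_le_mul_of_nonneg_left e2 hE
        have e6 := mul_le_mul_of_nonneg_left e4 hE
        have e7 : c / 2 * (Real.exp (l * τ) * l * (y τ ⬝ᵥ y τ)
            + Real.exp (l * τ) * (2 * (y τ ⬝ᵥ (-Aᵀ *ᵥ y τ))))
            = (c * Real.exp (l * τ)) * ((α + ν) * (y τ ⬝ᵥ y τ))
              + (c * Real.exp (l * τ)) * (y τ ⬝ᵥ (-Aᵀ *ᵥ y τ)) := by
          rw [hl]; ring
        rw [e7]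
        linarith
    have h00 : 0 ≤ h 0 := by
      have := dotProduct_self_nonneg' (y 0)
      have := h0 (y 0)
      positivity
    have := h00.trans (hmono ⟨le_rfl, hs.1⟩ ⟨hs.1, le_rfl⟩ hs.1)
    simp only [h, hys] at this
    linarith
  -- A first constant comes from compactness of `[0, t]`.
  obtain ⟨c₀, hc₀, hPc₀⟩ : ∃ c, 0 ≤ c ∧ P c := by
    have hbd : ∀ i j, ∃ b, ∀ s ∈ Set.Icc 0 t, |Z s i j| ≤ b := fun i j =>
      isCompact_Icc.exists_bound_of_continuousOn
        ((hZ.continuousOn i j).mono Set.Icc_subset_Ici_self)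
    choose b hb using hbd
    have hb' : ∀ s ∈ Set.Icc 0 t, ∀ i j, |Z s i j| ≤ ∑ i, ∑ j, |b i j| := fun s hs i j =>
      ((hb i j s hs).trans (le_abs_self _)).trans <|
        (Finset.single_le_sum (f := fun j => |b i j|) (fun j _ => abs_nonneg _)
          (Finset.mem_univ j)).trans
        (Finset.single_le_sum (f := fun i => ∑ j, |b i j|)
          (fun i _ => Finset.sum_nonneg fun j _ => abs_nonneg _) (Finset.mem_univ i))
    refine ⟨∑ _i : ι, ∑ _j : ι, ∑ i, ∑ j, |b i j|, by positivity, fun s hs w => ?_⟩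
    have h1 := (abs_le.1 (abs_quadForm_le (hb' s hs) w)).1
    refine le_trans (neg_le_neg ?_) h1
    have h2 : 1 ≤ Real.exp (l * s) := Real.one_le_exp (by have := hs.1; positivity)
    have h3 := dotProduct_self_nonneg' w
    refine mul_le_mul_of_nonneg_right (le_mul_of_one_le_right (by positivity) h2) h3
  have hall : ∀ j : ℕ, P (c₀ / 2 ^ j) := by
    intro j
    induction j with
    | zero => simpa using hPc₀
    | succ j ih =>
      have := hstep _ (by positivity) ih
      rwa [div_div, ← pow_succ] at this
  have hlim : Tendsto (fun j : ℕ => -(c₀ / 2 ^ j * Real.exp (l * t) * (v ⬝ᵥ v))) atTop (𝓝 0) := by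
    have h1 : Tendsto (fun j : ℕ => c₀ / (2 : ℝ) ^ j) atTop (𝓝 0) :=
      tendsto_const_nhds.div_atTop (tendsto_pow_atTop_atTop_of_one_lt one_lt_two)
    simpa using ((h1.mul_const (Real.exp (l * t))).mul_const (v ⬝ᵥ v)).neg
  exact le_of_tendsto hlim (Eventually.of_forall fun j => hall j t ⟨ht, le_rfl⟩ v)

theorem lyap_flow_posSemidef {γ : ℝ} {A : Matrix ι ι ℝ} {N : κ → Matrix ι ι ℝ}
    {Z : ℝ → Matrix ι ι ℝ} (hZ : IsMatrixFlow (sylv γ A N A N) Z) (h0 : (Z 0).PosSemidef)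
    {t : ℝ} (ht : 0 ≤ t) : (Z t).PosSemidef := by
  obtain ⟨hs, hq⟩ := posSemidef_iff_quadForm.1 h0
  refine posSemidef_iff_quadForm.2 ⟨?_, lyap_flow_quadForm_nonneg hZ hq ht⟩
  refine IsMatrixFlow.unique (Z := fun t => (Z t)ᵀ) (L := sylv γ A N A N) ?_ hZ hs ht
  intro s hs i j
  rw [← sylv_transpose]
  exact hZ s hs j i

end MatrixFlow

/-! ### Gramians and algebraic Lyapunov equations -/

section LinearFlowIntegral

variable {V : Type*} [NormedAddCommGroup V] [NormedSpace ℝ V] [CompleteSpace V]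

/-- Both `z` and `z' = F z` are integrable, hence `z → 0`, and integrating `z'` over the half line
gives the algebraic equation. -/
theorem apply_integral_linear_flow (F : V →L[ℝ] V) {z : ℝ → V}
    (hz : ∀ t, 0 ≤ t → HasDerivWithinAt z (F (z t)) (Set.Ici 0) t)
    (hint : IntegrableOn z (Set.Ioi 0)) : F (∫ s in Set.Ioi (0 : ℝ), z s) = -z 0 := by
  have hd : ∀ t ∈ Set.Ioi (0 : ℝ), HasDerivAt z (F (z t)) t := fun t ht =>
    (hz t (le_of_lt ht)).hasDerivAt (Ici_mem_nhds ht)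
  have hFint : IntegrableOn (fun t => F (z t)) (Set.Ioi 0) := F.integrable_comp hint
  have hlim := tendsto_zero_of_hasDerivAt_of_integrableOn_Ioi hd hFint hint
  have h := integral_Ioi_of_hasDerivAt_of_tendsto (hz 0 le_rfl).continuousWithinAt hd hFint hlim
  rw [← F.integral_comp_comm hint, h, zero_sub]

/-- A flow started in `∫ z` equals `∫ z` over `[t, ∞)`: the curves `F h` and `-z` solve the same
equation with the same initial value, so `h' = -z`. This gives decay of the Gramian's own trajectory
without any spectral assumption. -/
theorem linear_flow_tendsto_zero_of_integral (F : V →L[ℝ] V) {z h : ℝ → V}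
    (hz : ∀ t, 0 ≤ t → HasDerivWithinAt z (F (z t)) (Set.Ici 0) t)
    (hint : IntegrableOn z (Set.Ioi 0))
    (hh : ∀ t, 0 ≤ t → HasDerivWithinAt h (F (h t)) (Set.Ici 0) t)
    (h0 : h 0 = ∫ s in Set.Ioi (0 : ℝ), z s) : Tendsto h atTop (𝓝 0) := by
  have h1 : ∀ t, 0 ≤ t → F (h t) = -z t := fun t ht =>
    linear_flow_unique F (f := fun t => F (h t)) (g := fun t => -z t)
      (fun s hs => F.hasFDerivAt.comp_hasDerivWithinAt s (hh s hs))
      (fun s hs => by rw [map_neg]; exact (hz s hs).neg)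
      (by rw [h0, apply_integral_linear_flow F hz hint]) ht
  have h2 : ∀ t, 0 ≤ t → h t = h 0 - ∫ s in (0 : ℝ)..t, z s := by
    intro t ht
    have hI : IntervalIntegrable z volume 0 t :=
      (intervalIntegrable_iff_integrableOn_Ioc_of_le ht).2 (hint.mono_set Set.Ioc_subset_Ioi_self)
    have := intervalIntegral.integral_eq_sub_of_hasDeriv_right_of_le ht (f := h)
      (f' := fun s => -z s)
      (fun s hs => ((hh s hs.1).continuousWithinAt).mono Set.Icc_subset_Ici_self)
      (fun s hs => by
        rw [← h1 s hs.1.le]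
        exact (hh s hs.1.le).mono (Set.Ioi_subset_Ici hs.1.le)) hI.neg
    rw [intervalIntegral.integral_neg] at this
    rw [sub_eq_add_neg, this]; abel
  have h3 := (intervalIntegral_tendsto_integral_Ioi 0 hint tendsto_id).const_sub (h 0)
  rw [← h0, sub_self] at h3
  refine h3.congr' ?_
  filter_upwards [eventually_ge_atTop 0] with t ht using (h2 t ht).symm

end LinearFlowIntegral

section MatrixGramian

variable {ι ι' κ : Type*} [Fintype ι] [Fintype ι'] [Fintype κ]

theorem IsMatrixFlow.apply_integral {L : Matrix ι ι' ℝ →ₗ[ℝ] Matrix ι ι' ℝ}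
    {Z : ℝ → Matrix ι ι' ℝ} (hZ : IsMatrixFlow L Z)
    (hint : ∀ i j, IntegrableOn (fun s => Z s i j) (Set.Ioi 0)) :
    L (Matrix.of fun i j => ∫ s in Set.Ioi (0 : ℝ), Z s i j) = -Z 0 := by
  let L' : (ι → ι' → ℝ) →ₗ[ℝ] (ι → ι' → ℝ) := L
  let Z' : ℝ → ι → ι' → ℝ := Z
  have hint' : IntegrableOn Z' (Set.Ioi 0) :=
    Integrable.of_eval fun i => Integrable.of_eval fun j => hint i j
  have h := apply_integral_linear_flow (LinearMap.toContinuousLinearMap L') (z := Z')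
    (fun s hs => hasDerivWithinAt_pi.2 fun i => hasDerivWithinAt_pi.2 fun j => hZ s hs i j) hint'
  refine Eq.trans ?_ h
  change L _ = L _
  congr 1
  ext i j
  have e1 := eval_integral (μ := volume.restrict (Set.Ioi (0 : ℝ))) (f := Z')
    (fun i => Integrable.of_eval fun j => hint i j) i
  have e2 := eval_integral (μ := volume.restrict (Set.Ioi (0 : ℝ))) (f := fun s => Z' s i)
    (fun j => hint i j) j
  refine e2.symm.trans ?_
  exact (congrFun e1 j).symm

theorem IsMatrixFlow.tendsto_zero_of_integral {L : Matrix ι ι' ℝ →ₗ[ℝ] Matrix ι ι' ℝ}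
    {Z H : ℝ → Matrix ι ι' ℝ} (hZ : IsMatrixFlow L Z)
    (hint : ∀ i j, IntegrableOn (fun s => Z s i j) (Set.Ioi 0)) (hH : IsMatrixFlow L H)
    (h0 : ∀ i j, H 0 i j = ∫ s in Set.Ioi (0 : ℝ), Z s i j) (i : ι) (j : ι') :
    Tendsto (fun t => H t i j) atTop (𝓝 0) := by
  let L' : (ι → ι' → ℝ) →ₗ[ℝ] (ι → ι' → ℝ) := L
  let Z' : ℝ → ι → ι' → ℝ := Z
  have hint' : IntegrableOn Z' (Set.Ioi 0) :=
    Integrable.of_eval fun i => Integrable.of_eval fun j => hint i j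
  have h := linear_flow_tendsto_zero_of_integral (LinearMap.toContinuousLinearMap L') (z := Z')
    (h := (H : ℝ → ι → ι' → ℝ))
    (fun s hs => hasDerivWithinAt_pi.2 fun i => hasDerivWithinAt_pi.2 fun j => hZ s hs i j) hint'
    (fun s hs => hasDerivWithinAt_pi.2 fun i => hasDerivWithinAt_pi.2 fun j => hH s hs i j) (by
      ext i j
      have e1 := eval_integral (μ := volume.restrict (Set.Ioi (0 : ℝ))) (f := Z')
        (fun i => Integrable.of_eval fun j => hint i j) i
      have e2 := eval_integral (μ := volume.restrict (Set.Ioi (0 : ℝ))) (f := fun s => Z' s i)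
        (fun j => hint i j) j
      refine (h0 i j).trans ?_
      refine e2.symm.trans ?_
      exact (congrFun e1 j).symm)
  exact (tendsto_pi_nhds.1 ((tendsto_pi_nhds.1 h) i)) j

theorem trace_mul_nonneg_of_posSemidef {S P : Matrix ι ι ℝ} (hS : S.PosSemidef)
    (hP : P.PosSemidef) : 0 ≤ (S * P).trace := by
  obtain ⟨m, v, rfl⟩ := Matrix.posSemidef_iff_eq_sum_vecMulVec.1 hS
  rw [Finset.sum_mul, Matrix.trace_sum]
  refine Finset.sum_nonneg fun i _ => ?_
  rw [Matrix.vecMulVec_mul, Matrix.trace_vecMulVec, dotProduct_comm, ← Matrix.dotProduct_mulVec]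
  simpa using (posSemidef_iff_quadForm.1 hP).2 (v i)

/-- Cauchy-Schwarz on each rank one summand of `S`. It converts the storage at time zero into a
trace times `|v₀|²`. -/
theorem quadForm_le_trace_mul {S : Matrix ι ι ℝ} (hS : S.PosSemidef) (x : ι → ℝ) :
    x ⬝ᵥ (S *ᵥ x) ≤ S.trace * (x ⬝ᵥ x) := by
  obtain ⟨m, v, rfl⟩ := Matrix.posSemidef_iff_eq_sum_vecMulVec.1 hS
  rw [Matrix.sum_mulVec, Matrix.trace_sum, dotProduct_sum, Finset.sum_mul]
  refine Finset.sum_le_sum fun i _ => ?_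
  have := Finset.sum_mul_sq_le_sq_mul_sq Finset.univ (v i) x
  rw [Matrix.trace_vecMulVec, Matrix.vecMulVec_mulVec]
  simp only [dotProduct, Pi.star_apply, star_trivial, Pi.smul_apply, MulOpposite.smul_eq_mul_unop,
    MulOpposite.unop_op] at *
  refine le_trans (le_of_eq ?_) (this.trans (le_of_eq ?_))
  · rw [sq, Finset.sum_mul]
    exact Finset.sum_congr rfl fun j _ => by ring
  · simp only [sq]

theorem trace_sylv_adjoint (γ : ℝ) (A : Matrix ι ι ℝ) (N : κ → Matrix ι ι ℝ)
    (S X : Matrix ι ι ℝ) :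
    (S * sylv γ A N A N X).trace
      = (sylv γ Aᵀ (fun k => (N k)ᵀ) Aᵀ (fun k => (N k)ᵀ) S * X).trace := by
  simp only [sylv_apply, Matrix.mul_add, Matrix.add_mul, Matrix.trace_add, Matrix.transpose_transpose,
    Matrix.mul_smul, Matrix.smul_mul, Matrix.trace_smul, Matrix.mul_sum, Matrix.sum_mul,
    Matrix.trace_sum]
  have h1 : (S * (A * X)).trace = (S * A * X).trace := by rw [Matrix.mul_assoc]
  have h2 : (S * (X * Aᵀ)).trace = (Aᵀ * S * X).trace := by
    rw [← Matrix.mul_assoc, Matrix.trace_mul_comm, Matrix.mul_assoc]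
  have h3 : ∀ k, (S * (N k * X * (N k)ᵀ)).trace = ((N k)ᵀ * S * N k * X).trace := fun k => by
    rw [← Matrix.mul_assoc, Matrix.trace_mul_comm, ← Matrix.mul_assoc, ← Matrix.mul_assoc]
  rw [h1, h2]
  simp only [h3]
  ring

/-- If `H` is the flow from `P`, then `-L H` is a flow from a positive semidefinite matrix and stays
so. Thus `H` decreases in the Loewner order to its limit `0`, whence `H 0 = P ≥ 0`. -/
theorem posSemidef_of_lyapunov_of_tendsto {γ : ℝ} {A : Matrix ι ι ℝ} {N : κ → Matrix ι ι ℝ}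
    {P : Matrix ι ι ℝ} (hsym : Pᵀ = P) (hK : (-(sylv γ A N A N P)).PosSemidef)
    {H : ℝ → Matrix ι ι ℝ} (hH : IsMatrixFlow (sylv γ A N A N) H) (h0 : H 0 = P)
    (hlim : ∀ i j, Tendsto (fun t => H t i j) atTop (𝓝 0)) : P.PosSemidef := by
  refine posSemidef_iff_quadForm.2 ⟨hsym, fun v => ?_⟩
  have hM : IsMatrixFlow (sylv γ A N A N) (fun t => -(sylv γ A N A N (H t))) := by
    intro t ht i j
    have := (hH.apply_linear t ht i j).neg
    rw [map_neg]
    exact this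
  have hd : ∀ t, 0 ≤ t → HasDerivWithinAt (fun t => v ⬝ᵥ (H t *ᵥ v))
      (v ⬝ᵥ (sylv γ A N A N (H t) *ᵥ v)) (Set.Ici 0) t := by
    intro t ht
    have := hasDerivWithinAt_quadForm (x := fun _ => v) (x' := 0) (s := Set.Ici 0) (t := t)
      (fun i => hasDerivWithinAt_const _ _ _) (hH t ht)
    simpa using this
  have hneg : ∀ t, 0 ≤ t → v ⬝ᵥ (sylv γ A N A N (H t) *ᵥ v) ≤ 0 := by
    intro t ht
    have := (posSemidef_iff_quadForm.1 (lyap_flow_posSemidef hM (by rwa [h0]) ht)).2 v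
    rw [Matrix.neg_mulVec, dotProduct_neg] at this
    linarith
  have hanti : AntitoneOn (fun t => v ⬝ᵥ (H t *ᵥ v)) (Set.Ici 0) := by
    refine antitoneOn_of_deriv_nonpos (convex_Ici 0)
      (fun τ hτ => (hd τ hτ).continuousWithinAt) ?_ ?_
    · intro τ hτ
      rw [interior_Ici] at hτ
      exact ((hd τ (le_of_lt hτ)).hasDerivAt (Ici_mem_nhds hτ)).differentiableAt.differentiableWithinAt
    · intro τ hτ
      rw [interior_Ici] at hτ
      rw [((hd τ (le_of_lt hτ)).hasDerivAt (Ici_mem_nhds hτ)).deriv]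
      exact hneg τ (le_of_lt hτ)
  have hl : Tendsto (fun t => v ⬝ᵥ (H t *ᵥ v)) atTop (𝓝 0) := by
    simp only [quadForm_eq_sum]
    have : Tendsto (fun t => ∑ i, ∑ j, v i * H t i j * v j) atTop
        (𝓝 (∑ i, ∑ j, v i * 0 * v j)) :=
      tendsto_finsetSum _ fun i _ => tendsto_finsetSum _ fun j _ =>
        ((hlim i j).const_mul _).mul_const _
    simpa using this
  rw [← h0]
  refine le_of_tendsto hl ?_
  filter_upwards [eventually_ge_atTop 0] with t ht
  exact hanti Set.self_mem_Ici ht ht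

end MatrixGramian

theorem IsLyapunovFlow.isMatrixFlow {n m : ℕ} {γ : ℝ} {A : Matrix (Fin n) (Fin n) ℝ}
    {N : Fin m → Matrix (Fin n) (Fin n) ℝ} {K : Matrix (Fin n) (Fin n) ℝ}
    {Z : ℝ → Matrix (Fin n) (Fin n) ℝ} (h : IsLyapunovFlow γ A N K Z) :
    IsMatrixFlow (sylv γ A N A N) Z := fun t ht i j => h.2 t ht i j

theorem IsGramian.lyapunov {n m : ℕ} {γ : ℝ} {A : Matrix (Fin n) (Fin n) ℝ}
    {N : Fin m → Matrix (Fin n) (Fin n) ℝ} {K P : Matrix (Fin n) (Fin n) ℝ}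
    (h : IsGramian γ A N K P) : sylv γ A N A N P = -K := by
  obtain ⟨Z, hZ, hP⟩ := h
  have := hZ.isMatrixFlow.apply_integral fun i j => (hP i j).1
  rw [hZ.1] at this
  rw [← this]
  congr 1
  ext i j
  exact (hP i j).2

theorem IsGramian.flow_tendsto_zero {n m : ℕ} {γ : ℝ} {A : Matrix (Fin n) (Fin n) ℝ}
    {N : Fin m → Matrix (Fin n) (Fin n) ℝ} {K P : Matrix (Fin n) (Fin n) ℝ}
    (h : IsGramian γ A N K P) {H : ℝ → Matrix (Fin n) (Fin n) ℝ}
    (hH : IsMatrixFlow (sylv γ A N A N) H) (h0 : H 0 = P) (i j : Fin n) :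
    Tendsto (fun t => H t i j) atTop (𝓝 0) := by
  obtain ⟨Z, hZ, hP⟩ := h
  exact hZ.isMatrixFlow.tendsto_zero_of_integral (fun i j => (hP i j).1) hH
    (fun i j => by rw [h0]; exact (hP i j).2) i j

theorem IsGramian.transpose_eq {n m : ℕ} {γ : ℝ} {A : Matrix (Fin n) (Fin n) ℝ}
    {N : Fin m → Matrix (Fin n) (Fin n) ℝ} {K P : Matrix (Fin n) (Fin n) ℝ}
    (h : IsGramian γ A N K P) (hK : K.PosSemidef) : Pᵀ = P := by
  obtain ⟨Z, hZ, hP⟩ := h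
  ext i j
  rw [Matrix.transpose_apply, (hP j i).2, (hP i j).2]
  refine setIntegral_congr_fun measurableSet_Ioi fun t ht => ?_
  have := (posSemidef_iff_quadForm.1
    (lyap_flow_posSemidef hZ.isMatrixFlow (by rwa [hZ.1]) (le_of_lt ht))).1
  exact congrFun (congrFun this i) j

/-- If `L Θ ≤ -K` for some `Θ ≥ 0`, then the flow started in `K ≥ 0` is integrable. -/
theorem exists_isGramian_of_lyapunov_le {n m : ℕ} {γ : ℝ} {A : Matrix (Fin n) (Fin n) ℝ}
    {N : Fin m → Matrix (Fin n) (Fin n) ℝ} {K Θ : Matrix (Fin n) (Fin n) ℝ}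
    (hK : K.PosSemidef) (hΘ : Θ.PosSemidef)
    (h : (-(sylv γ A N A N Θ) - K).PosSemidef) : ∃ P, IsGramian γ A N K P := by
  obtain ⟨Z, hZ0, hZd⟩ := exists_matrixFlow (sylv γ A N A N) K
  obtain ⟨H, hH0, hHd⟩ := exists_matrixFlow (sylv γ A N A N) Θ
  have hZ := isMatrixFlow_of_hasDerivAt hZd
  have hH := isMatrixFlow_of_hasDerivAt hHd
  have hZp : ∀ t, 0 ≤ t → (Z t).PosSemidef := fun t ht =>
    lyap_flow_posSemidef hZ (by rwa [hZ0]) ht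
  have hHp : ∀ t, 0 ≤ t → (H t).PosSemidef := fun t ht =>
    lyap_flow_posSemidef hH (by rwa [hH0]) ht
  -- The gap `-H' - Z` is itself a flow started in a positive semidefinite matrix. Hence `Z ≤ -H'`
  -- for all times, and the integrals of the diagonal entries are bounded by those of `Θ`.
  have hM : IsMatrixFlow (sylv γ A N A N) (fun t => -(sylv γ A N A N (H t)) - Z t) := by
    intro t ht i j
    have := ((hH.apply_linear t ht i j).neg).sub (hZ t ht i j)
    rw [map_sub, map_neg]
    exact this
  have hMp : ∀ t, 0 ≤ t → (-(sylv γ A N A N (H t)) - Z t).PosSemidef := fun t ht =>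
    lyap_flow_posSemidef hM (by simpa only [hH0, hZ0] using h) ht
  have hZc : ∀ i j, Continuous fun t => Z t i j := fun i j =>
    continuous_iff_continuousAt.2 fun t => (hZd t i j).continuousAt
  have hLc : ∀ i, Continuous fun t => sylv γ A N A N (H t) i i := fun i =>
    continuous_iff_continuousAt.2 fun t => by
      have := hasDerivWithinAt_linearMap_apply (sylv γ A N A N) (Z := H) (s := Set.univ) (t := t)
        (fun i j => (hHd t i j).hasDerivWithinAt) i i
      rw [hasDerivWithinAt_univ] at this
      exact this.continuousAt
  have hdiag : ∀ i, IntegrableOn (fun s => Z s i i) (Set.Ioi 0) := by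
    intro i
    refine integrableOn_Ioi_of_intervalIntegral_norm_bounded (l := atTop) (b := id) (Θ i i) 0
      (fun t => ((hZc i i).integrableOn_Icc).mono_set Set.Ioc_subset_Icc_self) tendsto_id ?_
    filter_upwards [eventually_ge_atTop 0] with t ht
    have h1 : ∫ s in (0 : ℝ)..t, ‖Z s i i‖ ≤ ∫ s in (0 : ℝ)..t, -(sylv γ A N A N (H s) i i) := by
      refine intervalIntegral.integral_mono_on ht ((hZc i i).norm.intervalIntegrable _ _)
        ((hLc i).neg.intervalIntegrable _ _) fun s hs => ?_
      rw [Real.norm_of_nonneg (diag_nonneg_of_posSemidef (hZp s hs.1) i)]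
      have := diag_nonneg_of_posSemidef (hMp s hs.1) i
      rw [Matrix.sub_apply, Matrix.neg_apply] at this
      linarith
    refine h1.trans ?_
    rw [intervalIntegral.integral_neg, intervalIntegral.integral_eq_sub_of_hasDerivAt
      (fun s _ => hHd s i i) ((hLc i).intervalIntegrable _ _), hH0]
    have := diag_nonneg_of_posSemidef (hHp t ht) i
    linarith
  have hall : ∀ i j, IntegrableOn (fun s => Z s i j) (Set.Ioi 0) := by
    intro i j
    -- Off-diagonal entries of a positive semidefinite matrix are dominated by diagonal ones.
    refine Integrable.mono' ((hdiag i).add (hdiag j)) (hZc i j).aestronglyMeasurable ?_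
    refine (ae_restrict_iff' measurableSet_Ioi).2 (Eventually.of_forall fun t ht => ?_)
    have ht' : 0 ≤ t := le_of_lt ht
    have h1 := sq_apply_le_of_posSemidef (hZp t ht') i j
    have h2 := diag_nonneg_of_posSemidef (hZp t ht') i
    have h3 := diag_nonneg_of_posSemidef (hZp t ht') j
    rw [Real.norm_eq_abs]
    refine abs_le_of_sq_le_sq ?_ (add_nonneg h2 h3)
    simp only [Pi.add_apply]
    nlinarith
  exact ⟨Matrix.of fun i j => ∫ s in Set.Ioi (0 : ℝ), Z s i j, Z, ⟨hZ0, hZ⟩,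
    fun i j => ⟨hall i j, rfl⟩⟩

/-! ### Mean square stability -/

/-- Vectorization turns the Lyapunov operator into the Kronecker matrix of the stability hypothesis.
-/
theorem MeanSquareStable.flow_tendsto_zero {n m : ℕ} {γ : ℝ} {A : Matrix (Fin n) (Fin n) ℝ}
    {N : Fin m → Matrix (Fin n) (Fin n) ℝ} (h : MeanSquareStable γ A N)
    {Z : ℝ → Matrix (Fin n) (Fin n) ℝ} (hZ : IsMatrixFlow (sylv γ A N A N) Z) (i j : Fin n) :
    Tendsto (fun t => Z t i j) atTop (𝓝 0) := by
  set M := A ⊗ₖ (1 : Matrix (Fin n) (Fin n) ℝ) + (1 : Matrix (Fin n) (Fin n) ℝ) ⊗ₖ A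
    + (1 / γ ^ 2) • ∑ k, N k ⊗ₖ N k with hM
  have hMvec : ∀ X, M *ᵥ Matrix.vec X = Matrix.vec (sylv γ A N A N X) := by
    intro X
    rw [hM, Matrix.add_mulVec, Matrix.add_mulVec, Matrix.smul_mulVec, Matrix.sum_mulVec]
    simp only [Matrix.kronecker_mulVec_vec, sylv_apply]
    ext ⟨a, b⟩
    simp [Matrix.sum_apply]
    ring
  have key : Tendsto (fun t => fun p => ((Matrix.vec (Z t) p : ℝ) : ℂ)) atTop (𝓝 0) := by
    refine flow_tendsto_zero_of_spectrum (M.map (algebraMap ℝ ℂ)) h fun t ht => ?_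
    rw [hasDerivWithinAt_pi]
    rintro ⟨a, b⟩
    have h1 := (hZ t ht b a).ofReal_comp
    convert! h1 using 1
    have h2 := RingHom.map_mulVec (algebraMap ℝ ℂ) M (Matrix.vec (Z t)) (a, b)
    rw [hMvec] at h2
    exact h2.symm
  have h1 := (tendsto_pi_nhds.1 key) (j, i)
  have h2 := (Complex.continuous_re.tendsto _).comp h1
  simpa [Function.comp_def] using h2

/-! ### Decay and unique solvability for the mixed Sylvester equation -/

section Mixed

variable {ι ι' κ : Type*} [Fintype ι] [Fintype ι'] [Fintype κ]

theorem sylv_fromBlocks (γ : ℝ) (A : Matrix ι ι ℝ) (N : κ → Matrix ι ι ℝ) (A' : Matrix ι' ι' ℝ)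
    (N' : κ → Matrix ι' ι' ℝ) (X : Matrix (ι ⊕ ι') (ι ⊕ ι') ℝ) :
    sylv γ (Matrix.fromBlocks A 0 0 A') (fun k => Matrix.fromBlocks (N k) 0 0 (N' k))
        (Matrix.fromBlocks A 0 0 A') (fun k => Matrix.fromBlocks (N k) 0 0 (N' k)) X
      = Matrix.fromBlocks (sylv γ A N A N X.toBlocks₁₁) (sylv γ A N A' N' X.toBlocks₁₂)
          (sylv γ A' N' A N X.toBlocks₂₁) (sylv γ A' N' A' N' X.toBlocks₂₂) := by
  conv_lhs => rw [← Matrix.fromBlocks_toBlocks X]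
  rw [sylv_apply]
  ext (i | i) (j | j) <;>
  simp [Matrix.fromBlocks_multiply, Matrix.fromBlocks_transpose, Matrix.sum_apply, sylv_apply]

theorem IsMatrixFlow.toBlocks {γ : ℝ} {A : Matrix ι ι ℝ} {N : κ → Matrix ι ι ℝ}
    {A' : Matrix ι' ι' ℝ} {N' : κ → Matrix ι' ι' ℝ} {H : ℝ → Matrix (ι ⊕ ι') (ι ⊕ ι') ℝ}
    (hH : IsMatrixFlow (sylv γ (Matrix.fromBlocks A 0 0 A')
      (fun k => Matrix.fromBlocks (N k) 0 0 (N' k)) (Matrix.fromBlocks A 0 0 A')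
      (fun k => Matrix.fromBlocks (N k) 0 0 (N' k))) H) :
    IsMatrixFlow (sylv γ A N A N) (fun t => (H t).toBlocks₁₁) ∧
    IsMatrixFlow (sylv γ A N A' N') (fun t => (H t).toBlocks₁₂) ∧
    IsMatrixFlow (sylv γ A' N' A N) (fun t => (H t).toBlocks₂₁) ∧
    IsMatrixFlow (sylv γ A' N' A' N') (fun t => (H t).toBlocks₂₂) := by
  refine ⟨fun t ht i j => ?_, fun t ht i j => ?_, fun t ht i j => ?_, fun t ht i j => ?_⟩
  · have := hH t ht (Sum.inl i) (Sum.inl j)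
    rwa [sylv_fromBlocks] at this
  · have := hH t ht (Sum.inl i) (Sum.inr j)
    rwa [sylv_fromBlocks] at this
  · have := hH t ht (Sum.inr i) (Sum.inl j)
    rwa [sylv_fromBlocks] at this
  · have := hH t ht (Sum.inr i) (Sum.inr j)
    rwa [sylv_fromBlocks] at this

/-- A flow started in a positive semidefinite matrix stays bounded if `L* Θ ≤ 0` for some positive
definite diagonal `Θ`. -/
theorem exists_diag_bound_of_adjoint_lyapunov [DecidableEq ι] {γ : ℝ} {A : Matrix ι ι ℝ}
    {N : κ → Matrix ι ι ℝ} {θ : ι → ℝ} (hθ : ∀ i, 0 < θ i)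
    (hΘ : (-(sylv γ Aᵀ (fun k => (N k)ᵀ) Aᵀ (fun k => (N k)ᵀ)
      (Matrix.diagonal θ))).PosSemidef) {Z : ℝ → Matrix ι ι ℝ}
    (hZ : IsMatrixFlow (sylv γ A N A N) Z) (h0 : (Z 0).PosSemidef) :
    ∃ c : ι → ℝ, ∀ t, 0 ≤ t → ∀ i, Z t i i ≤ c i := by
  have hZp : ∀ t, 0 ≤ t → (Z t).PosSemidef := fun t ht => lyap_flow_posSemidef hZ h0 ht
  -- The functional `X ↦ tr(Θ X)` does not increase along the flow, by duality with `L* Θ ≤ 0`;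
  -- since `Θ > 0`, it controls every diagonal entry.
  let T : Matrix ι ι ℝ →ₗ[ℝ] Matrix Unit Unit ℝ :=
    { toFun := fun X => Matrix.of fun _ _ => (Matrix.diagonal θ * X).trace
      map_add' := fun X Y => by ext; simp [Matrix.mul_add]
      map_smul' := fun c X => by ext; simp }
  have hd : ∀ t, 0 ≤ t → HasDerivWithinAt (fun t => (Matrix.diagonal θ * Z t).trace)
      ((Matrix.diagonal θ * sylv γ A N A N (Z t)).trace) (Set.Ici 0) t := fun t ht =>
    hasDerivWithinAt_linearMap_apply T (hZ t ht) () ()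
  have hanti : AntitoneOn (fun t => (Matrix.diagonal θ * Z t).trace) (Set.Ici 0) := by
    refine antitoneOn_of_deriv_nonpos (convex_Ici 0)
      (fun τ hτ => (hd τ hτ).continuousWithinAt) ?_ ?_
    · intro τ hτ
      rw [interior_Ici] at hτ
      exact ((hd τ (le_of_lt hτ)).hasDerivAt (Ici_mem_nhds hτ)).differentiableAt.differentiableWithinAt
    · intro τ hτ
      rw [interior_Ici] at hτ
      rw [((hd τ (le_of_lt hτ)).hasDerivAt (Ici_mem_nhds hτ)).deriv, trace_sylv_adjoint]
      have := trace_mul_nonneg_of_posSemidef hΘ (hZp τ (le_of_lt hτ))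
      rw [Matrix.neg_mul, Matrix.trace_neg] at this
      linarith
  refine ⟨fun i => (Matrix.diagonal θ * Z 0).trace / θ i, fun t ht i => ?_⟩
  rw [le_div_iff₀ (hθ i)]
  refine le_trans ?_ (hanti Set.self_mem_Ici ht ht)
  have h1 : ∀ j, 0 ≤ (Matrix.diagonal θ * Z t) j j := fun j => by
    rw [Matrix.diagonal_mul]
    exact mul_nonneg (hθ j).le (diag_nonneg_of_posSemidef (hZp t ht) j)
  have h2 := Finset.single_le_sum (f := fun j => (Matrix.diagonal θ * Z t) j j)
    (fun j _ => h1 j) (Finset.mem_univ i)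
  simp only [Matrix.diagonal_mul] at h2
  rw [mul_comm]
  simpa [Matrix.trace] using h2

/-- The second pair of coefficients need not have a decaying flow. The mixed flow is the
off-diagonal block of a positive semidefinite block flow, so `Y_ij²` is at most a product of
diagonal entries: one from the stable block, which tends to zero, and one from the other block,
which is bounded thanks to `Θ`. -/
theorem mixed_flow_tendsto_zero [DecidableEq ι'] {γ : ℝ} {A : Matrix ι ι ℝ}
    {N : κ → Matrix ι ι ℝ} {A' : Matrix ι' ι' ℝ} {N' : κ → Matrix ι' ι' ℝ}
    (hst : ∀ Z : ℝ → Matrix ι ι ℝ, IsMatrixFlow (sylv γ A N A N) Z →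
      ∀ i j, Tendsto (fun t => Z t i j) atTop (𝓝 0))
    {θ : ι' → ℝ} (hθ : ∀ i, 0 < θ i)
    (hΘ : (-(sylv γ A'ᵀ (fun k => (N' k)ᵀ) A'ᵀ (fun k => (N' k)ᵀ)
      (Matrix.diagonal θ))).PosSemidef) {Y : ℝ → Matrix ι ι' ℝ}
    (hY : IsMatrixFlow (sylv γ A N A' N') Y) (i : ι) (j : ι') :
    Tendsto (fun t => Y t i j) atTop (𝓝 0) := by
  -- With this factor, `F Fᵀ ≥ 0` has the upper right block `Y 0`.
  let F : Matrix (ι ⊕ ι') ι' ℝ := Matrix.fromRows (Y 0) 1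
  obtain ⟨H, hH0, hHd⟩ := exists_matrixFlow (sylv γ (Matrix.fromBlocks A 0 0 A')
      (fun k => Matrix.fromBlocks (N k) 0 0 (N' k)) (Matrix.fromBlocks A 0 0 A')
      (fun k => Matrix.fromBlocks (N k) 0 0 (N' k))) (F * Fᵀ)
  have hH := isMatrixFlow_of_hasDerivAt hHd
  have hFp : (F * Fᵀ).PosSemidef := by
    simpa using Matrix.posSemidef_self_mul_conjTranspose F
  have hHp : ∀ t, 0 ≤ t → (H t).PosSemidef := fun t ht =>
    lyap_flow_posSemidef hH (by rwa [hH0]) ht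
  obtain ⟨h11, h12, -, h22⟩ := hH.toBlocks
  have hY12 : ∀ t, 0 ≤ t → Y t = (H t).toBlocks₁₂ := fun t ht =>
    hY.unique h12 (by
      rw [hH0]
      ext a b
      simp [F, Matrix.toBlocks₁₂, Matrix.mul_apply, Matrix.one_apply]) ht
  have h22p : ((H 0).toBlocks₂₂).PosSemidef := (hHp 0 le_rfl).submatrix Sum.inr
  obtain ⟨c, hc⟩ := exists_diag_bound_of_adjoint_lyapunov hθ hΘ h22 h22p
  have hsq : Tendsto (fun t => (Y t i j) ^ 2) atTop (𝓝 0) := by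
    have hup : Tendsto (fun t => (H t).toBlocks₁₁ i i * c j) atTop (𝓝 0) := by
      simpa using (hst _ h11 i i).mul_const (c j)
    refine tendsto_of_tendsto_of_tendsto_of_le_of_le' tendsto_const_nhds hup
      (Eventually.of_forall fun t => sq_nonneg _) ?_
    filter_upwards [eventually_ge_atTop 0] with t ht
    rw [hY12 t ht]
    refine (sq_apply_le_of_posSemidef (hHp t ht) (Sum.inl i) (Sum.inr j)).trans ?_
    exact mul_le_mul_of_nonneg_left (hc t ht j) (diag_nonneg_of_posSemidef (hHp t ht) (Sum.inl i))
  have := hsq.sqrt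
  simp only [Real.sqrt_sq_eq_abs, Real.sqrt_zero] at this
  exact (tendsto_zero_iff_abs_tendsto_zero _).2 this

theorem mixed_injective [DecidableEq ι'] {γ : ℝ} {A : Matrix ι ι ℝ}
    {N : κ → Matrix ι ι ℝ} {A' : Matrix ι' ι' ℝ} {N' : κ → Matrix ι' ι' ℝ}
    (hst : ∀ Z : ℝ → Matrix ι ι ℝ, IsMatrixFlow (sylv γ A N A N) Z →
      ∀ i j, Tendsto (fun t => Z t i j) atTop (𝓝 0))
    {θ : ι' → ℝ} (hθ : ∀ i, 0 < θ i)
    (hΘ : (-(sylv γ A'ᵀ (fun k => (N' k)ᵀ) A'ᵀ (fun k => (N' k)ᵀ)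
      (Matrix.diagonal θ))).PosSemidef) :
    Function.Injective (sylv γ A N A' N') := by
  rw [injective_iff_map_eq_zero]
  intro Y hY
  ext i j
  -- A matrix in the kernel is a stationary flow, and stationary flows that decay vanish.
  have := mixed_flow_tendsto_zero hst hθ hΘ (Y := fun _ => Y) (fun t _ a b => by
    rw [hY]
    exact hasDerivWithinAt_const _ _ _) i j
  exact tendsto_nhds_unique tendsto_const_nhds this

end Mixed

/-! ### Absolutely continuous functions -/

section AbsolutelyContinuous

theorem absolutelyContinuousOnInterval_congr {f g : ℝ → ℝ} {a b : ℝ}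
    (hf : AbsolutelyContinuousOnInterval f a b) (h : Set.EqOn f g (Set.uIcc a b)) :
    AbsolutelyContinuousOnInterval g a b := by
  rw [absolutelyContinuousOnInterval_iff] at hf ⊢
  intro ε hε
  obtain ⟨δ, hδ, H⟩ := hf ε hε
  refine ⟨δ, hδ, fun E hE hl => ?_⟩
  refine lt_of_le_of_lt (le_of_eq ?_) (H E hE hl)
  refine Finset.sum_congr rfl fun i hi => ?_
  rw [h (hE.1 i hi).1, h (hE.1 i hi).2]

theorem absolutelyContinuousOnInterval_lipschitz_comp {f : ℝ → ℝ} {φ : ℝ → ℝ} {a b : ℝ}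
    {K : NNReal} (hf : AbsolutelyContinuousOnInterval f a b)
    (hφ : LipschitzOnWith K φ (f '' Set.uIcc a b)) :
    AbsolutelyContinuousOnInterval (fun t => φ (f t)) a b := by
  rw [absolutelyContinuousOnInterval_iff] at hf ⊢
  intro ε hε
  have hK : (0 : ℝ) < K + 1 := by positivity
  obtain ⟨δ, hδ, H⟩ := hf (ε / (K + 1)) (by positivity)
  refine ⟨δ, hδ, fun E hE hl => ?_⟩
  have h1 := H E hE hl
  rw [lt_div_iff₀ hK] at h1
  refine lt_of_le_of_lt ?_ h1
  rw [Finset.sum_mul]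
  refine Finset.sum_le_sum fun i hi => ?_
  have h2 := hφ.dist_le_mul _ (Set.mem_image_of_mem f (hE.1 i hi).1) _
    (Set.mem_image_of_mem f (hE.1 i hi).2)
  have h3 : 0 ≤ dist (f (E.2 i).1) (f (E.2 i).2) := dist_nonneg
  nlinarith

theorem AbsolutelyContinuousOnInterval.exp_comp {f : ℝ → ℝ} {a b : ℝ}
    (hf : AbsolutelyContinuousOnInterval f a b) :
    AbsolutelyContinuousOnInterval (fun t => Real.exp (f t)) a b := by
  obtain ⟨C, hC⟩ := isCompact_uIcc.exists_bound_of_continuousOn hf.continuousOn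
  obtain ⟨K, hK⟩ := (Real.contDiff_exp (n := 1)).contDiffOn.exists_lipschitzOnWith
    (by decide) (convex_Icc (-C) C) isCompact_Icc
  refine absolutelyContinuousOnInterval_lipschitz_comp hf (hK.mono ?_)
  rintro _ ⟨t, ht, rfl⟩
  exact abs_le.1 (hC t ht)

theorem absolutelyContinuousOnInterval_const (c a b : ℝ) :
    AbsolutelyContinuousOnInterval (fun _ => c) a b :=
  (LipschitzWith.const c).lipschitzOnWith.absolutelyContinuousOnInterval

theorem absolutelyContinuousOnInterval_sum {ι : Type*} (s : Finset ι) {f : ι → ℝ → ℝ} {a b : ℝ}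
    (hf : ∀ i ∈ s, AbsolutelyContinuousOnInterval (f i) a b) :
    AbsolutelyContinuousOnInterval (fun t => ∑ i ∈ s, f i t) a b := by
  classical
  induction s using Finset.induction_on with
  | empty => simpa using absolutelyContinuousOnInterval_const 0 a b
  | insert i s hi ih =>
    simp only [Finset.sum_insert hi]
    exact (hf i (Finset.mem_insert_self i s)).fun_add
      (ih fun j hj => hf j (Finset.mem_insert_of_mem hj))

/-- `ξ t = ξ 0 + ∫₀ᵗ f` for all `t ≥ 0`, with `f` locally integrable on `[0, ∞)`. -/
def IsPrimitive (ξ f : ℝ → ℝ) : Prop :=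
  ∀ T : ℝ, 0 ≤ T → IntervalIntegrable f volume 0 T ∧ ξ T = ξ 0 + ∫ s in (0 : ℝ)..T, f s

namespace IsPrimitive

variable {ξ η f g : ℝ → ℝ}

theorem sub (h : IsPrimitive ξ f) (h' : IsPrimitive η g) :
    IsPrimitive (fun t => ξ t - η t) (fun t => f t - g t) := fun T hT => by
  refine ⟨(h T hT).1.sub (h' T hT).1, ?_⟩
  rw [intervalIntegral.integral_sub (h T hT).1 (h' T hT).1]
  have := (h T hT).2; have := (h' T hT).2
  linarith

theorem const_mul (c : ℝ) (h : IsPrimitive ξ f) :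
    IsPrimitive (fun t => c * ξ t) (fun t => c * f t) := fun T hT => by
  refine ⟨(h T hT).1.const_mul c, ?_⟩
  simp only [intervalIntegral.integral_const_mul]
  rw [(h T hT).2]
  ring

theorem sum {ι : Type*} (s : Finset ι) {ξ f : ι → ℝ → ℝ} (h : ∀ i ∈ s, IsPrimitive (ξ i) (f i)) :
    IsPrimitive (fun t => ∑ i ∈ s, ξ i t) (fun t => ∑ i ∈ s, f i t) := fun T hT => by
  have hi : ∀ i ∈ s, IntervalIntegrable (f i) volume 0 T := fun i hi => (h i hi T hT).1
  refine ⟨by simpa [Finset.sum_fn] using IntervalIntegrable.sum s hi, ?_⟩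
  rw [intervalIntegral.integral_finsetSum hi, ← Finset.sum_add_distrib]
  exact Finset.sum_congr rfl fun i hi => (h i hi T hT).2

theorem congr (h : IsPrimitive ξ f) (hη : ∀ t, 0 ≤ t → η t = ξ t) (hg : ∀ t, 0 ≤ t → g t = f t) :
    IsPrimitive η g := fun T hT => by
  have he : Set.EqOn f g (Set.uIcc 0 T) := fun t ht => by
    rw [Set.uIcc_of_le hT] at ht
    exact (hg t ht.1).symm
  refine ⟨(h T hT).1.congr (fun t ht => he (Set.uIoc_subset_uIcc ht)), ?_⟩
  rw [hη T hT, hη 0 le_rfl, (h T hT).2, intervalIntegral.integral_congr he]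

theorem absolutelyContinuousOnInterval (h : IsPrimitive ξ f) {T : ℝ} (hT : 0 ≤ T) :
    AbsolutelyContinuousOnInterval ξ 0 T := by
  have h1 := (h T hT).1.absolutelyContinuousOnInterval_intervalIntegral (c := 0) (by simp)
  have h2 := (absolutelyContinuousOnInterval_const (ξ 0) 0 T).fun_add h1
  refine absolutelyContinuousOnInterval_congr h2 fun t ht => ?_
  rw [Set.uIcc_of_le hT] at ht
  exact (h t ht.1).2.symm

theorem ae_hasDerivAt (h : IsPrimitive ξ f) {T : ℝ} (hT : 0 ≤ T) :
    ∀ᵐ t, t ∈ Set.Ioo 0 T → HasDerivAt ξ (f t) t := by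
  filter_upwards [(h T hT).1.ae_hasDerivAt_integral] with t ht htm
  have h1 := (ht (by rw [Set.uIcc_of_le hT]; exact ⟨htm.1.le, htm.2.le⟩) 0 (by simp)).const_add (ξ 0)
  refine h1.congr_of_eventuallyEq ?_
  filter_upwards [Ioi_mem_nhds htm.1] with s hs
  exact (h s (le_of_lt hs)).2

theorem continuousOn (h : IsPrimitive ξ f) : ContinuousOn ξ (Set.Ici 0) := by
  intro t ht
  have h0 : (0 : ℝ) ≤ t + 1 := by linarith [Set.mem_Ici.1 ht]
  have h1 := (h.absolutelyContinuousOnInterval h0).continuousOn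
  rw [Set.uIcc_of_le h0] at h1
  refine (h1 t ⟨ht, by linarith⟩).mono_of_mem_nhdsWithin ?_
  rw [← Set.Ici_inter_Iic]
  exact inter_mem self_mem_nhdsWithin (mem_nhdsWithin_of_mem_nhds (Iic_mem_nhds (by linarith)))

end IsPrimitive

/-- The dissipation inequality `V' ≤ -p + b + m V` yields an integral bound for `p`. -/
theorem integral_le_of_dissipation {T : ℝ} (hT : 0 ≤ T) {V p b m : ℝ → ℝ}
    (hV : AbsolutelyContinuousOnInterval V 0 T) (hVT : 0 ≤ V T)
    (hm : IntervalIntegrable m volume 0 T) (hm0 : ∀ t, 0 ≤ m t)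
    (hp : IntervalIntegrable p volume 0 T) (hp0 : ∀ t, 0 ≤ p t)
    (hb : IntervalIntegrable b volume 0 T) (hb0 : ∀ t, 0 ≤ b t)
    (hd : ∀ᵐ t, t ∈ Set.Ioo 0 T → ∃ V', HasDerivAt V V' t ∧ V' ≤ -p t + b t + m t * V t) :
    ∫ t in (0 : ℝ)..T, p t
      ≤ Real.exp (∫ t in (0 : ℝ)..T, m t) * (V 0 + ∫ t in (0 : ℝ)..T, b t) := by
  set a : ℝ → ℝ := fun t => ∫ s in (0 : ℝ)..t, m s with ha
  have haAC : AbsolutelyContinuousOnInterval a 0 T :=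
    hm.absolutelyContinuousOnInterval_intervalIntegral (c := 0) (by simp)
  -- The integrating factor lies between `exp (-(a T))` and `1`: the lower bound is used in front of
  -- `p`, the upper bound in front of `b`.
  set w : ℝ → ℝ := fun t => Real.exp (-(a t)) with hw
  have hwAC : AbsolutelyContinuousOnInterval w 0 T :=
    AbsolutelyContinuousOnInterval.exp_comp (f := fun t => -(a t)) haAC.neg
  have hwV : AbsolutelyContinuousOnInterval (fun t => w t * V t) 0 T := hwAC.fun_mul hV
  have ha0 : ∀ t ∈ Set.Icc 0 T, 0 ≤ a t ∧ a t ≤ a T := by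
    intro t ht
    refine ⟨intervalIntegral.integral_nonneg ht.1 fun s _ => hm0 s, ?_⟩
    have h1 : IntervalIntegrable m volume 0 t := hm.mono_set (by
      rw [Set.uIcc_of_le ht.1, Set.uIcc_of_le hT]; exact Set.Icc_subset_Icc_right ht.2)
    have h2 : IntervalIntegrable m volume t T := hm.mono_set (by
      rw [Set.uIcc_of_le ht.2, Set.uIcc_of_le hT]; exact Set.Icc_subset_Icc_left ht.1)
    have h3 := intervalIntegral.integral_add_adjacent_intervals h1 h2
    have h4 : 0 ≤ ∫ s in t..T, m s := intervalIntegral.integral_nonneg ht.2 fun s _ => hm0 s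
    simp only [ha]
    linarith
  have hint : ∫ t in (0 : ℝ)..T, deriv (fun t => w t * V t) t
      ≤ ∫ t in (0 : ℝ)..T, (b t - Real.exp (-(a T)) * p t) := by
    refine intervalIntegral.integral_mono_ae_restrict hT hwV.intervalIntegrable_deriv
      (hb.sub (hp.const_mul _)) ?_
    rw [Filter.EventuallyLE, ← restrict_Ioo_eq_restrict_Icc, ae_restrict_iff' measurableSet_Ioo]
    filter_upwards [hd, hm.ae_hasDerivAt_integral] with t ht1 ht2 htm
    obtain ⟨V', hV', hle⟩ := ht1 htm
    have htc : t ∈ Set.Icc 0 T := ⟨htm.1.le, htm.2.le⟩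
    have h1 : HasDerivAt a (m t) t := ht2 (by rwa [Set.uIcc_of_le hT]) 0 (by simp)
    have h2 : HasDerivAt w (w t * -(m t)) t := h1.fun_neg.exp
    rw [(h2.fun_mul hV').deriv]
    have hw1 : w t ≤ 1 := Real.exp_le_one_iff.2 (by linarith [(ha0 t htc).1])
    have hw2 : Real.exp (-(a T)) ≤ w t := Real.exp_le_exp.2 (by linarith [(ha0 t htc).2])
    have hw0 : 0 < w t := Real.exp_pos _
    have h3 := mul_le_mul_of_nonneg_left hle hw0.le
    have h4 := mul_le_mul_of_nonneg_right hw1 (hb0 t)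
    have h5 := mul_le_mul_of_nonneg_right hw2 (hp0 t)
    nlinarith
  rw [hwV.integral_deriv_eq_sub, intervalIntegral.integral_sub hb (hp.const_mul _),
    intervalIntegral.integral_const_mul] at hint
  have hw0 : w 0 = 1 := by simp [hw, ha]
  have h6 : 0 ≤ w T * V T := mul_nonneg (Real.exp_pos _).le hVT
  rw [hw0, one_mul] at hint
  have h7 : Real.exp (-(a T)) * ∫ t in (0 : ℝ)..T, p t ≤ V 0 + ∫ t in (0 : ℝ)..T, b t := by linarith
  have h8 := mul_le_mul_of_nonneg_left h7 (Real.exp_pos (a T)).le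
  rwa [← mul_assoc, ← Real.exp_add, add_neg_cancel, Real.exp_zero, one_mul] at h8

/-- The integrand is half the derivative of `exp (2 ∫ κ)`. This makes the Picard map a contraction
with factor `1 / 2` in the norm weighted by that exponential. -/
theorem integral_mul_exp_le {t : ℝ} {κ : ℝ → ℝ}
    (hκ : IntervalIntegrable κ volume 0 t) :
    ∫ s in (0 : ℝ)..t, κ s * Real.exp (2 * ∫ r in (0 : ℝ)..s, κ r)
      ≤ Real.exp (2 * ∫ r in (0 : ℝ)..t, κ r) / 2 := by
  set a : ℝ → ℝ := fun t => ∫ s in (0 : ℝ)..t, κ s with ha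
  have haAC : AbsolutelyContinuousOnInterval a 0 t :=
    hκ.absolutelyContinuousOnInterval_intervalIntegral (c := 0) (by simp)
  have hE : AbsolutelyContinuousOnInterval (fun s => Real.exp (2 * a s)) 0 t :=
    AbsolutelyContinuousOnInterval.exp_comp (haAC.const_mul 2)
  have h1 := hE.integral_deriv_eq_sub
  have h2 : ∫ s in (0 : ℝ)..t, deriv (fun s => Real.exp (2 * a s)) s
      = ∫ s in (0 : ℝ)..t, 2 * (κ s * Real.exp (2 * a s)) := by
    refine intervalIntegral.integral_congr_ae ?_
    filter_upwards [hκ.ae_hasDerivAt_integral] with s hs hsm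
    have := ((hs (Set.uIoc_subset_uIcc hsm) 0 (by simp)).const_mul 2).exp
    rw [this.deriv]
    ring
  rw [h2, intervalIntegral.integral_const_mul] at h1
  have h3 : a 0 = 0 := by simp [ha]
  rw [h3] at h1
  simp at h1
  change ∫ s in (0 : ℝ)..t, κ s * Real.exp (2 * a s) ≤ Real.exp (2 * a t) / 2
  linarith

/-- The weight `exp (2 ∫₀ᵗ κ)` is continuous. -/
theorem continuousOn_exp_integral {T : ℝ} {κ : ℝ → ℝ} (hκ : IntervalIntegrable κ volume 0 T) :
    ContinuousOn (fun t => Real.exp (2 * ∫ r in (0 : ℝ)..t, κ r)) (Set.uIcc 0 T) :=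
  (Real.continuous_exp.comp_continuousOn
    ((hκ.absolutelyContinuousOnInterval_intervalIntegral (c := 0) (by simp)).continuousOn.const_smul
      (2 : ℝ)))

theorem one_le_exp_integral {t : ℝ} (ht : 0 ≤ t) {κ : ℝ → ℝ} (hκ0 : ∀ s, 0 ≤ κ s) :
    1 ≤ Real.exp (2 * ∫ r in (0 : ℝ)..t, κ r) :=
  Real.one_le_exp (mul_nonneg zero_le_two (intervalIntegral.integral_nonneg ht fun s _ => hκ0 s))

end AbsolutelyContinuous

/-! ### Existence of Carathéodory solutions -/

section Picard

variable {E : Type*} [NormedAddCommGroup E] [NormedSpace ℝ E] [CompleteSpace E]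

/-- Picard iteration in an exponentially weighted norm. The Lipschitz constant is only locally
integrable in time, which suits controls in `L²`; the weight `e` gives a global solution without
patching short intervals. -/
theorem exists_integral_solution (F : ℝ → E → E) (x₀ : E) {κ : ℝ → ℝ} (hκ0 : ∀ t, 0 ≤ κ t)
    (hκ : ∀ T, 0 ≤ T → IntervalIntegrable κ volume 0 T)
    (hF : ∀ t x y, ‖F t x - F t y‖ ≤ κ t * ‖x - y‖)
    (hFint : ∀ x : ℝ → E, ContinuousOn x (Set.Ici 0) →
      ∀ T, 0 ≤ T → IntervalIntegrable (fun t => F t (x t)) volume 0 T) :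
    ∃ x : ℝ → E, ContinuousOn x (Set.Ici 0) ∧
      ∀ t, 0 ≤ t → x t = x₀ + ∫ s in (0 : ℝ)..t, F s (x s) := by
  set e : ℝ → ℝ := fun t => Real.exp (2 * ∫ r in (0 : ℝ)..t, κ r) with he
  have he1 : ∀ s, 0 ≤ s → 1 ≤ e s := fun s hs => one_le_exp_integral hs hκ0
  let Φ : (ℝ → E) → ℝ → E := fun x t => x₀ + ∫ s in (0 : ℝ)..t, F s (x s)
  let X : ℕ → ℝ → E := fun j => Φ^[j] (fun _ => x₀)
  have hXs : ∀ j, X (j + 1) = Φ (X j) := fun j => Function.iterate_succ_apply' _ _ _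
  have hΦc : ∀ x : ℝ → E, ContinuousOn x (Set.Ici 0) → ContinuousOn (Φ x) (Set.Ici 0) := by
    intro x hx t ht
    have ht' : (0 : ℝ) ≤ t + 1 := by linarith [Set.mem_Ici.1 ht]
    -- The horizon `t + 1` makes the compact interval a neighbourhood of `t` within `[0, ∞)`.
    have h1 : ContinuousOn (fun t => ∫ s in (0 : ℝ)..t, F s (x s)) (Set.uIcc 0 (t + 1)) :=
      intervalIntegral.continuousOn_primitive_interval (by
        have := hFint x hx (t + 1) ht'
        rw [Set.uIcc_of_le ht', integrableOn_Icc_iff_integrableOn_Ioc]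
        exact (intervalIntegrable_iff_integrableOn_Ioc_of_le ht').1 this)
    rw [Set.uIcc_of_le ht'] at h1
    have h2 := (h1 t ⟨ht, by linarith⟩).const_add x₀
    refine h2.mono_of_mem_nhdsWithin ?_
    rw [← Set.Ici_inter_Iic]
    exact inter_mem self_mem_nhdsWithin (mem_nhdsWithin_of_mem_nhds (Iic_mem_nhds (by linarith)))
  have hXc : ∀ j, ContinuousOn (X j) (Set.Ici 0) := by
    intro j
    induction j with
    | zero => exact continuousOn_const
    | succ j ih => rw [hXs]; exact hΦc _ ih
  have hsubset : ∀ {s T : ℝ}, 0 ≤ s → s ≤ T → Set.uIcc 0 s ⊆ Set.uIcc 0 T := by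
    intro s T hs hT
    rw [Set.uIcc_of_le hs, Set.uIcc_of_le (hs.trans hT)]; exact Set.Icc_subset_Icc_right hT
  have hcontr : ∀ (x y : ℝ → E), ContinuousOn x (Set.Ici 0) → ContinuousOn y (Set.Ici 0) →
      ∀ (T c : ℝ), 0 ≤ c → (∀ s ∈ Set.Icc 0 T, ‖x s - y s‖ ≤ c * e s) →
      ∀ s ∈ Set.Icc 0 T, ‖Φ x s - Φ y s‖ ≤ c / 2 * e s := by
    intro x y hx hy T c hc hyp s hs
    have hκs := hκ s hs.1
    have h1 : Φ x s - Φ y s = ∫ r in (0 : ℝ)..s, (F r (x r) - F r (y r)) := by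
      rw [intervalIntegral.integral_sub (hFint x hx s hs.1) (hFint y hy s hs.1)]
      simp only [Φ]; abel
    rw [h1]
    have h2 : ‖∫ r in (0 : ℝ)..s, (F r (x r) - F r (y r))‖
        ≤ ∫ r in (0 : ℝ)..s, c * (κ r * e r) := by
      refine intervalIntegral.norm_integral_le_of_norm_le hs.1 (Eventually.of_forall fun r hr => ?_)
        ((hκs.mul_continuousOn (continuousOn_exp_integral hκs)).const_mul _)
      refine (hF r _ _).trans ?_
      have := mul_le_mul_of_nonneg_left (hyp r ⟨hr.1.le, hr.2.trans hs.2⟩) (hκ0 r)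
      linarith
    rw [intervalIntegral.integral_const_mul] at h2
    have h3 : ∫ r in (0 : ℝ)..s, κ r * e r ≤ e s / 2 := integral_mul_exp_le hκs
    have h4 := mul_le_mul_of_nonneg_left h3 hc
    linarith
  have hC : ∀ T, 0 ≤ T → ∃ C, 0 ≤ C ∧ ∀ s ∈ Set.Icc 0 T, ‖X 0 s - X 1 s‖ ≤ C * e s := by
    intro T hT
    obtain ⟨C, hC⟩ := isCompact_Icc.exists_bound_of_continuousOn
      (((hXc 0).sub (hXc 1)).mono
        (Set.Icc_subset_Ici_self : Set.Icc 0 T ⊆ Set.Ici 0))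
    refine ⟨|C|, abs_nonneg C, fun s hs => ?_⟩
    exact ((hC s hs).trans (le_abs_self C)).trans
      (le_mul_of_one_le_right (abs_nonneg C) (he1 s hs.1))
  have hgeom : ∀ T C, 0 ≤ C → (∀ s ∈ Set.Icc 0 T, ‖X 0 s - X 1 s‖ ≤ C * e s) →
      ∀ j, ∀ s ∈ Set.Icc 0 T, ‖X j s - X (j + 1) s‖ ≤ C / 2 ^ j * e s := by
    intro T C hC0 hC j
    induction j with
    | zero => simpa using hC
    | succ j ih =>
      have := hcontr (X j) (X (j + 1)) (hXc j) (hXc (j + 1)) T _ (by positivity) ih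
      rw [div_div, ← pow_succ] at this
      simpa only [hXs] using this
  have hdist : ∀ T C, 0 ≤ C → (∀ s ∈ Set.Icc 0 T, ‖X 0 s - X 1 s‖ ≤ C * e s) →
      ∀ s ∈ Set.Icc 0 T, ∀ j, dist (X j s) (X (j + 1) s) ≤ (C * e s) * (1 / 2) ^ j := by
    intro T C hC0 hC s hs j
    rw [dist_eq_norm]
    refine (hgeom T C hC0 hC j s hs).trans (le_of_eq ?_)
    rw [one_div, inv_pow]; ring
  have hlimex : ∀ s, ∃ y, 0 ≤ s → Tendsto (fun j => X j s) atTop (𝓝 y) := by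
    intro s
    by_cases hs : 0 ≤ s
    · obtain ⟨C, hC0, hC⟩ := hC s hs
      obtain ⟨y, hy⟩ := cauchySeq_tendsto_of_complete
        (cauchySeq_of_le_geometric (1 / 2) (C * e s) (by norm_num)
          (hdist s C hC0 hC s ⟨hs, le_rfl⟩))
      exact ⟨y, fun _ => hy⟩
    · exact ⟨0, fun h => absurd h hs⟩
  choose x hx using hlimex
  have herr : ∀ T C, 0 ≤ C → (∀ s ∈ Set.Icc 0 T, ‖X 0 s - X 1 s‖ ≤ C * e s) →
      ∀ j, ∀ s ∈ Set.Icc 0 T, ‖X j s - x s‖ ≤ 2 * C / 2 ^ j * e s := by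
    intro T C hC0 hC j s hs
    have := dist_le_of_le_geometric_of_tendsto (1 / 2) (C * e s) (by norm_num)
      (hdist T C hC0 hC s hs) (hx s hs.1) j
    rw [dist_eq_norm] at this
    refine this.trans (le_of_eq ?_)
    rw [one_div, inv_pow]; ring
  have hxc : ContinuousOn x (Set.Ici 0) := by
    intro t ht
    have ht' : (0 : ℝ) ≤ t + 1 := by linarith [Set.mem_Ici.1 ht]
    obtain ⟨C, hC0, hC⟩ := hC (t + 1) ht'
    obtain ⟨D, hD⟩ := isCompact_uIcc.exists_bound_of_continuousOn
      (continuousOn_exp_integral (hκ (t + 1) ht'))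
    have hunif : TendstoUniformlyOn X x atTop (Set.Icc 0 (t + 1)) := by
      rw [Metric.tendstoUniformlyOn_iff]
      intro ε hε
      have hl : Tendsto (fun j : ℕ => 2 * C / 2 ^ j * |D|) atTop (𝓝 0) := by
        simpa using (tendsto_const_nhds.div_atTop
          (tendsto_pow_atTop_atTop_of_one_lt (one_lt_two (α := ℝ)))).mul_const |D|
      filter_upwards [hl.eventually_lt_const hε] with j hj s hs
      rw [dist_comm, dist_eq_norm]
      refine lt_of_le_of_lt ((herr _ C hC0 hC j s hs).trans ?_) hj
      refine mul_le_mul_of_nonneg_left ?_ (by positivity)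
      exact (le_abs_self _).trans ((hD s (by rwa [Set.uIcc_of_le ht'])).trans (le_abs_self D))
    have h1 := hunif.continuousOn (Frequently.of_forall fun j =>
      (hXc j).mono Set.Icc_subset_Ici_self)
    refine (h1 t ⟨ht, by linarith⟩).mono_of_mem_nhdsWithin ?_
    rw [← Set.Ici_inter_Iic]
    exact inter_mem self_mem_nhdsWithin (mem_nhdsWithin_of_mem_nhds (Iic_mem_nhds (by linarith)))
  refine ⟨x, hxc, fun t ht => ?_⟩
  obtain ⟨C, hC0, hC⟩ := hC t ht
  have h1 : Tendsto (fun j => X (j + 1) t) atTop (𝓝 (x t)) := (hx t ht).comp (tendsto_add_atTop_nat 1)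
  have h2 : Tendsto (fun j => X (j + 1) t) atTop (𝓝 (Φ x t)) := by
    rw [tendsto_iff_norm_sub_tendsto_zero]
    have hl : Tendsto (fun j : ℕ => 2 * C / 2 ^ j / 2 * e t) atTop (𝓝 0) := by
      simpa using ((tendsto_const_nhds.div_atTop
        (tendsto_pow_atTop_atTop_of_one_lt (one_lt_two (α := ℝ)))).div_const 2).mul_const (e t)
    refine tendsto_of_tendsto_of_tendsto_of_le_of_le tendsto_const_nhds hl
      (fun j => norm_nonneg _) fun j => ?_
    have := hcontr (X j) x (hXc j) hxc t _ (by positivity) (herr t C hC0 hC j) t ⟨ht, le_rfl⟩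
    simpa only [hXs] using this
  exact tendsto_nhds_unique h1 h2

end Picard

/-! ### Locally square integrable functions and the control system -/

section LocallySquareIntegrable

/-- `f` is square integrable on every `(0, T]`. -/
def LocL2 (f : ℝ → ℝ) : Prop :=
  ∀ T : ℝ, 0 ≤ T → MemLp f 2 (volume.restrict (Set.Ioc 0 T))

/-- `f` is integrable on every `(0, T]`. -/
def LocInt (f : ℝ → ℝ) : Prop :=
  ∀ T : ℝ, 0 ≤ T → IntervalIntegrable f volume 0 T

variable {f g : ℝ → ℝ}

theorem LocL2.add (hf : LocL2 f) (hg : LocL2 g) : LocL2 (fun t => f t + g t) :=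
  fun T hT => (hf T hT).add (hg T hT)

theorem LocL2.sub (hf : LocL2 f) (hg : LocL2 g) : LocL2 (fun t => f t - g t) :=
  fun T hT => (hf T hT).sub (hg T hT)

theorem LocL2.const_mul (hf : LocL2 f) (c : ℝ) : LocL2 (fun t => c * f t) :=
  fun T hT => (hf T hT).const_mul c

theorem LocL2.sum {ι : Type*} (s : Finset ι) {f : ι → ℝ → ℝ} (hf : ∀ i ∈ s, LocL2 (f i)) :
    LocL2 (fun t => ∑ i ∈ s, f i t) :=
  fun T hT => memLp_finsetSum s fun i hi => hf i hi T hT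

theorem LocL2.mul (hf : LocL2 f) (hg : LocL2 g) : LocInt (fun t => f t * g t) := fun T hT =>
  (intervalIntegrable_iff_integrableOn_Ioc_of_le hT).2 ((hf T hT).integrable_mul (hg T hT))

theorem LocL2.locInt (hf : LocL2 f) : LocInt f := fun T hT =>
  (intervalIntegrable_iff_integrableOn_Ioc_of_le hT).2 ((hf T hT).integrable (by norm_num))

theorem LocInt.add (hf : LocInt f) (hg : LocInt g) : LocInt (fun t => f t + g t) :=
  fun T hT => (hf T hT).add (hg T hT)

theorem LocInt.const_mul (hf : LocInt f) (c : ℝ) : LocInt (fun t => c * f t) :=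
  fun T hT => (hf T hT).const_mul c

theorem LocInt.sum {ι : Type*} (s : Finset ι) {f : ι → ℝ → ℝ} (hf : ∀ i ∈ s, LocInt (f i)) :
    LocInt (fun t => ∑ i ∈ s, f i t) := fun T hT => by
  simpa [Finset.sum_fn] using IntervalIntegrable.sum s fun i hi => hf i hi T hT

theorem locL2_of_continuousOn (hf : ContinuousOn f (Set.Ici 0)) : LocL2 f := fun T _ => by
  have hc : ContinuousOn f (Set.Icc 0 T) := hf.mono Set.Icc_subset_Ici_self
  obtain ⟨C, hC⟩ := isCompact_Icc.exists_bound_of_continuousOn hc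
  refine MemLp.of_bound ((hc.mono Set.Ioc_subset_Icc_self).aestronglyMeasurable measurableSet_Ioc)
    C ?_
  exact (ae_restrict_iff' measurableSet_Ioc).2
    (Eventually.of_forall fun t ht => hC t (Set.Ioc_subset_Icc_self ht))

theorem locL2_abs (hf : LocL2 f) : LocL2 (fun t => |f t|) := fun T hT => (hf T hT).norm

variable {ι κ : Type*} [Fintype ι]

theorem locL2_mulVec (M : Matrix κ ι ℝ) {x : ℝ → ι → ℝ} (hx : ∀ i, LocL2 fun t => x t i) (i : κ) :
    LocL2 fun t => (M *ᵥ x t) i :=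
  LocL2.sum Finset.univ fun j _ => (hx j).const_mul (M i j)

theorem locInt_dotProduct_self {x : ℝ → ι → ℝ} (hx : ∀ i, LocL2 fun t => x t i) :
    LocInt fun t => x t ⬝ᵥ x t :=
  LocInt.sum Finset.univ fun j _ => (hx j).mul (hx j)

theorem locL2_of_squareIntegrable {d : ℕ} {u : ℝ → Fin d → ℝ} (hu : SquareIntegrable u)
    (k : Fin d) : LocL2 fun t => u t k := fun T _ => by
  have h1 : MemLp (fun t => WithLp.toLp 2 (u t)) 2 (volume.restrict (Set.Ioc 0 T)) :=
    hu.mono_measure (Measure.restrict_mono Set.Ioc_subset_Ioi_self le_rfl)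
  exact (EuclideanSpace.proj (𝕜 := ℝ) k).comp_memLp' h1

end LocallySquareIntegrable

section ControlSystem

/-- The right-hand side `A x + B u + ∑ k, (N k x + E k u) (u k)`. -/
def controlRHS {n m : ℕ} (A : Matrix (Fin n) (Fin n) ℝ) (B : Matrix (Fin n) (Fin m) ℝ)
    (N : Fin m → Matrix (Fin n) (Fin n) ℝ) (E : Fin m → Matrix (Fin n) (Fin m) ℝ)
    (u : Fin m → ℝ) (x : Fin n → ℝ) : Fin n → ℝ :=
  A *ᵥ x + B *ᵥ u + ∑ k, u k • (N k *ᵥ x + E k *ᵥ u)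

variable {n m : ℕ} {A : Matrix (Fin n) (Fin n) ℝ} {B : Matrix (Fin n) (Fin m) ℝ}
  {N : Fin m → Matrix (Fin n) (Fin n) ℝ} {E : Fin m → Matrix (Fin n) (Fin m) ℝ}
  {u : ℝ → Fin m → ℝ}

theorem locInt_controlRHS (hu : ∀ k, LocL2 fun t => u t k) {x : ℝ → Fin n → ℝ}
    (hx : ∀ i, LocL2 fun t => x t i) (i : Fin n) :
    LocInt fun t => controlRHS A B N E (u t) (x t) i := by
  have h : LocInt fun t => (A *ᵥ x t) i + (B *ᵥ u t) i
      + ∑ k, u t k * ((N k *ᵥ x t) i + (E k *ᵥ u t) i) :=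
    ((locL2_mulVec A hx i).locInt.add (locL2_mulVec B hu i).locInt).add
      (LocInt.sum Finset.univ fun k _ =>
        (hu k).mul ((locL2_mulVec (N k) hx i).add (locL2_mulVec (E k) hu i)))
  convert! h using 2
  simp [controlRHS, Finset.sum_apply, mul_add]

theorem intervalIntegrable_controlRHS (hu : ∀ k, LocL2 fun t => u t k) {x : ℝ → Fin n → ℝ}
    (hx : ∀ i, LocL2 fun t => x t i) {T : ℝ} (hT : 0 ≤ T) :
    IntervalIntegrable (fun t => controlRHS A B N E (u t) (x t)) volume 0 T :=
  (intervalIntegrable_iff_integrableOn_Ioc_of_le hT).2 (Integrable.of_eval fun i =>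
    (intervalIntegrable_iff_integrableOn_Ioc_of_le hT).1 (locInt_controlRHS hu hx i T hT))

theorem IsSolution.locL2 {x₀ : Fin n → ℝ} {x : ℝ → Fin n → ℝ} (h : IsSolution A B N E x₀ u x)
    (i : Fin n) : LocL2 fun t => x t i :=
  locL2_of_continuousOn ((continuous_apply i).comp_continuousOn h.1)

theorem IsSolution.initial {x₀ : Fin n → ℝ} {x : ℝ → Fin n → ℝ}
    (h : IsSolution A B N E x₀ u x) : x 0 = x₀ := by
  simpa using h.2 0 le_rfl

theorem IsSolution.isPrimitive (hu : ∀ k, LocL2 fun t => u t k) {x₀ : Fin n → ℝ}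
    {x : ℝ → Fin n → ℝ} (h : IsSolution A B N E x₀ u x) (i : Fin n) :
    IsPrimitive (fun t => x t i) (fun t => controlRHS A B N E (u t) (x t) i) := by
  intro T hT
  refine ⟨locInt_controlRHS hu h.locL2 i T hT, ?_⟩
  have h1 := congrFun (h.2 T hT) i
  simp only [h.initial, h1]
  rw [Pi.add_apply, intervalIntegral.integral_of_le hT,
    intervalIntegral.integral_of_le hT]
  congr 1
  refine eval_integral (μ := volume.restrict (Set.Ioc 0 T))
    (f := fun t => controlRHS A B N E (u t) (x t)) (fun i => ?_) i
  exact (intervalIntegrable_iff_integrableOn_Ioc_of_le hT).1 (locInt_controlRHS hu h.locL2 i T hT)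

theorem exists_isSolution (A : Matrix (Fin n) (Fin n) ℝ) (B : Matrix (Fin n) (Fin m) ℝ)
    (N : Fin m → Matrix (Fin n) (Fin n) ℝ) (E : Fin m → Matrix (Fin n) (Fin m) ℝ)
    (hu : ∀ k, LocL2 fun t => u t k) (x₀ : Fin n → ℝ) : ∃ x, IsSolution A B N E x₀ u x := by
  let L : Matrix (Fin n) (Fin n) ℝ → (Fin n → ℝ) →L[ℝ] (Fin n → ℝ) := fun M =>
    LinearMap.toContinuousLinearMap (Matrix.mulVecLin M)
  have hκ : LocInt fun t => ‖L A‖ + ∑ k, ‖L (N k)‖ * |u t k| :=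
    LocInt.add (fun T _ => intervalIntegrable_const)
      (LocInt.sum Finset.univ fun k _ => (locL2_abs (hu k)).locInt.const_mul _)
  refine exists_integral_solution (fun t x => controlRHS A B N E (u t) x) x₀
    (fun t => by positivity) hκ (fun t x y => ?_) (fun x hx T hT => ?_)
  · have h1 : controlRHS A B N E (u t) x - controlRHS A B N E (u t) y
        = L A (x - y) + ∑ k, u t k • L (N k) (x - y) := by
      have h2 : ∀ M z, L M z = M *ᵥ z := fun M z => rfl
      simp only [controlRHS, h2, Matrix.mulVec_sub, smul_add, smul_sub, Finset.sum_add_distrib,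
        Finset.sum_sub_distrib]
      abel
    rw [h1, add_mul, Finset.sum_mul]
    refine (norm_add_le _ _).trans (add_le_add ((L A).le_opNorm _)
      ((norm_sum_le _ _).trans (Finset.sum_le_sum fun k _ => ?_)))
    rw [norm_smul, Real.norm_eq_abs, mul_comm ‖L (N k)‖, mul_assoc]
    exact mul_le_mul_of_nonneg_left ((L (N k)).le_opNorm _) (abs_nonneg _)
  · exact intervalIntegrable_controlRHS hu
      (fun i => locL2_of_continuousOn ((continuous_apply i).comp_continuousOn hx)) hT

end ControlSystem

/-! ### The energy estimate for homogeneous bilinear systems -/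

section Energy

variable {ι κ π ρ : Type*} [Fintype ι] [Fintype κ] [Fintype π] [Fintype ρ]

/-- The finite horizon observability Gramian `Φ` with `Φ' = L* Φ + Cᵀ C`, `Φ 0 = 0`. -/
theorem exists_finite_horizon_gramian (γ : ℝ) (A : Matrix ι ι ℝ) (N : κ → Matrix ι ι ℝ)
    {D : Matrix ι ι ℝ} (hD : D.PosSemidef) :
    ∃ Φ M : ℝ → Matrix ι ι ℝ, (∀ i j, Φ 0 i j = 0) ∧
      (∀ i j, Continuous fun t => M t i j) ∧
      (∀ t i j, HasDerivAt (fun s => Φ s i j) (M t i j) t) ∧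
      (∀ t, M t = sylv γ A N A N (Φ t) + D) ∧
      (∀ t, 0 ≤ t → (Φ t).PosSemidef) ∧ ∀ t, 0 ≤ t → (M t).PosSemidef := by
  obtain ⟨M, hM0, hMd⟩ := exists_matrixFlow (sylv γ A N A N) D
  have hMc : ∀ i j, Continuous fun t => M t i j := fun i j =>
    continuous_iff_continuousAt.2 fun t => (hMd t i j).continuousAt
  have hMp : ∀ t, 0 ≤ t → (M t).PosSemidef := fun t ht =>
    lyap_flow_posSemidef (isMatrixFlow_of_hasDerivAt hMd) (by rwa [hM0]) ht
  let Φ : ℝ → Matrix ι ι ℝ := fun t => Matrix.of fun i j => ∫ s in (0 : ℝ)..t, M s i j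
  have hΦ0 : ∀ i j, Φ 0 i j = 0 := fun i j => by simp [Φ]
  have hΦd : ∀ t i j, HasDerivAt (fun s => Φ s i j) (M t i j) t := fun t i j =>
    ((hMc i j).integral_hasStrictDerivAt 0 t).hasDerivAt
  refine ⟨Φ, M, hΦ0, hMc, hΦd, fun t => ?_, fun t ht => ?_, hMp⟩
  · ext i j
    -- Both `M` and `L Φ` have derivative `L M`, so their difference keeps its initial value `D`.
    have hd : ∀ s, HasDerivAt (fun s => M s i j - sylv γ A N A N (Φ s) i j) 0 s := by
      intro s
      have h1 := hasDerivWithinAt_linearMap_apply (sylv γ A N A N) (Z := Φ) (s := Set.univ) (t := s)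
        (fun i j => (hΦd s i j).hasDerivWithinAt) i j
      rw [hasDerivWithinAt_univ] at h1
      have h2 := (hMd s i j).fun_sub h1
      rwa [sub_self] at h2
    have h2 := is_const_of_deriv_eq_zero (fun s => (hd s).differentiableAt)
      (fun s => (hd s).deriv) t 0
    have h3 : Φ 0 = 0 := by ext i j; exact hΦ0 i j
    simp only [h3, hM0, map_zero, Matrix.zero_apply, sub_zero] at h2
    rw [Matrix.add_apply]
    linarith
  · refine posSemidef_iff_quadForm.2 ⟨?_, fun v => ?_⟩
    · ext i j
      refine intervalIntegral.integral_congr fun s hs => ?_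
      rw [Set.uIcc_of_le ht] at hs
      exact congrFun (congrFun (posSemidef_iff_quadForm.1 (hMp s hs.1)).1 i) j
    · have hd : ∀ s, HasDerivAt (fun s => v ⬝ᵥ (Φ s *ᵥ v)) (v ⬝ᵥ (M s *ᵥ v)) s := by
        intro s
        have := hasDerivAt_quadForm (x := fun _ => v) (x' := 0) (t := s)
          (fun i => hasDerivAt_const _ _) (hΦd s)
        simpa using this
      have hmono : MonotoneOn (fun s => v ⬝ᵥ (Φ s *ᵥ v)) (Set.Ici 0) := by
        refine monotoneOn_of_deriv_nonneg (convex_Ici 0)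
          (fun τ _ => (hd τ).continuousAt.continuousWithinAt)
          (fun τ _ => (hd τ).differentiableAt.differentiableWithinAt) fun τ hτ => ?_
        rw [interior_Ici] at hτ
        rw [(hd τ).deriv]
        exact (posSemidef_iff_quadForm.1 (hMp τ (le_of_lt hτ))).2 v
      have h3 : Φ 0 = 0 := by ext i j; exact hΦ0 i j
      have := hmono Set.self_mem_Ici ht ht
      simpa [h3] using this

theorem quadForm_add {S : Matrix ι ι ℝ} (hS : Sᵀ = S) (a b : ι → ℝ) :
    (a + b) ⬝ᵥ (S *ᵥ (a + b)) = a ⬝ᵥ (S *ᵥ a) + 2 * (a ⬝ᵥ (S *ᵥ b)) + b ⬝ᵥ (S *ᵥ b) := by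
  have h : b ⬝ᵥ (S *ᵥ a) = a ⬝ᵥ (S *ᵥ b) := by
    rw [dotProduct_transpose_mulVec_comm, hS, dotProduct_comm]
  simp only [Matrix.mulVec_add, add_dotProduct, dotProduct_add]
  rw [h]; ring

/-- Young's inequality, from the form at `γ c a - γ⁻¹ b`. The weight `γ⁻²` matches the one in the
Lyapunov operator. -/
theorem two_mul_quadForm_le {S : Matrix ι ι ℝ} (hS : S.PosSemidef) {γ : ℝ} (hγ : 0 < γ) (c : ℝ)
    (a b : ι → ℝ) :
    2 * c * (a ⬝ᵥ (S *ᵥ b)) ≤ (1 / γ ^ 2) * (b ⬝ᵥ (S *ᵥ b)) + γ ^ 2 * c ^ 2 * (a ⬝ᵥ (S *ᵥ a)) := by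
  obtain ⟨hs, hq⟩ := posSemidef_iff_quadForm.1 hS
  have h := hq ((γ * c) • a + (-(1 / γ)) • b)
  rw [quadForm_add hs] at h
  simp only [Matrix.mulVec_smul, smul_dotProduct, dotProduct_smul, smul_eq_mul] at h
  have h1 : γ * c * (-(1 / γ) * a ⬝ᵥ (S *ᵥ b)) = -(c * a ⬝ᵥ (S *ᵥ b)) := by field_simp
  have h2 : -(1 / γ) * (-(1 / γ) * b ⬝ᵥ (S *ᵥ b)) = (1 / γ ^ 2) * (b ⬝ᵥ (S *ᵥ b)) := by
    field_simp
  rw [mul_left_comm (-(1 / γ)), mul_left_comm (γ * c)] at h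
  nlinarith

theorem quadForm_sylv_transpose (γ : ℝ) (A : Matrix ι ι ℝ) (N : κ → Matrix ι ι ℝ)
    {S : Matrix ι ι ℝ} (hS : Sᵀ = S) (x : ι → ℝ) :
    x ⬝ᵥ (sylv γ Aᵀ (fun k => (N k)ᵀ) Aᵀ (fun k => (N k)ᵀ) S *ᵥ x)
      = 2 * (x ⬝ᵥ (S *ᵥ (A *ᵥ x)))
        + (1 / γ ^ 2) * ∑ k, (N k *ᵥ x) ⬝ᵥ (S *ᵥ (N k *ᵥ x)) := by
  have h1 : x ⬝ᵥ ((Aᵀ * S) *ᵥ x) = x ⬝ᵥ (S *ᵥ (A *ᵥ x)) := by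
    rw [← Matrix.mulVec_mulVec, dotProduct_transpose_mulVec_comm, Matrix.transpose_transpose,
      dotProduct_transpose_mulVec_comm, hS, dotProduct_comm]
  have h2 : ∀ k, x ⬝ᵥ (((N k)ᵀ * S * N k) *ᵥ x) = (N k *ᵥ x) ⬝ᵥ (S *ᵥ (N k *ᵥ x)) := fun k => by
    rw [Matrix.mul_assoc, ← Matrix.mulVec_mulVec, dotProduct_transpose_mulVec_comm,
      Matrix.transpose_transpose, ← Matrix.mulVec_mulVec]
  rw [sylv_apply]
  simp only [Matrix.add_mulVec, dotProduct_add, Matrix.smul_mulVec, Matrix.sum_mulVec,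
    dotProduct_smul, dotProduct_sum, Matrix.transpose_transpose, h1, h2, smul_eq_mul]
  rw [← Matrix.mulVec_mulVec]
  ring

/-- With `V t = xᵀ Φ(T - t) x`, the equation `Φ' = L* Φ + Cᵀ C` and Young's inequality give `V' ≤
-|C x|² + γ² |u'|² V`. The initial storage is at most `tr(Fᵀ Φ(T) F) |v₀|²`, and by duality this
trace equals `tr((Cᵀ C - Φ'(T)) P) ≤ tr(C P Cᵀ)`. -/
theorem homogeneous_energy_le {γ : ℝ} (hγ : 0 < γ) {A : Matrix ι ι ℝ} {N : κ → Matrix ι ι ℝ}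
    (C : Matrix π ι ℝ) {P : Matrix ι ι ℝ} (hP : P.PosSemidef) {F : Matrix ι ρ ℝ}
    (hL : sylv γ A N A N P = -(F * Fᵀ)) {u u' : ℝ → κ → ℝ}
    (hu' : ∀ k, LocL2 fun t => u' t k) (hN : ∀ t k, N k = 0 ∨ u' t k = u t k) {x : ℝ → ι → ℝ}
    (hx : ∀ i, IsPrimitive (fun t => x t i) (fun t => (A *ᵥ x t + ∑ k, u t k • (N k *ᵥ x t)) i))
    {v₀ : ρ → ℝ} (hx0 : x 0 = F *ᵥ v₀) {T : ℝ} (hT : 0 ≤ T) :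
    ∫ t in (0 : ℝ)..T, (C *ᵥ x t) ⬝ᵥ (C *ᵥ x t)
      ≤ Real.exp (∫ t in (0 : ℝ)..T, ∑ k, γ ^ 2 * u' t k ^ 2)
        * ((C * P * Cᵀ).trace * (v₀ ⬝ᵥ v₀)) := by
  have hD : (Cᵀ * C).PosSemidef := by simpa using Matrix.posSemidef_conjTranspose_mul_self C
  obtain ⟨Φ, M, hΦ0, hMc, hΦd, hΦM, hΦp, hMp⟩ :=
    exists_finite_horizon_gramian γ Aᵀ (fun k => (N k)ᵀ) hD
  have hxL : ∀ i, LocL2 fun t => x t i := fun i => locL2_of_continuousOn (hx i).continuousOn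
  have hΦr : ∀ t i j, HasDerivAt (fun s => Φ (T - s) i j) (-(M (T - t) i j)) t := fun t i j =>
    HasDerivAt.comp_const_sub (f := fun s => Φ s i j) T t (hΦd (T - t) i j)
  have hΦAC : ∀ i j, AbsolutelyContinuousOnInterval (fun s => Φ (T - s) i j) 0 T := fun i j => by
    have h1 : ContDiff ℝ 1 (fun s => Φ (T - s) i j) := by
      rw [contDiff_one_iff_deriv]
      refine ⟨fun t => (hΦr t i j).differentiableAt, ?_⟩
      have : deriv (fun s => Φ (T - s) i j) = fun t => -(M (T - t) i j) := by
        ext t; exact (hΦr t i j).deriv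
      rw [this]
      exact ((hMc i j).comp (continuous_const.sub continuous_id)).neg
    exact h1.contDiffOn.absolutelyContinuousOnInterval
  set V : ℝ → ℝ := fun t => x t ⬝ᵥ (Φ (T - t) *ᵥ x t) with hV
  have hVAC : AbsolutelyContinuousOnInterval V 0 T := by
    have : V = fun t => ∑ i, ∑ j, x t i * Φ (T - t) i j * x t j := by
      ext t; exact quadForm_eq_sum _ _
    rw [this]
    exact absolutelyContinuousOnInterval_sum _ fun i _ =>
      absolutelyContinuousOnInterval_sum _ fun j _ =>
        (((hx i).absolutelyContinuousOnInterval hT).fun_mul (hΦAC i j)).fun_mul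
          ((hx j).absolutelyContinuousOnInterval hT)
  have hm : LocInt fun t => ∑ k, γ ^ 2 * u' t k ^ 2 := by
    simp only [sq (u' _ _)]
    exact LocInt.sum _ fun k _ => ((hu' k).mul (hu' k)).const_mul _
  have hp : LocInt fun t => (C *ᵥ x t) ⬝ᵥ (C *ᵥ x t) :=
    locInt_dotProduct_self (locL2_mulVec C hxL)
  have hmain := integral_le_of_dissipation hT hVAC (b := fun _ => 0)
    ((posSemidef_iff_quadForm.1 (hΦp (T - T) (by simp))).2 (x T)) (hm T hT)
    (fun t => by positivity) (hp T hT) (fun t => dotProduct_self_nonneg' _)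
    intervalIntegrable_const (fun _ => le_rfl) (by
      have hall : ∀ᵐ t, ∀ i, t ∈ Set.Ioo 0 T →
          HasDerivAt (fun t => x t i) ((A *ᵥ x t + ∑ k, u t k • (N k *ᵥ x t)) i) t :=
        ae_all_iff.2 fun i => (hx i).ae_hasDerivAt hT
      filter_upwards [hall] with t ht htm
      have htT : 0 ≤ T - t := by linarith [htm.2]
      obtain ⟨hs, hq⟩ := posSemidef_iff_quadForm.1 (hΦp (T - t) htT)
      refine ⟨_, hasDerivAt_quadForm (Φ' := -M (T - t)) (fun i => ht i htm)
        (fun i j => hΦr t i j), ?_⟩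
      set x' := A *ᵥ x t + ∑ k, u t k • (N k *ᵥ x t) with hx'
      have e1 : x' ⬝ᵥ (Φ (T - t) *ᵥ x t) = x t ⬝ᵥ (Φ (T - t) *ᵥ x') := by
        rw [dotProduct_transpose_mulVec_comm, hs, dotProduct_comm]
      have e2 : x t ⬝ᵥ (M (T - t) *ᵥ x t) = 2 * (x t ⬝ᵥ (Φ (T - t) *ᵥ (A *ᵥ x t)))
          + (1 / γ ^ 2) * (∑ k, (N k *ᵥ x t) ⬝ᵥ (Φ (T - t) *ᵥ (N k *ᵥ x t)))
          + (C *ᵥ x t) ⬝ᵥ (C *ᵥ x t) := by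
        rw [hΦM, Matrix.add_mulVec, dotProduct_add, quadForm_sylv_transpose γ A N hs,
          ← Matrix.mulVec_mulVec]
        congr 1
        rw [Matrix.dotProduct_mulVec, Matrix.vecMul_transpose]
      have e3 : x t ⬝ᵥ (Φ (T - t) *ᵥ x') = x t ⬝ᵥ (Φ (T - t) *ᵥ (A *ᵥ x t))
          + ∑ k, u t k * (x t ⬝ᵥ (Φ (T - t) *ᵥ (N k *ᵥ x t))) := by
        rw [hx', Matrix.mulVec_add, dotProduct_add, Matrix.mulVec_sum, dotProduct_sum]
        simp only [Matrix.mulVec_smul, dotProduct_smul, smul_eq_mul]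
      have e4 : 2 * ∑ k, u t k * (x t ⬝ᵥ (Φ (T - t) *ᵥ (N k *ᵥ x t)))
          ≤ (1 / γ ^ 2) * (∑ k, (N k *ᵥ x t) ⬝ᵥ (Φ (T - t) *ᵥ (N k *ᵥ x t)))
            + (∑ k, γ ^ 2 * u' t k ^ 2) * V t := by
        rw [Finset.mul_sum, Finset.mul_sum, Finset.sum_mul, ← Finset.sum_add_distrib]
        refine Finset.sum_le_sum fun k _ => ?_
        -- Channels with `N k = 0` contribute nothing, so `u'` may differ from `u` there.
        rcases hN t k with h0 | h0
        · have hv0 : 0 ≤ V t := hq (x t)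
          simp only [h0, Matrix.zero_mulVec, Matrix.mulVec_zero, dotProduct_zero, mul_zero,
            zero_add]
          positivity
        · have := two_mul_quadForm_le (hΦp (T - t) htT) hγ (u t k) (x t) (N k *ᵥ x t)
          rw [h0]
          simp only [hV]
          linarith
      rw [e1, Matrix.neg_mulVec, dotProduct_neg, e2, e3]
      linarith)
  rw [intervalIntegral.integral_zero, add_zero] at hmain
  refine hmain.trans (mul_le_mul_of_nonneg_left ?_ (Real.exp_pos _).le)
  have hV0 : V 0 = v₀ ⬝ᵥ ((Fᵀ * Φ T * F) *ᵥ v₀) := by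
    rw [hV, Matrix.mul_assoc, ← Matrix.mulVec_mulVec, ← Matrix.mulVec_mulVec,
      Matrix.dotProduct_mulVec v₀ Fᵀ, Matrix.vecMul_transpose]
    simp only [sub_zero, hx0]
  have hps : (Fᵀ * Φ T * F).PosSemidef := by
    simpa using (hΦp T hT).conjTranspose_mul_mul_same F
  rw [hV0]
  refine (quadForm_le_trace_mul hps v₀).trans
    (mul_le_mul_of_nonneg_right ?_ (dotProduct_self_nonneg' v₀))
  have t1 : (Fᵀ * Φ T * F).trace = -(Φ T * sylv γ A N A N P).trace := by
    rw [hL, Matrix.mul_neg, Matrix.trace_neg, neg_neg, Matrix.trace_mul_comm, ← Matrix.mul_assoc,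
      Matrix.trace_mul_comm]
  -- This is the part of the trace that is not yet observed at time `T`; it is discarded.
  have t2 := trace_mul_nonneg_of_posSemidef (hMp T hT) hP
  rw [hΦM, Matrix.add_mul, Matrix.trace_add, ← trace_sylv_adjoint] at t2
  have t3 : (C * P * Cᵀ).trace = (Cᵀ * C * P).trace := by
    rw [Matrix.trace_mul_comm, ← Matrix.mul_assoc]
  rw [t1, t3]
  linarith

end Energy

/-! ### Splitting of the coordinates -/

section Splitting

variable {n r : ℕ} {κ κ' : Type*}

theorem sum_splitIdx (h : r ≤ n) (f : Fin n → ℝ) :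
    ∑ i, f i = ∑ i, f (idx₁ h i) + ∑ i, f (idx₂ h i) := by
  rw [← Equiv.sum_comp (splitIdx h) f, Fintype.sum_sum_type]
  rfl

theorem mul_eq_split (h : r ≤ n) (M : Matrix κ (Fin n) ℝ) (X : Matrix (Fin n) κ' ℝ) :
    M * X = cols₁ h M * rows₁ h X + cols₂ h M * rows₂ h X := by
  ext i j
  simp only [Matrix.mul_apply, Matrix.add_apply]
  exact sum_splitIdx h _

theorem trace_diagonal_mul_split (h : r ≤ n) [Fintype κ] (θ : Fin n → ℝ)
    (Y Z : Matrix (Fin n) κ ℝ) :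
    (Matrix.diagonal θ * (Y * Zᵀ)).trace
      = (Matrix.diagonal (fun i => θ (idx₁ h i)) * (rows₁ h Y * (rows₁ h Z)ᵀ)).trace
        + (truncatedDiag h θ * (rows₂ h Y * (rows₂ h Z)ᵀ)).trace := by
  simp only [truncatedDiag, Matrix.trace, Matrix.diag_apply, Matrix.diagonal_mul]
  exact sum_splitIdx h _

theorem transpose_mul_diagonal_mul_split (h : r ≤ n) (θ : Fin n → ℝ) (M : Matrix (Fin n) κ ℝ)
    (M' : Matrix (Fin n) κ' ℝ) :
    Mᵀ * Matrix.diagonal θ * M'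
      = (rows₁ h M)ᵀ * Matrix.diagonal (fun i => θ (idx₁ h i)) * rows₁ h M'
        + (rows₂ h M)ᵀ * truncatedDiag h θ * rows₂ h M' := by
  rw [mul_eq_split h (Mᵀ * Matrix.diagonal θ)]
  congr 2
  · ext i j
    simp [cols₁, rows₁, Matrix.mul_diagonal]
  · ext i j
    simp [cols₂, rows₂, truncatedDiag, Matrix.mul_diagonal]

/-- The matrix with first block row `1` and second block row `J₂`. -/
def liftRows (h : r ≤ n) (J₂ : Matrix (Fin (n - r)) (Fin r) ℝ) : Matrix (Fin n) (Fin r) ℝ :=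
  Matrix.of fun i => Sum.elim (fun a => (1 : Matrix (Fin r) (Fin r) ℝ) a) (fun a => J₂ a)
    ((splitIdx h).symm i)

@[simp]
theorem rows₁_liftRows (h : r ≤ n) (J₂ : Matrix (Fin (n - r)) (Fin r) ℝ) :
    rows₁ h (liftRows h J₂) = 1 := by
  ext i j
  simp [rows₁, liftRows, idx₁]

@[simp]
theorem rows₂_liftRows (h : r ≤ n) (J₂ : Matrix (Fin (n - r)) (Fin r) ℝ) :
    rows₂ h (liftRows h J₂) = J₂ := by
  ext i j
  simp [rows₂, liftRows, idx₂]

theorem mul_liftRows (h : r ≤ n) (M : Matrix κ (Fin n) ℝ) (J₂ : Matrix (Fin (n - r)) (Fin r) ℝ) :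
    M * liftRows h J₂ = cols₁ h M + cols₂ h M * J₂ := by
  rw [mul_eq_split h, rows₁_liftRows, rows₂_liftRows, Matrix.mul_one]

theorem rows₁_mul_liftRows (h : r ≤ n) (M : Matrix (Fin n) (Fin n) ℝ)
    (J₂ : Matrix (Fin (n - r)) (Fin r) ℝ) :
    rows₁ h (M * liftRows h J₂) = block₁₁ h M + block₁₂ h M * J₂ :=
  mul_liftRows h (rows₁ h M) J₂

theorem rows₂_mul_liftRows (h : r ≤ n) (M : Matrix (Fin n) (Fin n) ℝ)
    (J₂ : Matrix (Fin (n - r)) (Fin r) ℝ) :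
    rows₂ h (M * liftRows h J₂) = block₂₁ h M + block₂₂ h M * J₂ :=
  mul_liftRows h (rows₂ h M) J₂

end Splitting

/-! ### The homogeneous subsystem -/

section Homogeneous

variable {n m q p r : ℕ}

/-- The reduced coefficients of both schemes are obtained by compressing with
`J = [1; Ā₂₁]`. -/
structure IsCompression (h : r ≤ n) (G : BilinearSystem n m q p) (μ : Method)
    (R : HomogeneousROM r m q p) : Prop where
  A₁ : rows₁ h (G.A * liftRows h (boldAbar₂₁ h G μ)) = R.A
  A₂ : rows₂ h (G.A * liftRows h (boldAbar₂₁ h G μ)) = boldA₂₁ h G μ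
  N₁ : ∀ k, rows₁ h (G.N k * liftRows h (boldAbar₂₁ h G μ)) = R.N k
  N₂ : ∀ k, rows₂ h (G.N k * liftRows h (boldAbar₂₁ h G μ)) = boldN₂₁ h G μ k
  C : G.C * liftRows h (boldAbar₂₁ h G μ) = R.C
  X₀ : rows₁ h G.X₀ = R.X₀
  cross : boldA₂₁ h G μ = 0 ∨ boldAbar₂₁ h G μ = 0

theorem isCompression_homogeneousROM (h : r ≤ n) (G : BilinearSystem n m q p) (μ : Method)
    (hμ : μ = Method.spa → IsUnit (block₂₂ h G.A).det) :
    IsCompression h G μ (homogeneousROM h G μ) := by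
  cases μ with
  | bt =>
    refine ⟨?_, ?_, fun k => ?_, fun k => ?_, ?_, rfl, Or.inr rfl⟩ <;>
    simp [rows₁_mul_liftRows, rows₂_mul_liftRows, boldAbar₂₁, boldA₂₁, boldN₂₁, homogeneousROM]
    simp [mul_liftRows]
  | spa =>
    have hu := hμ rfl
    refine ⟨?_, ?_, fun k => ?_, fun k => ?_, ?_, rfl, Or.inl rfl⟩
    · simp [rows₁_mul_liftRows, boldAbar₂₁, homogeneousROM, sub_eq_add_neg, Matrix.mul_assoc]
    · simp [rows₂_mul_liftRows, boldAbar₂₁, boldA₂₁, Matrix.mul_nonsing_inv_cancel_left _ _ hu]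
    · simp [rows₁_mul_liftRows, boldAbar₂₁, homogeneousROM, sub_eq_add_neg, Matrix.mul_assoc]
    · simp [rows₂_mul_liftRows, boldAbar₂₁, boldN₂₁, sub_eq_add_neg, Matrix.mul_assoc]
    · simp [mul_liftRows, boldAbar₂₁, homogeneousROM, sub_eq_add_neg, Matrix.mul_assoc]

variable {h : r ≤ n} {γ : ℝ} {G : BilinearSystem n m q p} {μ : Method}
  {R : HomogeneousROM r m q p} {θ : Fin n → ℝ}

/-- The observability equation of the reduced model. -/
theorem IsCompression.adjoint_lyapunov (hR : IsCompression h G μ R)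
    (hQ : sylv γ G.Aᵀ (fun k => (G.N k)ᵀ) G.Aᵀ (fun k => (G.N k)ᵀ) (Matrix.diagonal θ)
      = -(G.Cᵀ * G.C)) :
    sylv γ R.Aᵀ (fun k => (R.N k)ᵀ) R.Aᵀ (fun k => (R.N k)ᵀ)
        (Matrix.diagonal fun i => θ (idx₁ h i))
      = -(R.Cᵀ * R.C) - (1 / γ ^ 2) • ∑ k, (boldN₂₁ h G μ k)ᵀ * truncatedDiag h θ
          * boldN₂₁ h G μ k := by
  set J := liftRows h (boldAbar₂₁ h G μ) with hJ
  set Θ₁ : Matrix (Fin r) (Fin r) ℝ := Matrix.diagonal fun i => θ (idx₁ h i) with hΘ₁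
  -- The only term of `(A J)ᵀ Θ J` that involves `Θ₂`: one factor is zero for BT, the other for SPA.
  have hcross : (boldA₂₁ h G μ)ᵀ * truncatedDiag h θ * boldAbar₂₁ h G μ = 0 := by
    rcases hR.cross with h0 | h0 <;> rw [h0] <;> simp
  have e1 : (G.A * J)ᵀ * Matrix.diagonal θ * J = R.Aᵀ * Θ₁ := by
    rw [transpose_mul_diagonal_mul_split h, hR.A₁, hR.A₂, hJ, rows₁_liftRows, rows₂_liftRows,
      hcross, Matrix.mul_one, add_zero]
  have e2 : Jᵀ * Matrix.diagonal θ * (G.A * J) = Θ₁ * R.A := by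
    have := congrArg Matrix.transpose e1
    simpa [Matrix.transpose_mul, Matrix.mul_assoc, hΘ₁] using this
  have e3 : ∀ k, (G.N k * J)ᵀ * Matrix.diagonal θ * (G.N k * J)
      = (R.N k)ᵀ * Θ₁ * R.N k + (boldN₂₁ h G μ k)ᵀ * truncatedDiag h θ * boldN₂₁ h G μ k :=
    fun k => by rw [transpose_mul_diagonal_mul_split h, hR.N₁, hR.N₂]
  -- The reduced equation is the congruence of the full one with `J`.
  have e4 := congrArg (fun X => Jᵀ * X * J) hQ
  simp only [sylv_apply, Matrix.transpose_transpose, Matrix.mul_add, Matrix.add_mul,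
    Matrix.mul_smul, Matrix.smul_mul, Matrix.mul_sum, Matrix.sum_mul, Matrix.mul_neg,
    Matrix.neg_mul] at e4
  have e5 : Jᵀ * (G.Aᵀ * Matrix.diagonal θ) * J = R.Aᵀ * Θ₁ := by
    rw [← e1, Matrix.transpose_mul]; simp only [Matrix.mul_assoc]
  have e6 : Jᵀ * (Matrix.diagonal θ * G.A) * J = Θ₁ * R.A := by
    rw [← e2]; simp only [Matrix.mul_assoc]
  have e7 : ∀ k, Jᵀ * ((G.N k)ᵀ * Matrix.diagonal θ * G.N k) * J
      = (R.N k)ᵀ * Θ₁ * R.N k + (boldN₂₁ h G μ k)ᵀ * truncatedDiag h θ * boldN₂₁ h G μ k :=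
    fun k => by rw [← e3, Matrix.transpose_mul]; simp only [Matrix.mul_assoc]
  have e8 : Jᵀ * (G.Cᵀ * G.C) * J = R.Cᵀ * R.C := by
    rw [← hR.C, Matrix.transpose_mul]; simp only [← hJ, Matrix.mul_assoc]
  rw [e5, e6, e8] at e4
  simp only [e7, Finset.sum_add_distrib, smul_add] at e4
  rw [sylv_apply]
  simp only [Matrix.transpose_transpose]
  rw [← e4]
  abel

theorem truncatedDiag_posSemidef (h : r ≤ n) (hθ : ∀ i, 0 ≤ θ i) :
    (truncatedDiag h θ).PosSemidef :=
  Matrix.PosSemidef.diagonal fun _ => hθ _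

theorem IsCompression.adjoint_lyapunov_le (hR : IsCompression h G μ R) (hθ : ∀ i, 0 ≤ θ i)
    (hQ : sylv γ G.Aᵀ (fun k => (G.N k)ᵀ) G.Aᵀ (fun k => (G.N k)ᵀ) (Matrix.diagonal θ)
      = -(G.Cᵀ * G.C)) :
    (-(sylv γ R.Aᵀ (fun k => (R.N k)ᵀ) R.Aᵀ (fun k => (R.N k)ᵀ)
        (Matrix.diagonal fun i => θ (idx₁ h i)))).PosSemidef := by
  rw [hR.adjoint_lyapunov hQ, neg_sub, sub_neg_eq_add]
  refine Matrix.PosSemidef.add (Matrix.PosSemidef.smul ?_ (by positivity)) ?_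
  · refine Matrix.posSemidef_sum _ fun k _ => ?_
    simpa using (truncatedDiag_posSemidef h hθ).conjTranspose_mul_mul_same (boldN₂₁ h G μ k)
  · simpa using Matrix.posSemidef_conjTranspose_mul_self R.C

/-- The leading block of the reachability equation shows that `Θ₁` satisfies the reduced equation up
to the negative semidefinite term `-γ⁻² ∑ N_{k,12} Θ₂ N_{k,12}ᵀ`, so it dominates the reduced
Gramian. -/
theorem exists_isGramian_bt (h : r ≤ n) (G : BilinearSystem n m q p) (hθ : ∀ i, 0 ≤ θ i)
    (hP : sylv γ G.A G.N G.A G.N (Matrix.diagonal θ) = -(G.X₀ * G.X₀ᵀ)) :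
    ∃ P, IsGramian γ (block₁₁ h G.A) (fun k => block₁₁ h (G.N k))
      (rows₁ h G.X₀ * (rows₁ h G.X₀)ᵀ) P := by
  set Θ₁ : Matrix (Fin r) (Fin r) ℝ := Matrix.diagonal fun i => θ (idx₁ h i) with hΘ₁
  refine exists_isGramian_of_lyapunov_le (Θ := Θ₁)
    (by simpa using Matrix.posSemidef_self_mul_conjTranspose (rows₁ h G.X₀))
    (Matrix.PosSemidef.diagonal fun _ => hθ _) ?_
  have key : -(sylv γ (block₁₁ h G.A) (fun k => block₁₁ h (G.N k)) (block₁₁ h G.A)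
      (fun k => block₁₁ h (G.N k)) Θ₁) - rows₁ h G.X₀ * (rows₁ h G.X₀)ᵀ
      = (1 / γ ^ 2) • ∑ k, block₁₂ h (G.N k) * truncatedDiag h θ * (block₁₂ h (G.N k))ᵀ := by
    have e1 := congrArg (block₁₁ h) hP
    have a1 : block₁₁ h (G.A * Matrix.diagonal θ) = block₁₁ h G.A * Θ₁ := by
      ext i j; simp [block₁₁, hΘ₁, Matrix.mul_diagonal]
    have a2 : block₁₁ h (Matrix.diagonal θ * G.Aᵀ) = Θ₁ * (block₁₁ h G.A)ᵀ := by
      ext i j; simp [block₁₁, hΘ₁, Matrix.diagonal_mul]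
    have a3 : ∀ k, block₁₁ h (G.N k * Matrix.diagonal θ * (G.N k)ᵀ)
        = block₁₁ h (G.N k) * Θ₁ * (block₁₁ h (G.N k))ᵀ
          + block₁₂ h (G.N k) * truncatedDiag h θ * (block₁₂ h (G.N k))ᵀ := fun k => by
      have := transpose_mul_diagonal_mul_split h θ (rows₁ h (G.N k))ᵀ (rows₁ h (G.N k))ᵀ
      exact this
    have a4 : block₁₁ h (sylv γ G.A G.N G.A G.N (Matrix.diagonal θ))
        = block₁₁ h (G.A * Matrix.diagonal θ) + block₁₁ h (Matrix.diagonal θ * G.Aᵀ)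
          + (1 / γ ^ 2) • ∑ k, block₁₁ h (G.N k * Matrix.diagonal θ * (G.N k)ᵀ) := by
      ext i j
      simp [sylv_apply, block₁₁, Matrix.sum_apply]
    have a5 : block₁₁ h (-(G.X₀ * G.X₀ᵀ)) = -(rows₁ h G.X₀ * (rows₁ h G.X₀)ᵀ) := rfl
    rw [a4, a1, a2, a5] at e1
    simp only [a3, Finset.sum_add_distrib, smul_add] at e1
    rw [sylv_apply, sub_eq_add_neg, ← e1]
    abel
  rw [key]
  refine Matrix.PosSemidef.smul (Matrix.posSemidef_sum _ fun k _ => ?_) (by positivity)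
  simpa using (truncatedDiag_posSemidef h hθ).mul_mul_conjTranspose_same (block₁₂ h (G.N k))

/-- Each trace on the left is rewritten by duality with an observability equation. Each equals
`tr(Θ₁ X̃₀ X̃₀ᵀ)` plus terms in `Θ₂`; with the coefficients `1, -2, 1` the common part cancels. -/
theorem IsCompression.trace_eq (hR : IsCompression h G μ R)
    (hP : sylv γ G.A G.N G.A G.N (Matrix.diagonal θ) = -(G.X₀ * G.X₀ᵀ))
    (hQ : sylv γ G.Aᵀ (fun k => (G.N k)ᵀ) G.Aᵀ (fun k => (G.N k)ᵀ) (Matrix.diagonal θ)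
      = -(G.Cᵀ * G.C)) {Pt : Matrix (Fin r) (Fin r) ℝ}
    (hPt : sylv γ R.A R.N R.A R.N Pt = -(R.X₀ * R.X₀ᵀ)) {Y : Matrix (Fin n) (Fin r) ℝ}
    (hY : MixedEquation γ G R Y) :
    (G.C * Matrix.diagonal θ * G.Cᵀ).trace - 2 * (G.C * Y * R.Cᵀ).trace
        + (R.C * Pt * R.Cᵀ).trace
      = (truncatedDiag h θ * weight h γ G μ Y Pt).trace := by
  set J := liftRows h (boldAbar₂₁ h G μ) with hJ
  set Θ₁ : Matrix (Fin r) (Fin r) ℝ := Matrix.diagonal fun i => θ (idx₁ h i) with hΘ₁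
  set Θ₂ := truncatedDiag h θ with hΘ₂
  have t1 : (G.C * Matrix.diagonal θ * G.Cᵀ).trace
      = (Θ₁ * (R.X₀ * R.X₀ᵀ)).trace + (Θ₂ * (rows₂ h G.X₀ * (rows₂ h G.X₀)ᵀ)).trace := by
    have e1 := trace_sylv_adjoint γ G.A G.N (Matrix.diagonal θ) (Matrix.diagonal θ)
    rw [hP, hQ, Matrix.mul_neg, Matrix.neg_mul, Matrix.trace_neg, Matrix.trace_neg, neg_inj,
      trace_diagonal_mul_split h, hR.X₀] at e1
    rw [e1, Matrix.trace_mul_comm, ← Matrix.mul_assoc]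
  have t2 : (G.C * Y * R.Cᵀ).trace
      = (Θ₁ * (R.X₀ * R.X₀ᵀ)).trace - ((Θ₂ * (rows₂ h Y * (boldA₂₁ h G μ)ᵀ)).trace
        + (Θ₂ * (rows₂ h G.A * Y * (boldAbar₂₁ h G μ)ᵀ)).trace
        + (1 / γ ^ 2) * ∑ k, (Θ₂ * (rows₂ h (G.N k) * Y * (boldN₂₁ h G μ k)ᵀ)).trace) := by
    -- Testing with `Y Jᵀ` produces `C J = C̃` on one side and `A J`, `N_k J` on the other, whose
    -- leading rows are the reduced coefficients.
    have e1 := trace_sylv_adjoint γ G.A G.N (Matrix.diagonal θ) (Y * Jᵀ)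
    have e2 : (G.Cᵀ * G.C * (Y * Jᵀ)).trace = (G.C * Y * R.Cᵀ).trace := by
      rw [← hR.C, ← hJ, Matrix.transpose_mul, Matrix.mul_assoc, Matrix.trace_mul_comm]
      simp only [Matrix.mul_assoc]
    have e3 : sylv γ G.A G.N G.A G.N (Y * Jᵀ)
        = G.A * Y * Jᵀ + Y * (G.A * J)ᵀ + (1 / γ ^ 2) • ∑ k, G.N k * Y * (G.N k * J)ᵀ := by
      simp only [sylv_apply, Matrix.transpose_mul, Matrix.mul_assoc]
    have e4 : ∀ X : Matrix (Fin n) (Fin n) ℝ, rows₁ h (X * Y) = rows₁ h X * Y := fun _ => rfl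
    have e5 : ∀ X : Matrix (Fin n) (Fin n) ℝ, rows₂ h (X * Y) = rows₂ h X * Y := fun _ => rfl
    rw [hQ, Matrix.neg_mul, Matrix.trace_neg, e2, e3] at e1
    simp only [Matrix.mul_add, Matrix.trace_add, Matrix.mul_smul, Matrix.trace_smul,
      Matrix.mul_sum, Matrix.trace_sum, trace_diagonal_mul_split h, hR.A₁, hR.A₂, hR.N₁, hR.N₂,
      rows₁_liftRows, rows₂_liftRows, hJ, Matrix.transpose_one, Matrix.mul_one, e4, e5,
      Finset.sum_add_distrib, smul_eq_mul] at e1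
    -- The leading rows of the mixed equation evaluate all terms that carry `Θ₁`.
    have e6 := congrArg (fun X => (Θ₁ * rows₁ h X).trace) hY
    have e7 : rows₁ h (G.A * Y + Y * R.Aᵀ + (1 / γ ^ 2) • ∑ k, G.N k * Y * (R.N k)ᵀ)
        = rows₁ h G.A * Y + rows₁ h Y * R.Aᵀ
          + (1 / γ ^ 2) • ∑ k, rows₁ h (G.N k) * Y * (R.N k)ᵀ := by
      ext i j
      simp only [rows₁, Matrix.submatrix_apply, Matrix.add_apply, Matrix.smul_apply,
        Matrix.sum_apply]
      rfl
    have e8 : rows₁ h (-(G.X₀ * R.X₀ᵀ)) = -(R.X₀ * R.X₀ᵀ) := by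
      conv_rhs => rw [← hR.X₀]
      rw [← hR.X₀]; rfl
    simp only [e7, e8, Matrix.mul_add, Matrix.trace_add, Matrix.mul_smul, Matrix.trace_smul,
      Matrix.mul_sum, Matrix.trace_sum, Matrix.mul_neg, Matrix.trace_neg, smul_eq_mul] at e6
    rw [← hΘ₁, ← hΘ₂] at e1
    linarith
  have t3 : (R.C * Pt * R.Cᵀ).trace
      = (Θ₁ * (R.X₀ * R.X₀ᵀ)).trace
        - (1 / γ ^ 2) * ∑ k, (Θ₂ * (boldN₂₁ h G μ k * Pt * (boldN₂₁ h G μ k)ᵀ)).trace := by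
    have e1 := trace_sylv_adjoint γ R.A R.N Θ₁ Pt
    rw [hPt, hR.adjoint_lyapunov hQ] at e1
    simp only [Matrix.mul_neg, Matrix.trace_neg, Matrix.sub_mul, Matrix.neg_mul, Matrix.trace_sub,
      Matrix.smul_mul, Matrix.sum_mul, Matrix.trace_smul, Matrix.trace_sum, smul_eq_mul] at e1
    have e2 : (R.C * Pt * R.Cᵀ).trace = (R.Cᵀ * R.C * Pt).trace := by
      rw [Matrix.trace_mul_comm, ← Matrix.mul_assoc]
    have e3 : ∀ k, (Θ₂ * (boldN₂₁ h G μ k * Pt * (boldN₂₁ h G μ k)ᵀ)).trace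
        = ((boldN₂₁ h G μ k)ᵀ * Θ₂ * boldN₂₁ h G μ k * Pt).trace := fun k => by
      rw [← Matrix.mul_assoc, Matrix.trace_mul_comm]
      simp only [Matrix.mul_assoc]
    simp only [e2, e3]
    linarith
  rw [t1, t2, t3, weight]
  simp only [Matrix.mul_add, Matrix.trace_add, Matrix.trace_sub, Matrix.mul_smul,
    Matrix.trace_smul, Matrix.trace_sum, smul_eq_mul, Finset.sum_sub_distrib, Finset.mul_sum,
    mul_sub]
  simp only [mul_left_comm _ (2 : ℝ), ← Finset.mul_sum]
  ring

end Homogeneous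

/-! ### The error system of the homogeneous subsystem -/

section HomogeneousError

variable {n m q p r : ℕ} {h : r ≤ n} {γ : ℝ} {G : BilinearSystem n m q p} {μ : Method}
  {R : HomogeneousROM r m q p} {θ : Fin n → ℝ} {Y : Matrix (Fin n) (Fin r) ℝ}
  {Pt : Matrix (Fin r) (Fin r) ℝ}

theorem errorGramian_lyapunov
    (hP : sylv γ G.A G.N G.A G.N (Matrix.diagonal θ) = -(G.X₀ * G.X₀ᵀ))
    (hPt : sylv γ R.A R.N R.A R.N Pt = -(R.X₀ * R.X₀ᵀ)) (hY : MixedEquation γ G R Y) :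
    sylv γ (Matrix.fromBlocks G.A 0 0 R.A) (fun k => Matrix.fromBlocks (G.N k) 0 0 (R.N k))
        (Matrix.fromBlocks G.A 0 0 R.A) (fun k => Matrix.fromBlocks (G.N k) 0 0 (R.N k))
        (Matrix.fromBlocks (Matrix.diagonal θ) Y Yᵀ Pt)
      = -(Matrix.fromRows G.X₀ R.X₀ * (Matrix.fromRows G.X₀ R.X₀)ᵀ) := by
  have hY' : sylv γ G.A G.N R.A R.N Y = -(G.X₀ * R.X₀ᵀ) := hY
  have hY'' : sylv γ R.A R.N G.A G.N Yᵀ = -(R.X₀ * G.X₀ᵀ) := by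
    rw [← sylv_transpose, hY', Matrix.transpose_neg, Matrix.transpose_mul,
      Matrix.transpose_transpose]
  rw [sylv_fromBlocks, Matrix.transpose_fromRows, Matrix.fromRows_mul_fromCols,
    Matrix.fromBlocks_neg]
  simp only [Matrix.toBlocks_fromBlocks₁₁, Matrix.toBlocks_fromBlocks₁₂,
    Matrix.toBlocks_fromBlocks₂₁, Matrix.toBlocks_fromBlocks₂₂, hP, hY', hY'', hPt]

/-- The block matrix solves the Lyapunov equation of the error system, so it suffices that its flow
decays. The leading block decays by stability, the mixed blocks by `mixed_flow_tendsto_zero`, and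
the last block because it starts in an integral of a flow. -/
theorem errorGramian_posSemidef
    (hst : ∀ Z : ℝ → Matrix (Fin n) (Fin n) ℝ, IsMatrixFlow (sylv γ G.A G.N G.A G.N) Z →
      ∀ i j, Tendsto (fun t => Z t i j) atTop (𝓝 0))
    (hP : sylv γ G.A G.N G.A G.N (Matrix.diagonal θ) = -(G.X₀ * G.X₀ᵀ))
    (hθ : ∀ i, 0 < θ (idx₁ h i))
    (hΘ : (-(sylv γ R.Aᵀ (fun k => (R.N k)ᵀ) R.Aᵀ (fun k => (R.N k)ᵀ)
        (Matrix.diagonal fun i => θ (idx₁ h i)))).PosSemidef)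
    (hPt : IsGramian γ R.A R.N (R.X₀ * R.X₀ᵀ) Pt) (hY : MixedEquation γ G R Y) :
    (Matrix.fromBlocks (Matrix.diagonal θ) Y Yᵀ Pt).PosSemidef := by
  have hsym : Ptᵀ = Pt := hPt.transpose_eq
    (by simpa using Matrix.posSemidef_self_mul_conjTranspose R.X₀)
  obtain ⟨H, hH0, hHd⟩ := exists_matrixFlow
    (sylv γ (Matrix.fromBlocks G.A 0 0 R.A) (fun k => Matrix.fromBlocks (G.N k) 0 0 (R.N k))
      (Matrix.fromBlocks G.A 0 0 R.A) (fun k => Matrix.fromBlocks (G.N k) 0 0 (R.N k)))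
    (Matrix.fromBlocks (Matrix.diagonal θ) Y Yᵀ Pt)
  have hH := isMatrixFlow_of_hasDerivAt hHd
  obtain ⟨h11, h12, h21, h22⟩ := hH.toBlocks
  have h21' : IsMatrixFlow (sylv γ G.A G.N R.A R.N) (fun t => ((H t).toBlocks₂₁)ᵀ) :=
    fun t ht i j => by
      have := h21 t ht j i
      rw [← sylv_transpose]
      exact this
  refine posSemidef_of_lyapunov_of_tendsto ?_ ?_ hH hH0 ?_
  · rw [Matrix.fromBlocks_transpose, Matrix.diagonal_transpose, Matrix.transpose_transpose, hsym]
  · rw [errorGramian_lyapunov hP hPt.lyapunov hY, neg_neg]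
    simpa using Matrix.posSemidef_self_mul_conjTranspose (Matrix.fromRows G.X₀ R.X₀)
  · rintro (i | i) (j | j)
    · exact hst _ h11 i j
    · exact mixed_flow_tendsto_zero hst hθ hΘ h12 i j
    · exact mixed_flow_tendsto_zero hst hθ hΘ h21' j i
    · exact hPt.flow_tendsto_zero h22 (by simp [hH0]) i j

theorem trace_errorGramian (C : Matrix (Fin p) (Fin n) ℝ) (C' : Matrix (Fin p) (Fin r) ℝ)
    (Θ : Matrix (Fin n) (Fin n) ℝ) :
    (Matrix.fromCols C (-C') * Matrix.fromBlocks Θ Y Yᵀ Pt * (Matrix.fromCols C (-C'))ᵀ).trace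
      = (C * Θ * Cᵀ).trace - 2 * (C * Y * C'ᵀ).trace + (C' * Pt * C'ᵀ).trace := by
  have h1 : (C' * Yᵀ * Cᵀ).trace = (C * Y * C'ᵀ).trace := by
    rw [← Matrix.trace_transpose]
    simp [Matrix.transpose_mul, Matrix.mul_assoc]
  rw [Matrix.fromCols_mul_fromBlocks, Matrix.transpose_fromCols, Matrix.fromCols_mul_fromRows]
  simp only [Matrix.add_mul, Matrix.neg_mul, Matrix.transpose_neg, Matrix.mul_neg, neg_neg,
    Matrix.trace_add, Matrix.trace_neg, h1, neg_add]
  ring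

theorem homogeneous_output_error_le (hγ : 0 < γ)
    (hPe : (Matrix.fromBlocks (Matrix.diagonal θ) Y Yᵀ Pt).PosSemidef)
    (hP : sylv γ G.A G.N G.A G.N (Matrix.diagonal θ) = -(G.X₀ * G.X₀ᵀ))
    (hPt : sylv γ R.A R.N R.A R.N Pt = -(R.X₀ * R.X₀ᵀ)) (hY : MixedEquation γ G R Y)
    {u u' : ℝ → Fin m → ℝ} (hu' : ∀ k, LocL2 fun t => u' t k)
    (hN : ∀ t k, (G.N k = 0 ∧ R.N k = 0) ∨ u' t k = u t k) {x : ℝ → Fin n → ℝ}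
    {xt : ℝ → Fin r → ℝ} {v₀ : Fin q → ℝ}
    (hx : ∀ i, IsPrimitive (fun t => x t i) (fun t => controlRHS G.A 0 G.N 0 (u t) (x t) i))
    (hx0 : x 0 = G.X₀ *ᵥ v₀)
    (hxt : ∀ i, IsPrimitive (fun t => xt t i) (fun t => controlRHS R.A 0 R.N 0 (u t) (xt t) i))
    (hxt0 : xt 0 = R.X₀ *ᵥ v₀) {T : ℝ} (hT : 0 ≤ T) :
    ∫ t in (0 : ℝ)..T, (G.C *ᵥ x t - R.C *ᵥ xt t) ⬝ᵥ (G.C *ᵥ x t - R.C *ᵥ xt t)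
      ≤ Real.exp (∫ t in (0 : ℝ)..T, ∑ k, γ ^ 2 * u' t k ^ 2)
        * (((G.C * Matrix.diagonal θ * G.Cᵀ).trace - 2 * (G.C * Y * R.Cᵀ).trace
          + (R.C * Pt * R.Cᵀ).trace) * (v₀ ⬝ᵥ v₀)) := by
  have key := homogeneous_energy_le hγ (Matrix.fromCols G.C (-R.C)) hPe
    (errorGramian_lyapunov hP hPt hY) hu' (u := u)
    (x := fun t => Sum.elim (x t) (xt t)) (v₀ := v₀)
    (fun t k => (hN t k).imp (fun hk => by rw [hk.1, hk.2]; exact Matrix.fromBlocks_zero) id)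
    (by
      have e : ∀ t, (Matrix.fromBlocks G.A 0 0 R.A *ᵥ Sum.elim (x t) (xt t)
          + ∑ k, u t k • (Matrix.fromBlocks (G.N k) 0 0 (R.N k) *ᵥ Sum.elim (x t) (xt t)))
          = Sum.elim (controlRHS G.A 0 G.N 0 (u t) (x t))
            (controlRHS R.A 0 R.N 0 (u t) (xt t)) := fun t => by
        ext (i | i) <;>
        simp [controlRHS, Matrix.fromBlocks_mulVec, Finset.sum_apply]
      rintro (i | i)
      · simp only [e]; exact hx i
      · simp only [e]; exact hxt i)
    (by rw [Matrix.fromRows_mulVec, hx0, hxt0]) hT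
  simp only [Matrix.fromCols_mulVec_sumElim, Matrix.neg_mulVec, ← sub_eq_add_neg] at key
  rwa [trace_errorGramian] at key

end HomogeneousError

/-! ### Change of coordinates -/

section Transform

variable {n m q p : ℕ} {G : BilinearSystem n m q p} {γ : ℝ} {T : Matrix (Fin n) (Fin n) ℝ}

theorem transform_sylv (hT : IsUnit T.det) (X : Matrix (Fin n) (Fin n) ℝ) :
    sylv γ (G.transform T).A (G.transform T).N (G.transform T).A (G.transform T).N (T * X * Tᵀ)
      = T * sylv γ G.A G.N G.A G.N X * Tᵀ := by
  have h1 : Tᵀ * (T⁻¹)ᵀ = 1 := by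
    rw [← Matrix.transpose_mul, Matrix.nonsing_inv_mul _ hT, Matrix.transpose_one]
  have h2 : ∀ X : Matrix (Fin n) (Fin n) ℝ, T⁻¹ * (T * X) = X := fun X =>
    Matrix.nonsing_inv_mul_cancel_left _ _ hT
  have h3 : ∀ (X : Matrix (Fin n) (Fin n) ℝ), Tᵀ * ((T⁻¹)ᵀ * X) = X := fun X => by
    rw [← Matrix.mul_assoc, h1, Matrix.one_mul]
  simp only [sylv_apply, BilinearSystem.transform, Matrix.transpose_mul, Matrix.mul_add,
    Matrix.add_mul, Matrix.mul_smul, Matrix.smul_mul, Matrix.mul_sum, Matrix.sum_mul,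
    Matrix.mul_assoc, h2, h3]

theorem transform_sylv_transpose (hT : IsUnit T.det) (X : Matrix (Fin n) (Fin n) ℝ) :
    sylv γ (G.transform T).Aᵀ (fun k => ((G.transform T).N k)ᵀ) (G.transform T).Aᵀ
        (fun k => ((G.transform T).N k)ᵀ) ((T⁻¹)ᵀ * X * T⁻¹)
      = (T⁻¹)ᵀ * sylv γ G.Aᵀ (fun k => (G.N k)ᵀ) G.Aᵀ (fun k => (G.N k)ᵀ) X * T⁻¹ := by
  have h1 : Tᵀ * (T⁻¹)ᵀ = 1 := by
    rw [← Matrix.transpose_mul, Matrix.nonsing_inv_mul _ hT, Matrix.transpose_one]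
  have h2 : ∀ X : Matrix (Fin n) (Fin n) ℝ, T⁻¹ * (T * X) = X := fun X =>
    Matrix.nonsing_inv_mul_cancel_left _ _ hT
  have h3 : ∀ (X : Matrix (Fin n) (Fin n) ℝ), Tᵀ * ((T⁻¹)ᵀ * X) = X := fun X => by
    rw [← Matrix.mul_assoc, h1, Matrix.one_mul]
  simp only [sylv_apply, BilinearSystem.transform, Matrix.transpose_mul, Matrix.mul_add,
    Matrix.add_mul, Matrix.mul_smul, Matrix.smul_mul, Matrix.mul_sum, Matrix.sum_mul,
    Matrix.mul_assoc, Matrix.transpose_transpose, h2, h3]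

theorem transform_flow_tendsto_zero (hT : IsUnit T.det)
    (hst : ∀ Z : ℝ → Matrix (Fin n) (Fin n) ℝ, IsMatrixFlow (sylv γ G.A G.N G.A G.N) Z →
      ∀ i j, Tendsto (fun t => Z t i j) atTop (𝓝 0))
    {Z : ℝ → Matrix (Fin n) (Fin n) ℝ}
    (hZ : IsMatrixFlow (sylv γ (G.transform T).A (G.transform T).N (G.transform T).A
      (G.transform T).N) Z) (i j : Fin n) :
    Tendsto (fun t => Z t i j) atTop (𝓝 0) := by
  let L : Matrix (Fin n) (Fin n) ℝ → Matrix (Fin n) (Fin n) ℝ →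
      Matrix (Fin n) (Fin n) ℝ →ₗ[ℝ] Matrix (Fin n) (Fin n) ℝ := fun M M' =>
    { toFun := fun X => M * X * M'
      map_add' := fun X Y => by rw [Matrix.mul_add, Matrix.add_mul]
      map_smul' := fun c X => by
        rw [Matrix.mul_smul, Matrix.smul_mul, RingHom.id_apply] }
  have h1 : Tᵀ * (T⁻¹)ᵀ = 1 := by
    rw [← Matrix.transpose_mul, Matrix.nonsing_inv_mul _ hT, Matrix.transpose_one]
  have h1' : (T⁻¹)ᵀ * Tᵀ = 1 := by
    rw [← Matrix.transpose_mul, Matrix.mul_nonsing_inv _ hT, Matrix.transpose_one]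
  have hback : ∀ X : Matrix (Fin n) (Fin n) ℝ, T * (T⁻¹ * X * (T⁻¹)ᵀ) * Tᵀ = X := fun X => by
    rw [Matrix.mul_assoc T⁻¹, Matrix.mul_nonsing_inv_cancel_left _ _ hT, Matrix.mul_assoc, h1',
      Matrix.mul_one]
  have hforth : ∀ X : Matrix (Fin n) (Fin n) ℝ, T⁻¹ * (T * X * Tᵀ) * (T⁻¹)ᵀ = X := fun X => by
    rw [Matrix.mul_assoc T, Matrix.nonsing_inv_mul_cancel_left _ _ hT, Matrix.mul_assoc, h1,
      Matrix.mul_one]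
  have hW : IsMatrixFlow (sylv γ G.A G.N G.A G.N) (fun t => L T⁻¹ (T⁻¹)ᵀ (Z t)) :=
    fun t ht i j => by
      have h2 := hasDerivWithinAt_linearMap_apply (L T⁻¹ (T⁻¹)ᵀ) (hZ t ht) i j
      have h3 : L T⁻¹ (T⁻¹)ᵀ (sylv γ (G.transform T).A (G.transform T).N (G.transform T).A
          (G.transform T).N (Z t)) = sylv γ G.A G.N G.A G.N (L T⁻¹ (T⁻¹)ᵀ (Z t)) := by
        change T⁻¹ * _ * (T⁻¹)ᵀ = sylv γ G.A G.N G.A G.N (T⁻¹ * Z t * (T⁻¹)ᵀ)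
        conv_lhs => rw [← hback (Z t)]
        rw [transform_sylv hT, hforth]
      rwa [h3] at h2
  have h4 : ∀ t, Z t i j = ∑ b, (∑ a, T i a * (L T⁻¹ (T⁻¹)ᵀ (Z t)) a b) * Tᵀ b j := fun t => by
    conv_lhs => rw [← hback (Z t)]
    rfl
  simp only [h4]
  have h5 : Tendsto (fun t => ∑ b, (∑ a, T i a * (L T⁻¹ (T⁻¹)ᵀ (Z t)) a b) * Tᵀ b j) atTop
      (𝓝 (∑ b, (∑ a, T i a * 0) * Tᵀ b j)) :=
    tendsto_finsetSum _ fun b _ => (tendsto_finsetSum _ fun a _ =>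
      (hst _ hW a b).const_mul _).mul_const _
  simpa using h5

theorem transform_controlRHS (hT : IsUnit T.det) (B : Matrix (Fin n) (Fin m) ℝ)
    (u : Fin m → ℝ) (x : Fin n → ℝ) :
    T *ᵥ controlRHS G.A B G.N 0 u x
      = controlRHS (G.transform T).A (T * B) (G.transform T).N 0 u (T *ᵥ x) := by
  have h1 : ∀ M : Matrix (Fin n) (Fin n) ℝ, (T * M * T⁻¹) *ᵥ (T *ᵥ x) = T *ᵥ (M *ᵥ x) :=
    fun M => by
      rw [Matrix.mulVec_mulVec, Matrix.mulVec_mulVec, Matrix.mul_assoc (T * M),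
        Matrix.nonsing_inv_mul _ hT, Matrix.mul_one]
  simp only [controlRHS, BilinearSystem.transform, h1, Matrix.mulVec_add, Matrix.mulVec_sum,
    Matrix.mulVec_smul, Pi.zero_apply, Matrix.zero_mulVec, add_zero, Matrix.mulVec_mulVec]

theorem isPrimitive_mulVec {ι κ : Type*} [Fintype ι] (M : Matrix κ ι ℝ) {x f : ℝ → ι → ℝ}
    (hx : ∀ i, IsPrimitive (fun t => x t i) (fun t => f t i)) (i : κ) :
    IsPrimitive (fun t => (M *ᵥ x t) i) (fun t => (M *ᵥ f t) i) :=
  IsPrimitive.sum Finset.univ fun j _ => (hx j).const_mul (M i j)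

theorem transform_isPrimitive (hT : IsUnit T.det) {B : Matrix (Fin n) (Fin m) ℝ}
    {u : ℝ → Fin m → ℝ} {x : ℝ → Fin n → ℝ}
    (hx : ∀ i, IsPrimitive (fun t => x t i) (fun t => controlRHS G.A B G.N 0 (u t) (x t) i))
    (i : Fin n) :
    IsPrimitive (fun t => (T *ᵥ x t) i)
      (fun t => controlRHS (G.transform T).A (T * B) (G.transform T).N 0 (u t) (T *ᵥ x t) i) := by
  have := isPrimitive_mulVec T hx i
  simpa only [transform_controlRHS hT] using this

theorem transform_output (hT : IsUnit T.det) (x : Fin n → ℝ) :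
    (G.transform T).C *ᵥ (T *ᵥ x) = G.C *ᵥ x := by
  rw [BilinearSystem.transform, Matrix.mulVec_mulVec, Matrix.mul_assoc,
    Matrix.nonsing_inv_mul _ hT, Matrix.mul_one]

end Transform

/-! ### The inhomogeneous subsystem: dissipation inequalities -/

section Dissipation

variable {n m q p : ℕ}

/-- The observability and reachability inequalities of a realization whose Gramians are both
equal to `diag(σ)`. -/
structure IsBalancedRealization (γ : ℝ) (G : BilinearSystem n m q p) (σ : Fin n → ℝ) : Prop where
  pos : ∀ i, 0 < σ i
  obs : ∀ e, 2 * ∑ i, σ i * (e i * (G.A *ᵥ e) i)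
    + (1 / γ ^ 2) * ∑ j, ∑ i, σ i * (G.N j *ᵥ e) i ^ 2 ≤ -((G.C *ᵥ e) ⬝ᵥ (G.C *ᵥ e))
  reach : ∀ e z, 2 * ∑ i, (σ i)⁻¹ * (e i * (G.A *ᵥ e + G.B *ᵥ z) i)
    + (1 / γ ^ 2) * ∑ j, ∑ i, (σ i)⁻¹ * (G.N j *ᵥ e) i ^ 2 ≤ z ⬝ᵥ z

theorem controlRHS_sub (A : Matrix (Fin n) (Fin n) ℝ) (B : Matrix (Fin n) (Fin m) ℝ)
    (N : Fin m → Matrix (Fin n) (Fin n) ℝ) (u : Fin m → ℝ) (x y : Fin n → ℝ) (i : Fin n) :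
    controlRHS A B N 0 u x i - controlRHS A B N 0 u y i
      = (A *ᵥ (x - y)) i + ∑ j, u j * (N j *ᵥ (x - y)) i := by
  simp only [controlRHS, Pi.add_apply, Finset.sum_apply, Pi.smul_apply, smul_eq_mul,
    Matrix.mulVec_sub, Pi.sub_apply, Pi.zero_apply, Matrix.zero_mulVec, add_zero, mul_sub,
    Finset.sum_sub_distrib]
  ring

theorem controlRHS_add (A : Matrix (Fin n) (Fin n) ℝ) (B : Matrix (Fin n) (Fin m) ℝ)
    (N : Fin m → Matrix (Fin n) (Fin n) ℝ) (u : Fin m → ℝ) (x y : Fin n → ℝ) (i : Fin n) :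
    controlRHS A B N 0 u x i + controlRHS A B N 0 u y i
      = (A *ᵥ (x + y) + B *ᵥ ((2 : ℝ) • u)) i + ∑ j, u j * (N j *ᵥ (x + y)) i := by
  simp only [controlRHS, Pi.add_apply, Finset.sum_apply, Pi.smul_apply, smul_eq_mul,
    Matrix.mulVec_add, Matrix.mulVec_smul, Pi.zero_apply, Matrix.zero_mulVec, add_zero, mul_add,
    Finset.sum_add_distrib]
  ring

/-- Young's inequality for one coordinate, obtained from the square of `g j / γ - γ u j e`. -/
theorem two_mul_sum_control_le {γ : ℝ} (hγ : 0 < γ) {c : ℝ} (hc : 0 ≤ c) {u w g : Fin m → ℝ}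
    (hg : ∀ j, g j = 0 ∨ w j = u j) (e : ℝ) :
    2 * c * (e * ∑ j, u j * g j)
      ≤ (∑ j, (1 / γ ^ 2) * (c * g j ^ 2)) + (∑ j, γ ^ 2 * w j ^ 2) * (c * e ^ 2) := by
  rw [Finset.mul_sum, Finset.mul_sum, Finset.sum_mul, ← Finset.sum_add_distrib]
  refine Finset.sum_le_sum fun j _ => ?_
  rcases hg j with h0 | h0
  · rw [h0]
    have : 0 ≤ γ ^ 2 * w j ^ 2 * (c * e ^ 2) := by positivity
    simpa using this
  · rw [h0]
    have h1 : 0 ≤ c * (g j / γ - γ * u j * e) ^ 2 := by positivity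
    have h2 : c * (g j / γ - γ * u j * e) ^ 2
        = 1 / γ ^ 2 * (c * g j ^ 2) + γ ^ 2 * u j ^ 2 * (c * e ^ 2)
          - 2 * c * (e * (u j * g j)) := by
      field_simp
      ring
    linarith

/-- The contribution of the coordinate `i` to the storage function that compares a model with
its truncation by the coordinate `κ`. -/
def stepEnergy (σ : Fin n → ℝ) (κ : Fin n) (x y : Fin n → ℝ) (i : Fin n) : ℝ :=
  if i < κ then σ i * (x i - y i) ^ 2 + σ κ ^ 2 * (σ i)⁻¹ * (x i + y i) ^ 2
  else if i = κ then 2 * σ κ * x i ^ 2 else 0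

/-- The derivative of `stepEnergy` along curves with velocities `f` and `g`. -/
def stepRate (σ : Fin n → ℝ) (κ : Fin n) (x y f g : Fin n → ℝ) (i : Fin n) : ℝ :=
  if i < κ then 2 * σ i * ((x i - y i) * (f i - g i))
    + 2 * (σ κ ^ 2 * (σ i)⁻¹) * ((x i + y i) * (f i + g i))
  else if i = κ then 4 * σ κ * (x i * f i) else 0

theorem stepEnergy_nonneg {σ : Fin n → ℝ} (hσ : ∀ i, 0 < σ i) (κ : Fin n) (x y : Fin n → ℝ)
    (i : Fin n) : 0 ≤ stepEnergy σ κ x y i := by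
  have h1 := hσ i
  have h2 := hσ κ
  unfold stepEnergy
  split_ifs <;> positivity

/-- The sum of the observability inequality for `x - y` and `σ_κ²` times the reachability inequality
for `x + y` with input `2 u`; that input explains `4 σ_κ² |u|²`. In the coordinate `κ` both weights
equal `σ_κ`, so the mixed products of `x` and `y` cancel and the remaining `y` terms have a
favourable sign. Later coordinates are not stored, and their contributions have a favourable sign as
well. -/
theorem sum_stepRate_le {γ : ℝ} (hγ : 0 < γ) {G : BilinearSystem n m q p} {σ : Fin n → ℝ}
    (hG : IsBalancedRealization γ G σ) (κ : Fin n) {u w : Fin m → ℝ}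
    (hw : ∀ j, G.N j = 0 ∨ w j = u j) {x y : Fin n → ℝ}
    (hxy : ∀ i, κ < i → 0 ≤ (x i - y i) * (G.A *ᵥ (x - y)) i
      ∧ 0 ≤ (x i + y i) * (G.A *ᵥ (x + y) + G.B *ᵥ ((2 : ℝ) • u)) i)
    (hy : 0 ≤ y κ * (G.A *ᵥ y + G.B *ᵥ u) κ) :
    ∑ i, stepRate σ κ x y (controlRHS G.A G.B G.N 0 u x) (controlRHS G.A G.B G.N 0 u y) i
      ≤ -((G.C *ᵥ (x - y)) ⬝ᵥ (G.C *ᵥ (x - y))) + 4 * σ κ ^ 2 * (u ⬝ᵥ u)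
        + (∑ j, γ ^ 2 * w j ^ 2) * ∑ i, stepEnergy σ κ x y i := by
  set M := ∑ j, γ ^ 2 * w j ^ 2 with hM
  have hM0 : 0 ≤ M := Finset.sum_nonneg fun j _ => by positivity
  have hNe : ∀ e i j, (G.N j *ᵥ e) i = 0 ∨ w j = u j := fun e i j =>
    (hw j).imp_left fun h0 => by rw [h0, Matrix.zero_mulVec, Pi.zero_apply]
  have hpt : ∀ i, stepRate σ κ x y (controlRHS G.A G.B G.N 0 u x)
      (controlRHS G.A G.B G.N 0 u y) i
      ≤ (2 * (σ i * ((x - y) i * (G.A *ᵥ (x - y)) i))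
          + ∑ j, (1 / γ ^ 2) * (σ i * (G.N j *ᵥ (x - y)) i ^ 2))
        + σ κ ^ 2 * (2 * ((σ i)⁻¹ * ((x + y) i * (G.A *ᵥ (x + y) + G.B *ᵥ ((2 : ℝ) • u)) i))
          + ∑ j, (1 / γ ^ 2) * ((σ i)⁻¹ * (G.N j *ᵥ (x + y)) i ^ 2))
        + M * stepEnergy σ κ x y i := fun i => by
    have hσi := hG.pos i
    have hσκ := hG.pos κ
    rcases lt_trichotomy i κ with hi | hi | hi
    · have e1 := two_mul_sum_control_le hγ hσi.le (hNe (x - y) i) (x i - y i)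
      have e2 := two_mul_sum_control_le hγ (c := σ κ ^ 2 * (σ i)⁻¹) (by positivity)
        (hNe (x + y) i) (x i + y i)
      have e3 : ∑ j, (1 / γ ^ 2) * (σ κ ^ 2 * (σ i)⁻¹ * (G.N j *ᵥ (x + y)) i ^ 2)
          = σ κ ^ 2 * ∑ j, (1 / γ ^ 2) * ((σ i)⁻¹ * (G.N j *ᵥ (x + y)) i ^ 2) := by
        rw [Finset.mul_sum]; exact Finset.sum_congr rfl fun j _ => by ring
      rw [e3] at e2
      simp only [stepRate, stepEnergy, if_pos hi, controlRHS_sub, controlRHS_add, Pi.sub_apply,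
        Pi.add_apply (x : Fin n → ℝ) y] at e1 e2 ⊢
      linarith
    · subst hi
      have e1 := two_mul_sum_control_le hγ (c := 2 * σ i) (by positivity) (hNe x i) (x i)
      -- Parallelogram identity, with the nonnegative square of `N_j y` dropped.
      have e2 : ∀ j, (1 / γ ^ 2) * (2 * σ i * (G.N j *ᵥ x) i ^ 2)
          ≤ (1 / γ ^ 2) * (σ i * (G.N j *ᵥ (x - y)) i ^ 2)
            + σ i ^ 2 * ((1 / γ ^ 2) * ((σ i)⁻¹ * (G.N j *ᵥ (x + y)) i ^ 2)) := fun j => by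
        have e3 : σ i ^ 2 * ((1 / γ ^ 2) * ((σ i)⁻¹ * (G.N j *ᵥ (x + y)) i ^ 2))
            = (1 / γ ^ 2) * (σ i * (G.N j *ᵥ (x + y)) i ^ 2) := by field_simp
        rw [e3, ← mul_add, Matrix.mulVec_sub, Matrix.mulVec_add, Pi.sub_apply, Pi.add_apply]
        refine mul_le_mul_of_nonneg_left ?_ (by positivity)
        have e4 : 0 ≤ σ i * (G.N j *ᵥ y) i ^ 2 := by positivity
        linarith
      have e5 := Finset.sum_le_sum fun j (_ : j ∈ Finset.univ) => e2 j
      rw [Finset.sum_add_distrib, ← Finset.mul_sum (a := σ i ^ 2)] at e5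
      have e6 : controlRHS G.A G.B G.N 0 u x i
          = (G.A *ᵥ x + G.B *ᵥ u) i + ∑ j, u j * (G.N j *ᵥ x) i := by
        simp [controlRHS, Finset.sum_apply]
      have e7 : σ i ^ 2 * (2 * ((σ i)⁻¹
          * ((x + y) i * (G.A *ᵥ (x + y) + G.B *ᵥ ((2 : ℝ) • u)) i)))
          = 2 * (σ i * ((x + y) i * (G.A *ᵥ (x + y) + G.B *ᵥ ((2 : ℝ) • u)) i)) := by
        field_simp
      have e8 : 0 ≤ σ i * (y i * (G.A *ᵥ y + G.B *ᵥ u) i) := mul_nonneg hσi.le hy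
      -- With `a = A x + B u` and `b = A y + B u`, the products `(x - y)(a - b) + (x + y)(a + b)`
      -- add up to `2 x a + 2 y b`; the last product is nonnegative by `hy`.
      rw [mul_add (σ i ^ 2), e7]
      simp only [stepRate, stepEnergy, lt_irrefl, if_false, if_true, e6, Matrix.mulVec_sub,
        Matrix.mulVec_add, Matrix.mulVec_smul, Pi.add_apply, Pi.sub_apply, Pi.smul_apply,
        smul_eq_mul] at e1 e5 e8 ⊢
      linarith
    · have h1 : ¬ i < κ := not_lt.2 hi.le
      have h2 : ¬ i = κ := ne_of_gt hi
      obtain ⟨h3, h4⟩ := hxy i hi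
      simp only [stepRate, stepEnergy, if_neg h1, if_neg h2, mul_zero, add_zero]
      have h5 : 0 ≤ (x - y) i * (G.A *ᵥ (x - y)) i := h3
      have h6 : 0 ≤ (x + y) i * (G.A *ᵥ (x + y) + G.B *ᵥ ((2 : ℝ) • u)) i := h4
      have h7 : 0 ≤ ∑ j, (1 / γ ^ 2) * (σ i * (G.N j *ᵥ (x - y)) i ^ 2) :=
        Finset.sum_nonneg fun j _ => by positivity
      have h8 : 0 ≤ ∑ j, (1 / γ ^ 2) * ((σ i)⁻¹ * (G.N j *ᵥ (x + y)) i ^ 2) :=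
        Finset.sum_nonneg fun j _ => by positivity
      positivity
  refine (Finset.sum_le_sum fun i _ => hpt i).trans ?_
  have hobs := hG.obs (x - y)
  have hreach := mul_le_mul_of_nonneg_left (hG.reach (x + y) ((2 : ℝ) • u)) (sq_nonneg (σ κ))
  simp only [Finset.sum_add_distrib, ← Finset.mul_sum]
  rw [Finset.sum_comm (γ := Fin m)] at hobs hreach
  simp only [← Finset.mul_sum] at hobs hreach
  have e9 : ((2 : ℝ) • u) ⬝ᵥ ((2 : ℝ) • u) = 4 * (u ⬝ᵥ u) := by
    rw [smul_dotProduct, dotProduct_smul, smul_eq_mul, smul_eq_mul]; ring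
  rw [e9] at hreach
  linarith

/-- The pointwise estimate behind the continuous dependence of a reduced model on its
algebraic part. -/
theorem sum_perturbation_rate_le {γ : ℝ} (hγ : 0 < γ) {G : BilinearSystem n m q p} {σ : Fin n → ℝ}
    (hG : IsBalancedRealization γ G σ) (r : ℕ) {u w : Fin m → ℝ}
    (hw : ∀ j, G.N j = 0 ∨ w j = u j) {x y b : Fin n → ℝ} (hb : ∀ i, 0 ≤ b i)
    (hxy : ∀ i : Fin n, r ≤ i → -b i ≤ 2 * (σ i * ((x i - y i) * (G.A *ᵥ (x - y)) i))) :
    ∑ i : Fin n, (if (i : ℕ) < r then 2 * σ i * ((x i - y i) * (controlRHS G.A G.B G.N 0 u x i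
        - controlRHS G.A G.B G.N 0 u y i)) else 0)
      ≤ -((G.C *ᵥ (x - y)) ⬝ᵥ (G.C *ᵥ (x - y))) + ∑ i, b i
        + (∑ j, γ ^ 2 * w j ^ 2)
          * ∑ i : Fin n, (if (i : ℕ) < r then σ i * (x i - y i) ^ 2 else 0) := by
  set M := ∑ j, γ ^ 2 * w j ^ 2 with hM
  have hNe : ∀ e i j, (G.N j *ᵥ e) i = 0 ∨ w j = u j := fun e i j =>
    (hw j).imp_left fun h0 => by rw [h0, Matrix.zero_mulVec, Pi.zero_apply]
  have hpt : ∀ i : Fin n, (if (i : ℕ) < r then 2 * σ i * ((x i - y i)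
        * (controlRHS G.A G.B G.N 0 u x i - controlRHS G.A G.B G.N 0 u y i)) else 0)
      ≤ (2 * (σ i * ((x - y) i * (G.A *ᵥ (x - y)) i))
          + ∑ j, (1 / γ ^ 2) * (σ i * (G.N j *ᵥ (x - y)) i ^ 2)) + b i
        + M * (if (i : ℕ) < r then σ i * (x i - y i) ^ 2 else 0) := fun i => by
    have hσi := hG.pos i
    rcases lt_or_ge (i : ℕ) r with hi | hi
    · have e1 := two_mul_sum_control_le hγ hσi.le (hNe (x - y) i) (x i - y i)
      simp only [if_pos hi, controlRHS_sub, Pi.sub_apply] at e1 ⊢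
      linarith [hb i]
    -- Algebraic coordinates appear in the observability inequality but not in the storage function;
    -- the allowance `b` pays for their possibly wrong sign.
    · have h5 := hxy i hi
      have h7 : 0 ≤ ∑ j, (1 / γ ^ 2) * (σ i * (G.N j *ᵥ (x - y)) i ^ 2) :=
        Finset.sum_nonneg fun j _ => by positivity
      simp only [if_neg (not_lt.2 hi), mul_zero, add_zero, Pi.sub_apply] at h5 ⊢
      linarith
  refine (Finset.sum_le_sum fun i _ => hpt i).trans ?_
  have hobs := hG.obs (x - y)
  simp only [Finset.sum_add_distrib, ← Finset.mul_sum]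
  rw [Finset.sum_comm (γ := Fin m)] at hobs
  simp only [← Finset.mul_sum] at hobs
  linarith

end Dissipation

/-! ### Minkowski's inequality on a finite horizon -/

section Minkowski

variable {ι : Type*} [Fintype ι]

theorem locInt_dotProduct {f g : ℝ → ι → ℝ} (hf : ∀ i, LocL2 fun t => f t i)
    (hg : ∀ i, LocL2 fun t => g t i) : LocInt fun t => f t ⬝ᵥ g t :=
  LocInt.sum Finset.univ fun j _ => (hf j).mul (hg j)

/-- Minkowski's inequality on `[0, T]`. -/
theorem integral_dotProduct_add_le {f g : ℝ → ι → ℝ} (hf : ∀ i, LocL2 fun t => f t i)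
    (hg : ∀ i, LocL2 fun t => g t i) {T a b : ℝ} (hT : 0 ≤ T) (ha : 0 ≤ a) (hb : 0 ≤ b)
    (hfa : ∫ t in (0 : ℝ)..T, f t ⬝ᵥ f t ≤ a ^ 2) (hgb : ∫ t in (0 : ℝ)..T, g t ⬝ᵥ g t ≤ b ^ 2) :
    ∫ t in (0 : ℝ)..T, (f t + g t) ⬝ᵥ (f t + g t) ≤ (a + b) ^ 2 := by
  have h1 := locInt_dotProduct hf hf T hT
  have h2 := locInt_dotProduct hf hg T hT
  have h3 := locInt_dotProduct hg hg T hT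
  have key : ∀ s : ℝ, ∫ t in (0 : ℝ)..T, (f t + s • g t) ⬝ᵥ (f t + s • g t)
      = (∫ t in (0 : ℝ)..T, f t ⬝ᵥ f t) + s * (2 * ∫ t in (0 : ℝ)..T, f t ⬝ᵥ g t)
        + s * s * ∫ t in (0 : ℝ)..T, g t ⬝ᵥ g t := fun s => by
    rw [← intervalIntegral.integral_const_mul, ← intervalIntegral.integral_const_mul,
      ← intervalIntegral.integral_const_mul,
      ← intervalIntegral.integral_add h1 ((h2.const_mul 2).const_mul s),
      ← intervalIntegral.integral_add (h1.add ((h2.const_mul 2).const_mul s)) (h3.const_mul _)]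
    congr 1
    ext t
    simp only [add_dotProduct, dotProduct_add, smul_dotProduct, dotProduct_smul, smul_eq_mul,
      dotProduct_comm (g t) (f t)]
    ring
  have hnn : ∀ s : ℝ, 0 ≤ (∫ t in (0 : ℝ)..T, g t ⬝ᵥ g t) * (s * s)
      + (2 * ∫ t in (0 : ℝ)..T, f t ⬝ᵥ g t) * s + ∫ t in (0 : ℝ)..T, f t ⬝ᵥ f t := fun s => by
    have := intervalIntegral.integral_nonneg (μ := volume) hT
      fun t (_ : t ∈ Set.Icc 0 T) => dotProduct_self_nonneg' (f t + s • g t)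
    rw [key s] at this
    linarith
  -- The discriminant of `s ↦ ∫ |f + s g|²` gives the Cauchy-Schwarz inequality.
  have hd := discrim_le_zero hnn
  rw [discrim] at hd
  have hF : 0 ≤ ∫ t in (0 : ℝ)..T, f t ⬝ᵥ f t := intervalIntegral.integral_nonneg hT
    fun t _ => dotProduct_self_nonneg' _
  have hG : 0 ≤ ∫ t in (0 : ℝ)..T, g t ⬝ᵥ g t := intervalIntegral.integral_nonneg hT
    fun t _ => dotProduct_self_nonneg' _
  have h4 : (∫ t in (0 : ℝ)..T, f t ⬝ᵥ g t) ≤ a * b := by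
    refine le_of_sq_le_sq ?_ (mul_nonneg ha hb)
    have := mul_le_mul hfa hgb hG (sq_nonneg a)
    nlinarith
  have h5 := key 1
  simp only [one_smul] at h5
  rw [h5]
  nlinarith

end Minkowski

/-! ### Signals with a common algebraic constraint, and the error of one reduction step -/

section ReducedSignals

variable {n m q p : ℕ}

/-- In the signal `x` the coordinates below `k` follow the differential equation with zero
initial value, while the others satisfy `α x = β (A x + B u)`. -/
structure IsReducedSignal (G : BilinearSystem n m q p) (α β : ℝ) (k : ℕ) (u : ℝ → Fin m → ℝ)
    (x : ℝ → Fin n → ℝ) : Prop where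
  locL2 : ∀ i, LocL2 fun t => x t i
  initial : ∀ i : Fin n, (i : ℕ) < k → x 0 i = 0
  diff : ∀ i : Fin n, (i : ℕ) < k →
    IsPrimitive (fun t => x t i) (fun t => controlRHS G.A G.B G.N 0 (u t) (x t) i)
  alg : ∀ i : Fin n, k ≤ i → ∀ t, 0 ≤ t → α * x t i = β * (G.A *ᵥ x t + G.B *ᵥ u t) i

/-- The sign property of the constraint `α a = β b` that makes truncation, singular perturbation and
all interpolating schemes accessible to one argument. -/
theorem mul_nonneg_of_mul_eq {α β a b : ℝ} (hα : 0 ≤ α) (hβ : 0 ≤ β) (h : 0 < α + β)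
    (hab : α * a = β * b) : 0 ≤ a * b := by
  have h1 : (α + β) * (a * b) = β * b ^ 2 + α * a ^ 2 := by
    have e1 : α * a * b = β * b * b := by rw [hab]
    have e2 : α * a * a = β * b * a := by rw [hab]
    linear_combination e1 - e2
  have h2 : 0 ≤ (α + β) * (a * b) := by rw [h1]; positivity
  exact nonneg_of_mul_nonneg_right h2 h

variable {G : BilinearSystem n m q p} {α β γ : ℝ} {σ : Fin n → ℝ} {u w : ℝ → Fin m → ℝ}

theorem locInt_control (hw : ∀ j, LocL2 fun t => w t j) :
    LocInt fun t => ∑ j, γ ^ 2 * w t j ^ 2 := by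
  simp only [sq (w _ _)]
  exact LocInt.sum _ fun j _ => ((hw j).mul (hw j)).const_mul _

/-- The output changes by at most `2 σ κ` times the input when the coordinate `κ` is reduced. -/
theorem reduction_step_error_le (hγ : 0 < γ) (hG : IsBalancedRealization γ G σ) (hα : 0 ≤ α)
    (hβ : 0 ≤ β) (hαβ : 0 < α + β) (hu : ∀ j, LocL2 fun t => u t j)
    (hw : ∀ j, LocL2 fun t => w t j) (hN : ∀ t j, G.N j = 0 ∨ w t j = u t j) (κ : Fin n)
    {x y : ℝ → Fin n → ℝ} (hx : IsReducedSignal G α β (κ + 1) u x)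
    (hy : IsReducedSignal G α β κ u y) {T : ℝ} (hT : 0 ≤ T) :
    ∫ t in (0 : ℝ)..T, (G.C *ᵥ (x t - y t)) ⬝ᵥ (G.C *ᵥ (x t - y t))
      ≤ Real.exp (∫ t in (0 : ℝ)..T, ∑ j, γ ^ 2 * w t j ^ 2)
        * (4 * σ κ ^ 2 * ∫ t in (0 : ℝ)..T, u t ⬝ᵥ u t) := by
  have hp : LocInt fun t => (G.C *ᵥ (x t - y t)) ⬝ᵥ (G.C *ᵥ (x t - y t)) :=
    locInt_dotProduct_self (locL2_mulVec G.C fun i => (hx.locL2 i).sub (hy.locL2 i))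
  have hlt : ∀ {i : Fin n}, i < κ → (i : ℕ) < κ + 1 := fun h => Nat.lt_succ_of_lt h
  have hV : AbsolutelyContinuousOnInterval (fun t => ∑ i, stepEnergy σ κ (x t) (y t) i) 0 T := by
    refine absolutelyContinuousOnInterval_sum _ fun i _ => ?_
    unfold stepEnergy
    split_ifs with h1 h2
    · have e1 := (hx.diff i (hlt h1)).absolutelyContinuousOnInterval hT
      have e2 := (hy.diff i h1).absolutelyContinuousOnInterval hT
      simp only [sq (_ - _ : ℝ), sq (_ + _ : ℝ)]
      exact ((((e1.sub e2).fun_mul (e1.sub e2)).const_mul _).add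
        (((e1.add e2).fun_mul (e1.add e2)).const_mul _))
    · have e1 := (hx.diff i (by rw [h2]; exact Nat.lt_succ_self _)).absolutelyContinuousOnInterval
        hT
      simp only [sq (x _ _)]
      exact (e1.fun_mul e1).const_mul _
    · exact absolutelyContinuousOnInterval_const _ _ _
  have hV0 : ∑ i, stepEnergy σ κ (x 0) (y 0) i = 0 := by
    refine Finset.sum_eq_zero fun i _ => ?_
    unfold stepEnergy
    split_ifs with h1 h2
    · rw [hx.initial i (hlt h1), hy.initial i h1]; simp
    · rw [hx.initial i (by rw [h2]; exact Nat.lt_succ_self _)]; simp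
    · rfl
  have hmain := integral_le_of_dissipation hT hV
    (b := fun t => 4 * σ κ ^ 2 * (u t ⬝ᵥ u t))
    (Finset.sum_nonneg fun i _ => stepEnergy_nonneg hG.pos κ _ _ i)
    (locInt_control (γ := γ) hw T hT) (fun t => by positivity) (hp T hT)
    (fun t => dotProduct_self_nonneg' _) (((locInt_dotProduct_self hu).const_mul _) T hT)
    (fun t => mul_nonneg (by positivity) (dotProduct_self_nonneg' _)) (by
      have hallx : ∀ᵐ t, ∀ i : Fin n, (i : ℕ) < κ + 1 → t ∈ Set.Ioo 0 T →
          HasDerivAt (fun t => x t i) (controlRHS G.A G.B G.N 0 (u t) (x t) i) t :=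
        ae_all_iff.2 fun i => Filter.eventually_imp_distrib_left.2 fun hi => (hx.diff i hi).ae_hasDerivAt hT
      have hally : ∀ᵐ t, ∀ i : Fin n, (i : ℕ) < κ → t ∈ Set.Ioo 0 T →
          HasDerivAt (fun t => y t i) (controlRHS G.A G.B G.N 0 (u t) (y t) i) t :=
        ae_all_iff.2 fun i => Filter.eventually_imp_distrib_left.2 fun hi => (hy.diff i hi).ae_hasDerivAt hT
      filter_upwards [hallx, hally] with t htx hty htm
      have ht0 := htm.1.le
      refine ⟨∑ i, stepRate σ κ (x t) (y t) (controlRHS G.A G.B G.N 0 (u t) (x t))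
        (controlRHS G.A G.B G.N 0 (u t) (y t)) i, ?_, ?_⟩
      · refine HasDerivAt.fun_sum fun i _ => ?_
        unfold stepEnergy stepRate
        split_ifs with h1 h2
        · have e1 := htx i (hlt h1) htm
          have e2 := hty i h1 htm
          convert! (((e1.fun_sub e2).fun_pow 2).const_mul (σ i)).fun_add
            (((e1.fun_add e2).fun_pow 2).const_mul (σ κ ^ 2 * (σ i)⁻¹)) using 1
          simp only [Nat.cast_ofNat]
          ring
        · have e1 := htx i (by rw [h2]; exact Nat.lt_succ_self _) htm
          convert! (e1.fun_pow 2).const_mul (2 * σ κ) using 1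
          simp only [Nat.cast_ofNat]
          ring
        · exact hasDerivAt_const _ _
      · refine sum_stepRate_le hγ hG κ (hN t) (fun i hi => ⟨?_, ?_⟩) ?_
        · refine mul_nonneg_of_mul_eq hα hβ hαβ ?_
          have e1 := hx.alg i hi t ht0
          have e2 := hy.alg i hi.le t ht0
          simp only [Matrix.mulVec_sub, Pi.sub_apply, Pi.add_apply] at e1 e2 ⊢
          linarith
        · refine mul_nonneg_of_mul_eq hα hβ hαβ ?_
          have e1 := hx.alg i hi t ht0
          have e2 := hy.alg i hi.le t ht0
          simp only [Matrix.mulVec_add, Matrix.mulVec_smul, Pi.smul_apply, smul_eq_mul,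
            Pi.add_apply] at e1 e2 ⊢
          linarith
        · exact mul_nonneg_of_mul_eq hα hβ hαβ (hy.alg κ le_rfl t ht0))
  rwa [hV0, zero_add, intervalIntegral.integral_const_mul] at hmain

/-- The storage function is the `σ`-weighted square of the difference in the dynamic coordinates.
The two signals may obey different constraints, which allows SPA to be compared with its
regularization; with `b = 0` and all coordinates dynamic it shows that outputs are unique. -/
theorem perturbation_error_le (hγ : 0 < γ) (hG : IsBalancedRealization γ G σ)
    (hw : ∀ j, LocL2 fun t => w t j) (hN : ∀ t j, G.N j = 0 ∨ w t j = u t j) {r : ℕ} {α' β' : ℝ}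
    {x y : ℝ → Fin n → ℝ} (hx : IsReducedSignal G α β r u x)
    (hy : IsReducedSignal G α' β' r u y) {b : ℝ → Fin n → ℝ} (hb : ∀ i, LocInt fun t => b t i)
    (hb0 : ∀ t i, 0 ≤ b t i)
    (hxy : ∀ t, 0 ≤ t → ∀ i : Fin n, r ≤ i →
      -b t i ≤ 2 * (σ i * ((x t i - y t i) * (G.A *ᵥ (x t - y t)) i))) {T : ℝ} (hT : 0 ≤ T) :
    ∫ t in (0 : ℝ)..T, (G.C *ᵥ (x t - y t)) ⬝ᵥ (G.C *ᵥ (x t - y t))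
      ≤ Real.exp (∫ t in (0 : ℝ)..T, ∑ j, γ ^ 2 * w t j ^ 2)
        * ∫ t in (0 : ℝ)..T, ∑ i, b t i := by
  have hp : LocInt fun t => (G.C *ᵥ (x t - y t)) ⬝ᵥ (G.C *ᵥ (x t - y t)) :=
    locInt_dotProduct_self (locL2_mulVec G.C fun i => (hx.locL2 i).sub (hy.locL2 i))
  have hV : AbsolutelyContinuousOnInterval
      (fun t => ∑ i : Fin n, (if (i : ℕ) < r then σ i * (x t i - y t i) ^ 2 else 0)) 0 T := by
    refine absolutelyContinuousOnInterval_sum _ fun i _ => ?_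
    split_ifs with h1
    · have e1 := (hx.diff i h1).absolutelyContinuousOnInterval hT
      have e2 := (hy.diff i h1).absolutelyContinuousOnInterval hT
      simp only [sq (_ - _ : ℝ)]
      exact ((e1.sub e2).fun_mul (e1.sub e2)).const_mul _
    · exact absolutelyContinuousOnInterval_const _ _ _
  have hV0 : (∑ i : Fin n, (if (i : ℕ) < r then σ i * (x 0 i - y 0 i) ^ 2 else 0)) = 0 := by
    refine Finset.sum_eq_zero fun i _ => ?_
    split_ifs with h1
    · rw [hx.initial i h1, hy.initial i h1]; simp
    · rfl
  have hmain := integral_le_of_dissipation hT hV (b := fun t => ∑ i, b t i)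
    (Finset.sum_nonneg fun i _ => by
      have := hG.pos i
      split_ifs <;> positivity)
    (locInt_control (γ := γ) hw T hT) (fun t => by positivity) (hp T hT)
    (fun t => dotProduct_self_nonneg' _) ((LocInt.sum Finset.univ fun i _ => hb i) T hT)
    (fun t => Finset.sum_nonneg fun i _ => hb0 t i) (by
      have hallx : ∀ᵐ t, ∀ i : Fin n, (i : ℕ) < r → t ∈ Set.Ioo 0 T →
          HasDerivAt (fun t => x t i) (controlRHS G.A G.B G.N 0 (u t) (x t) i) t :=
        ae_all_iff.2 fun i => Filter.eventually_imp_distrib_left.2 fun hi => (hx.diff i hi).ae_hasDerivAt hT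
      have hally : ∀ᵐ t, ∀ i : Fin n, (i : ℕ) < r → t ∈ Set.Ioo 0 T →
          HasDerivAt (fun t => y t i) (controlRHS G.A G.B G.N 0 (u t) (y t) i) t :=
        ae_all_iff.2 fun i => Filter.eventually_imp_distrib_left.2 fun hi => (hy.diff i hi).ae_hasDerivAt hT
      filter_upwards [hallx, hally] with t htx hty htm
      refine ⟨_, ?_, sum_perturbation_rate_le hγ hG r (hN t) (hb0 t) (hxy t htm.1.le)⟩
      refine HasDerivAt.fun_sum fun i _ => ?_
      split_ifs with h1
      · convert! (((htx i h1 htm).fun_sub (hty i h1 htm)).fun_pow 2).const_mul (σ i) using 1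
        simp only [Nat.cast_ofNat]
        ring
      · exact hasDerivAt_const _ _)
  rwa [hV0, zero_add] at hmain

end ReducedSignals

/-! ### Existence of intermediate models and the telescoped error bound -/

section Existence

variable {n m q p : ℕ} {G : BilinearSystem n m q p} {α β γ : ℝ} {σ : Fin n → ℝ}
  {u w : ℝ → Fin m → ℝ}

theorem IsBalancedRealization.sum_mul_mulVec_nonpos (hG : IsBalancedRealization γ G σ)
    (v : Fin n → ℝ) : ∑ i, σ i * (v i * (G.A *ᵥ v) i) ≤ 0 := by
  have h1 := hG.obs v
  have h2 := dotProduct_self_nonneg' (G.C *ᵥ v)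
  have h3 : 0 ≤ (1 / γ ^ 2) * ∑ j, ∑ i, σ i * (G.N j *ᵥ v) i ^ 2 :=
    mul_nonneg (by positivity) (Finset.sum_nonneg fun j _ => Finset.sum_nonneg fun i _ =>
      mul_nonneg (hG.pos i).le (sq_nonneg _))
  linarith

/-- For `α > 0` the constraint can be solved for the trailing coordinates because `A` is dissipative
in the `σ`-weighted inner product. Elimination leaves a control system of the standard form with
additional terms `E k`. -/
theorem exists_isReducedSignal (hG : IsBalancedRealization γ G σ) (hα : 0 < α) (hβ : 0 ≤ β)
    (hu : ∀ j, LocL2 fun t => u t j) (k : ℕ) : ∃ x, IsReducedSignal G α β k u x := by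
  set M : Matrix (Fin n) (Fin n) ℝ := Matrix.of fun i j =>
    if (i : ℕ) < k then (1 : Matrix (Fin n) (Fin n) ℝ) i j
    else (α • (1 : Matrix (Fin n) (Fin n) ℝ) - β • G.A) i j with hM
  have hM₁ : ∀ (v : Fin n → ℝ) (i : Fin n), (i : ℕ) < k → (M *ᵥ v) i = v i := fun v i hi => by
    have : (M *ᵥ v) i = ((1 : Matrix (Fin n) (Fin n) ℝ) *ᵥ v) i := by
      simp only [Matrix.mulVec, dotProduct, hM, Matrix.of_apply, if_pos hi]
    rw [this, Matrix.one_mulVec]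
  have hM₂ : ∀ (v : Fin n → ℝ) (i : Fin n), k ≤ i →
      (M *ᵥ v) i = α * v i - β * (G.A *ᵥ v) i := fun v i hi => by
    have : (M *ᵥ v) i = ((α • (1 : Matrix (Fin n) (Fin n) ℝ) - β • G.A) *ᵥ v) i := by
      simp only [Matrix.mulVec, dotProduct, hM, Matrix.of_apply, if_neg (not_lt.2 hi)]
    rw [this, Matrix.sub_mulVec, Matrix.smul_mulVec, Matrix.smul_mulVec, Matrix.one_mulVec]
    rfl
  have hMu : IsUnit M.det := by
    rw [← Matrix.isUnit_iff_isUnit_det, ← Matrix.mulVec_injective_iff_isUnit]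
    refine (injective_iff_map_eq_zero' (Matrix.mulVecLin M)).2 fun v => ⟨fun hv => ?_, fun hv => ?_⟩
    · have hv' : ∀ i, (M *ᵥ v) i = 0 := fun i => congrFun hv i
      -- Summed over `i`, the right side is not positive, which forces `v = 0`.
      have h1 : ∀ i, σ i * (α * v i ^ 2) ≤ β * (σ i * (v i * (G.A *ᵥ v) i)) := fun i => by
        rcases lt_or_ge (i : ℕ) k with hi | hi
        · have := hv' i
          rw [hM₁ v i hi] at this
          simp [this]
        · have := hv' i
          rw [hM₂ v i hi] at this
          refine le_of_eq ?_
          linear_combination σ i * v i * this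
      have h2 := Finset.sum_le_sum fun i (_ : i ∈ Finset.univ) => h1 i
      rw [← Finset.mul_sum] at h2
      have h3 := mul_nonpos_of_nonneg_of_nonpos hβ (hG.sum_mul_mulVec_nonpos v)
      have h4 : ∀ i ∈ Finset.univ, 0 ≤ σ i * (α * v i ^ 2) := fun i _ =>
        mul_nonneg (hG.pos i).le (by positivity)
      have h5 := (Finset.sum_eq_zero_iff_of_nonneg h4).1
        (le_antisymm (h2.trans h3) (Finset.sum_nonneg h4))
      ext i
      have h6 := h5 i (Finset.mem_univ i)
      have h7 := (hG.pos i).ne'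
      simpa [h7, hα.ne'] using h6
    · rw [hv, map_zero]
  set D : Matrix (Fin n) (Fin n) ℝ := Matrix.diagonal fun i => if (i : ℕ) < k then 1 else 0 with hD
  have hD₁ : ∀ (v : Fin n → ℝ) (i : Fin n), (i : ℕ) < k → (D *ᵥ v) i = v i := fun v i hi => by
    rw [hD, Matrix.mulVec_diagonal, if_pos hi, one_mul]
  have hD₂ : ∀ (v : Fin n → ℝ) (i : Fin n), k ≤ i → (D *ᵥ v) i = 0 := fun v i hi => by
    rw [hD, Matrix.mulVec_diagonal, if_neg (not_lt.2 hi), zero_mul]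
  set J := M⁻¹ * D with hJ
  set H := M⁻¹ * ((β • (1 - D)) * G.B) with hH
  -- The dynamics are posed in full dimension `n`; the projection `D` keeps only the first `k`
  -- coordinates, from which `x = J ξ + H u` is recovered.
  obtain ⟨ξ, hξ⟩ := exists_isSolution (D * (G.A * J)) (D * (G.A * H + G.B))
    (fun j => D * (G.N j * J)) (fun j => D * (G.N j * H)) hu 0
  set x : ℝ → Fin n → ℝ := fun t => J *ᵥ ξ t + H *ᵥ u t with hx
  have hMx : ∀ t, M *ᵥ x t = D *ᵥ ξ t + β • (G.B *ᵥ u t - D *ᵥ (G.B *ᵥ u t)) := fun t => by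
    rw [hx, Matrix.mulVec_add, Matrix.mulVec_mulVec, Matrix.mulVec_mulVec, hJ, hH,
      Matrix.mul_nonsing_inv_cancel_left _ _ hMu, Matrix.mul_nonsing_inv_cancel_left _ _ hMu,
      ← Matrix.mulVec_mulVec, Matrix.smul_mulVec, Matrix.sub_mulVec, Matrix.one_mulVec]
  have hx₁ : ∀ (i : Fin n), (i : ℕ) < k → ∀ t, x t i = ξ t i := fun i hi t => by
    have h1 := congrFun (hMx t) i
    rw [hM₁ _ i hi, Pi.add_apply, Pi.smul_apply, Pi.sub_apply, hD₁ _ i hi, hD₁ _ i hi, sub_self,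
      smul_zero, add_zero] at h1
    exact h1
  have hrhs : ∀ t, controlRHS (D * (G.A * J)) (D * (G.A * H + G.B))
      (fun j => D * (G.N j * J)) (fun j => D * (G.N j * H)) (u t) (ξ t)
      = D *ᵥ controlRHS G.A G.B G.N 0 (u t) (x t) := fun t => by
    simp only [controlRHS, hx, Matrix.mulVec_add, Matrix.mulVec_sum, Matrix.mulVec_smul,
      ← Matrix.mulVec_mulVec, Matrix.add_mulVec, Pi.zero_apply, Matrix.zero_mulVec, add_zero]
    abel
  refine ⟨x, fun i => ?_, fun i hi => ?_, fun i hi => ?_, fun i hi t _ => ?_⟩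
  · exact (locL2_mulVec J hξ.locL2 i).add (locL2_mulVec H hu i)
  · rw [hx₁ i hi, hξ.initial, Pi.zero_apply]
  · refine (hξ.isPrimitive hu i).congr (fun t _ => hx₁ i hi t) fun t _ => ?_
    rw [hrhs, hD₁ _ i hi]
  · have h1 := congrFun (hMx t) i
    rw [hM₂ _ i hi, Pi.add_apply, Pi.smul_apply, Pi.sub_apply, hD₂ _ i hi, hD₂ _ i hi, sub_zero,
      zero_add, smul_eq_mul] at h1
    rw [Pi.add_apply]
    linarith

theorem IsReducedSignal.of_full {x : ℝ → Fin n → ℝ} (hx : IsReducedSignal G α β n u x)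
    (α' β' : ℝ) : IsReducedSignal G α' β' n u x :=
  ⟨hx.locL2, hx.initial, hx.diff, fun i hi => absurd i.isLt (not_lt.2 hi)⟩

/-- Telescoping over intermediate models: the signal at level `k` is compared with one at level `k +
1`, and Minkowski's inequality adds the costs `2 σ_k`. The induction runs over `d = n - k`. -/
theorem reduction_error_le_of_pos (hγ : 0 < γ) (hG : IsBalancedRealization γ G σ) (hα : 0 < α)
    (hβ : 0 ≤ β) (hu : ∀ j, LocL2 fun t => u t j) (hw : ∀ j, LocL2 fun t => w t j)
    (hN : ∀ t j, G.N j = 0 ∨ w t j = u t j) {x : ℝ → Fin n → ℝ}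
    (hx : IsReducedSignal G α β n u x) {T : ℝ} (hT : 0 ≤ T) (d : ℕ) :
    ∀ k, k + d = n → ∀ y, IsReducedSignal G α β k u y →
      ∫ t in (0 : ℝ)..T, (G.C *ᵥ (x t - y t)) ⬝ᵥ (G.C *ᵥ (x t - y t))
        ≤ ((2 * ∑ i : Fin n, if k ≤ i then σ i else 0)
          * Real.sqrt (Real.exp (∫ t in (0 : ℝ)..T, ∑ j, γ ^ 2 * w t j ^ 2)
            * ∫ t in (0 : ℝ)..T, u t ⬝ᵥ u t)) ^ 2 := by
  have hU : 0 ≤ ∫ t in (0 : ℝ)..T, u t ⬝ᵥ u t := intervalIntegral.integral_nonneg hT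
    fun t _ => dotProduct_self_nonneg' _
  induction d with
  | zero =>
    intro k hk y hy
    rw [add_zero] at hk
    subst hk
    have h1 := perturbation_error_le hγ hG hw hN hx hy (b := fun _ _ => 0)
      (fun i T _ => intervalIntegrable_const) (fun _ _ => le_rfl)
      (fun t _ i hi => absurd i.isLt (not_lt.2 hi)) hT
    simp only [Finset.sum_const_zero, intervalIntegral.integral_zero, mul_zero] at h1
    exact h1.trans (sq_nonneg _)
  | succ d ih =>
    intro k hk y hy
    obtain ⟨z, hz⟩ := exists_isReducedSignal hG hα hβ hu (k + 1)
    have h1 := ih (k + 1) (by omega) z hz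
    let κ : Fin n := ⟨k, by omega⟩
    have h2 := reduction_step_error_le hγ hG hα.le hβ (by linarith) hu hw hN κ hz hy hT
    have h3 : Real.exp (∫ t in (0 : ℝ)..T, ∑ j, γ ^ 2 * w t j ^ 2)
        * (4 * σ κ ^ 2 * ∫ t in (0 : ℝ)..T, u t ⬝ᵥ u t)
        = (2 * σ κ * Real.sqrt (Real.exp (∫ t in (0 : ℝ)..T, ∑ j, γ ^ 2 * w t j ^ 2)
          * ∫ t in (0 : ℝ)..T, u t ⬝ᵥ u t)) ^ 2 := by
      rw [mul_pow, Real.sq_sqrt (by positivity)]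
      ring
    rw [h3] at h2
    have hσ := fun i => (hG.pos i).le
    have h4 := integral_dotProduct_add_le
      (f := fun t => G.C *ᵥ (x t - z t)) (g := fun t => G.C *ᵥ (z t - y t))
      (locL2_mulVec G.C fun i => (hx.locL2 i).sub (hz.locL2 i))
      (locL2_mulVec G.C fun i => (hz.locL2 i).sub (hy.locL2 i)) hT
      (mul_nonneg (mul_nonneg zero_le_two (Finset.sum_nonneg fun i _ => by
        split_ifs
        · exact hσ i
        · exact le_rfl)) (Real.sqrt_nonneg _))
      (mul_nonneg (mul_nonneg zero_le_two (hσ κ)) (Real.sqrt_nonneg _)) h1 h2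
    have h5 : ∀ t, G.C *ᵥ (x t - z t) + G.C *ᵥ (z t - y t) = G.C *ᵥ (x t - y t) := fun t => by
      rw [← Matrix.mulVec_add, sub_add_sub_cancel]
    have h6 : (∑ i : Fin n, if k ≤ i then σ i else 0)
        = (∑ i : Fin n, if k + 1 ≤ i then σ i else 0) + σ κ := by
      have h7 : ∀ i : Fin n, (if k ≤ i then σ i else 0)
          = (if k + 1 ≤ i then σ i else 0) + if i = κ then σ i else 0 := fun i => by
        have h8 : i = κ ↔ (i : ℕ) = k := Fin.ext_iff
        rcases lt_trichotomy (i : ℕ) k with hi | hi | hi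
        · simp [h8, hi.ne, not_le.2 hi, not_le.2 (Nat.lt_succ_of_lt hi)]
        · simp [h8, hi]
        · simp [h8, hi.ne', hi.le, Nat.succ_le_of_lt hi]
      simp only [h7, Finset.sum_add_distrib]
      simp
    simp only [h5] at h4
    rw [h6, mul_add, add_mul]
    exact h4

/-- Only `α = 0` is new. The reduced signal is then the limit of signals with `α = ε β`, for which
all intermediate models exist; the deviation of their outputs is of order `√ε` in `L²(0, T)`. -/
theorem reduction_error_le (hγ : 0 < γ) (hG : IsBalancedRealization γ G σ) (hα : 0 ≤ α)
    (hβ : 0 ≤ β) (hαβ : 0 < α + β) (hu : ∀ j, LocL2 fun t => u t j)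
    (hw : ∀ j, LocL2 fun t => w t j) (hN : ∀ t j, G.N j = 0 ∨ w t j = u t j)
    {x y : ℝ → Fin n → ℝ} {r : ℕ} (hr : r ≤ n) (hx : IsReducedSignal G α β n u x)
    (hy : IsReducedSignal G α β r u y) {T : ℝ} (hT : 0 ≤ T) :
    ∫ t in (0 : ℝ)..T, (G.C *ᵥ (x t - y t)) ⬝ᵥ (G.C *ᵥ (x t - y t))
      ≤ ((2 * ∑ i : Fin n, if r ≤ i then σ i else 0)
        * Real.sqrt (Real.exp (∫ t in (0 : ℝ)..T, ∑ j, γ ^ 2 * w t j ^ 2)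
          * ∫ t in (0 : ℝ)..T, u t ⬝ᵥ u t)) ^ 2 := by
  rcases hα.lt_or_eq with hα' | hα'
  · exact reduction_error_le_of_pos hγ hG hα' hβ hu hw hN hx hT (n - r) r (by omega) y hy
  subst hα'
  have hβ' : 0 < β := by simpa using hαβ
  set E := Real.exp (∫ t in (0 : ℝ)..T, ∑ j, γ ^ 2 * w t j ^ 2) with hE
  set a := (2 * ∑ i : Fin n, if r ≤ i then σ i else 0)
    * Real.sqrt (E * ∫ t in (0 : ℝ)..T, u t ⬝ᵥ u t) with ha
  have ha0 : 0 ≤ a := mul_nonneg (mul_nonneg zero_le_two (Finset.sum_nonneg fun i _ => by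
    have := (hG.pos i).le
    split_ifs
    · exact this
    · exact le_rfl)) (Real.sqrt_nonneg _)
  set c := ∫ t in (0 : ℝ)..T, ∑ i, σ i / 2 * (y t i * y t i) with hc
  have hc0 : 0 ≤ c := intervalIntegral.integral_nonneg hT fun t _ => Finset.sum_nonneg fun i _ =>
    mul_nonneg (half_pos (hG.pos i)).le (mul_self_nonneg _)
  have hε : ∀ ε : ℝ, 0 < ε → ∫ t in (0 : ℝ)..T, (G.C *ᵥ (x t - y t)) ⬝ᵥ (G.C *ᵥ (x t - y t))
      ≤ (a + Real.sqrt (E * (ε * c))) ^ 2 := fun ε hε => by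
    obtain ⟨z, hz⟩ := exists_isReducedSignal hG (mul_pos hε hβ') hβ hu r
    -- The full signal has no algebraic coordinates, so it belongs to every pair `(α, β)`.
    have h1 := reduction_error_le_of_pos hγ hG (mul_pos hε hβ') hβ hu hw hN (hx.of_full _ _) hT
      (n - r) r (by omega) z hz
    have h2 := perturbation_error_le hγ hG hw hN hy hz
      (b := fun t i => ε * (σ i / 2 * (y t i * y t i)))
      (fun i => (((hy.locL2 i).mul (hy.locL2 i)).const_mul _).const_mul _)
      (fun t i => mul_nonneg hε.le (mul_nonneg (half_pos (hG.pos i)).le (mul_self_nonneg _)))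
      (fun t ht i hi => by
        have e1 := hy.alg i hi t ht
        have e2 := hz.alg i hi t ht
        have e3 : (G.A *ᵥ y t + G.B *ᵥ u t) i = 0 := by
          rw [zero_mul] at e1
          exact (mul_eq_zero.1 e1.symm).resolve_left hβ'.ne'
        have e4 : (G.A *ᵥ z t + G.B *ᵥ u t) i = ε * z t i := by
          refine mul_left_cancel₀ hβ'.ne' ?_
          rw [← e2]; ring
        have e5 : (G.A *ᵥ (y t - z t)) i = -(ε * z t i) := by
          rw [← e4, Matrix.mulVec_sub, Pi.sub_apply]
          rw [Pi.add_apply] at e3 ⊢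
          linarith
        rw [e5]
        -- Here `(A (y - z))_i = -ε z_i`, and completing the square in `z` leaves `-ε σ_i y_i² / 2`.
        -- The allowance thus depends on `y` alone and not on the regularized signal.
        have e6 : 0 ≤ ε * σ i * (2 * z t i - y t i) ^ 2 :=
          mul_nonneg (mul_nonneg hε.le (hG.pos i).le) (sq_nonneg _)
        nlinarith) hT
    have e7 : ∀ t, ∑ i, ε * (σ i / 2 * (y t i * y t i)) = ε * ∑ i, σ i / 2 * (y t i * y t i) :=
      fun t => (Finset.mul_sum _ _ _).symm
    simp only [e7] at h2
    rw [intervalIntegral.integral_const_mul, ← hE, ← hc,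
      ← Real.sq_sqrt (show 0 ≤ E * (ε * c) by positivity)] at h2
    have h3 : ∀ t, (G.C *ᵥ (z t - y t)) ⬝ᵥ (G.C *ᵥ (z t - y t))
        = (G.C *ᵥ (y t - z t)) ⬝ᵥ (G.C *ᵥ (y t - z t)) := fun t => by
      rw [← neg_sub (y t), Matrix.mulVec_neg, neg_dotProduct_neg]
    simp only [← h3] at h2
    have h4 := integral_dotProduct_add_le
      (f := fun t => G.C *ᵥ (x t - z t)) (g := fun t => G.C *ᵥ (z t - y t))
      (locL2_mulVec G.C fun i => (hx.locL2 i).sub (hz.locL2 i))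
      (locL2_mulVec G.C fun i => (hz.locL2 i).sub (hy.locL2 i)) hT ha0 (Real.sqrt_nonneg _) h1 h2
    have h5 : ∀ t, G.C *ᵥ (x t - z t) + G.C *ᵥ (z t - y t) = G.C *ᵥ (x t - y t) := fun t => by
      rw [← Matrix.mulVec_add, sub_add_sub_cancel]
    simpa only [h5] using h4
  have hlim : Tendsto (fun ε : ℝ => (a + Real.sqrt (E * (ε * c))) ^ 2) (𝓝[>] 0) (𝓝 (a ^ 2)) := by
    have h1 : Continuous fun ε : ℝ => (a + Real.sqrt (E * (ε * c))) ^ 2 := by fun_prop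
    have h2 := (h1.tendsto 0).mono_left (nhdsWithin_le_nhds (s := Set.Ioi 0))
    simpa using h2
  exact ge_of_tendsto hlim (by filter_upwards [self_mem_nhdsWithin] with ε h using hε ε h)

end Existence

/-! ### Reduced models as signals of the balanced realization -/

section Identification

variable {n m q p r : ℕ}

/-- The vector with leading part `a` and trailing part `b`. -/
def joinVec (h : r ≤ n) (a : Fin r → ℝ) (b : Fin (n - r) → ℝ) : Fin n → ℝ :=
  fun i => Sum.elim a b ((splitIdx h).symm i)

@[simp]
theorem joinVec_idx₁ (h : r ≤ n) (a : Fin r → ℝ) (b : Fin (n - r) → ℝ) (i : Fin r) :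
    joinVec h a b (idx₁ h i) = a i := by
  simp [joinVec, idx₁]

@[simp]
theorem joinVec_idx₂ (h : r ≤ n) (a : Fin r → ℝ) (b : Fin (n - r) → ℝ) (i : Fin (n - r)) :
    joinVec h a b (idx₂ h i) = b i := by
  simp [joinVec, idx₂]

theorem mulVec_joinVec {κ : Type*} (h : r ≤ n) (M : Matrix κ (Fin n) ℝ) (a : Fin r → ℝ)
    (b : Fin (n - r) → ℝ) : M *ᵥ joinVec h a b = cols₁ h M *ᵥ a + cols₂ h M *ᵥ b := by
  ext i
  simp only [Matrix.mulVec, dotProduct, Pi.add_apply]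
  rw [sum_splitIdx h]
  simp only [joinVec_idx₁, joinVec_idx₂]
  rfl

theorem mulVec_joinVec_idx₁ (h : r ≤ n) (M : Matrix (Fin n) (Fin n) ℝ) (a : Fin r → ℝ)
    (b : Fin (n - r) → ℝ) (i : Fin r) :
    (M *ᵥ joinVec h a b) (idx₁ h i) = (block₁₁ h M *ᵥ a) i + (block₁₂ h M *ᵥ b) i :=
  congrFun (mulVec_joinVec h M a b) (idx₁ h i)

theorem mulVec_joinVec_idx₂ (h : r ≤ n) (M : Matrix (Fin n) (Fin n) ℝ) (a : Fin r → ℝ)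
    (b : Fin (n - r) → ℝ) (i : Fin (n - r)) :
    (M *ᵥ joinVec h a b) (idx₂ h i) = (block₂₁ h M *ᵥ a) i + (block₂₂ h M *ᵥ b) i :=
  congrFun (mulVec_joinVec h M a b) (idx₂ h i)

theorem idx₁_val (h : r ≤ n) (i : Fin r) : (idx₁ h i : ℕ) = i := by
  simp [idx₁, splitIdx]

theorem idx₂_val (h : r ≤ n) (i : Fin (n - r)) : (idx₂ h i : ℕ) = r + i := by
  simp [idx₂, splitIdx]

theorem forall_fin_iff_split (h : r ≤ n) {P : Fin n → Prop} :
    (∀ i, P i) ↔ (∀ i, P (idx₁ h i)) ∧ ∀ i, P (idx₂ h i) := by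
  rw [← (splitIdx h).forall_congr_right, Sum.forall]
  rfl

theorem sum_trailing (h : r ≤ n) (f : Fin n → ℝ) :
    (∑ i : Fin n, if r ≤ i then f i else 0) = ∑ i, f (idx₂ h i) := by
  rw [sum_splitIdx h]
  simp only [idx₁_val, idx₂_val, Nat.le_add_right, if_true]
  rw [Finset.sum_eq_zero fun i _ => if_neg (not_le.2 i.isLt), zero_add]

/-- The reduced model follows a signal of the balanced realization whose trailing coordinates
`x₂ = L xt + K u` satisfy the algebraic relation `α x₂ = β (A x + B u)₂`. -/
theorem isReducedSignal_joinVec (h : r ≤ n) (G : BilinearSystem n m q p) {α β : ℝ}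
    {R : InhomogeneousROM r m p} {L : Matrix (Fin (n - r)) (Fin r) ℝ}
    {K : Matrix (Fin (n - r)) (Fin m) ℝ} (hA : R.A = block₁₁ h G.A + block₁₂ h G.A * L)
    (hB : R.B = rows₁ h G.B + block₁₂ h G.A * K)
    (hN : ∀ k, R.N k = block₁₁ h (G.N k) + block₁₂ h (G.N k) * L)
    (hE : ∀ k, R.E k = block₁₂ h (G.N k) * K)
    (hL : α • L = β • (block₂₁ h G.A + block₂₂ h G.A * L))
    (hK : α • K = β • (rows₂ h G.B + block₂₂ h G.A * K))
    {u : ℝ → Fin m → ℝ} (hu : ∀ k, LocL2 fun t => u t k) {xt : ℝ → Fin r → ℝ}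
    (hxt : IsSolution R.A R.B R.N R.E 0 u xt) :
    IsReducedSignal G α β r u (fun t => joinVec h (xt t) (L *ᵥ xt t + K *ᵥ u t)) := by
  have hrows₁ : ∀ (t : ℝ) (i : Fin r), (G.B *ᵥ u t) (idx₁ h i) = (rows₁ h G.B *ᵥ u t) i :=
    fun _ _ => rfl
  have hrows₂ : ∀ (t : ℝ) (i : Fin (n - r)), (G.B *ᵥ u t) (idx₂ h i) = (rows₂ h G.B *ᵥ u t) i :=
    fun _ _ => rfl
  refine ⟨(forall_fin_iff_split h).2 ⟨fun i => ?_, fun i => ?_⟩,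
    (forall_fin_iff_split h).2 ⟨fun i _ => ?_, fun i hi => ?_⟩,
    (forall_fin_iff_split h).2 ⟨fun i _ => ?_, fun i hi => ?_⟩,
    (forall_fin_iff_split h).2 ⟨fun i hi => ?_, fun i _ t _ => ?_⟩⟩
  · simpa only [joinVec_idx₁] using hxt.locL2 i
  · simp only [joinVec_idx₂]
    exact (locL2_mulVec L hxt.locL2 i).add (locL2_mulVec K hu i)
  · rw [joinVec_idx₁, hxt.initial, Pi.zero_apply]
  · rw [idx₂_val] at hi; omega
  · refine (hxt.isPrimitive hu i).congr (fun t _ => joinVec_idx₁ h _ _ i) fun t _ => ?_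
    simp only [controlRHS, Pi.add_apply, Finset.sum_apply, Pi.smul_apply, smul_eq_mul,
      mulVec_joinVec_idx₁, hrows₁, hA, hB, hN, hE, Matrix.add_mulVec, Matrix.mulVec_add,
      Matrix.mulVec_mulVec, Pi.zero_apply, Matrix.zero_mulVec, add_zero]
    have e : ∀ k, u t k * ((block₁₁ h (G.N k) *ᵥ xt t) i
          + ((block₁₂ h (G.N k) * L) *ᵥ xt t) i + ((block₁₂ h (G.N k) * K) *ᵥ u t) i)
        = u t k * ((block₁₁ h (G.N k) *ᵥ xt t) i
          + (((block₁₂ h (G.N k) * L) *ᵥ xt t) i + ((block₁₂ h (G.N k) * K) *ᵥ u t) i)) :=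
      fun k => by ring
    simp only [e]
    ring
  · rw [idx₂_val] at hi; omega
  · rw [idx₁_val] at hi; have := i.isLt; omega
  · have e1 := congrFun (congrArg (fun X => X *ᵥ xt t) hL) i
    have e2 := congrFun (congrArg (fun X => X *ᵥ u t) hK) i
    simp only [Matrix.smul_mulVec, Pi.smul_apply, smul_eq_mul, Matrix.add_mulVec,
      Pi.add_apply, ← Matrix.mulVec_mulVec] at e1 e2
    simp only [joinVec_idx₂, Pi.add_apply, mulVec_joinVec_idx₂, hrows₂, Matrix.mulVec_add]
    linear_combination e1 + e2

/-- BT sets the trailing coordinates to zero, `(α, β) = (1, 0)`. SPA sets their formal derivative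
without the bilinear part to zero, `(α, β) = (0, 1)`, which gives `x₂ = -A₂₂⁻¹ (A₂₁ x₁ + B₂ u)`. -/
theorem exists_isReducedSignal_of_isSolution (h : r ≤ n) (G : BilinearSystem n m q p) (ν : Method)
    (hν : ν = Method.spa → IsUnit (block₂₂ h G.A).det) {u : ℝ → Fin m → ℝ}
    (hu : ∀ k, LocL2 fun t => u t k) {xt : ℝ → Fin r → ℝ}
    (hxt : IsSolution (inhomogeneousROM h G ν).A (inhomogeneousROM h G ν).B
      (inhomogeneousROM h G ν).N (inhomogeneousROM h G ν).E 0 u xt) :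
    ∃ α β : ℝ, 0 ≤ α ∧ 0 ≤ β ∧ 0 < α + β ∧ ∃ x, IsReducedSignal G α β r u x ∧
      ∀ t, G.C *ᵥ x t = (inhomogeneousROM h G ν).C *ᵥ xt t + (inhomogeneousROM h G ν).D *ᵥ u t := by
  cases ν with
  | bt =>
    refine ⟨1, 0, zero_le_one, le_rfl, by norm_num, _,
      isReducedSignal_joinVec h G (L := 0) (K := 0) ?_ ?_ ?_ ?_ ?_ ?_ hu hxt, fun t => ?_⟩ <;>
    simp [inhomogeneousROM, mulVec_joinVec]
  | spa =>
    have hd := hν rfl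
    refine ⟨0, 1, le_rfl, zero_le_one, by norm_num, _,
      isReducedSignal_joinVec h G (L := -((block₂₂ h G.A)⁻¹ * block₂₁ h G.A))
        (K := -((block₂₂ h G.A)⁻¹ * rows₂ h G.B)) ?_ ?_ ?_ ?_ ?_ ?_ hu hxt, fun t => ?_⟩
    · simp [inhomogeneousROM, sub_eq_add_neg, Matrix.mul_assoc]
    · simp [inhomogeneousROM, sub_eq_add_neg, Matrix.mul_assoc]
    · simp [inhomogeneousROM, sub_eq_add_neg, Matrix.mul_assoc]
    · simp [inhomogeneousROM, Matrix.mul_assoc]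
    · simp [Matrix.mul_nonsing_inv_cancel_left _ _ hd]
    · simp [Matrix.mul_nonsing_inv_cancel_left _ _ hd]
    · simp only [inhomogeneousROM, mulVec_joinVec, Matrix.mulVec_add, Matrix.mulVec_mulVec,
        Matrix.mulVec_neg, Matrix.neg_mulVec, Matrix.sub_mulVec, Matrix.mul_assoc]
      abel

end Identification

/-! ### Balanced coordinates -/

section Balanced

variable {n m q p : ℕ} {G : BilinearSystem n m q p} {γ : ℝ} {P Q S : Matrix (Fin n) (Fin n) ℝ}
  {σ : Fin n → ℝ}

theorem IsBalancing.obs_lyapunov (hS : IsBalancing S P Q σ)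
    (hQ : IsGramian γ G.Aᵀ (fun k => (G.N k)ᵀ) (G.Cᵀ * G.C) Q) :
    sylv γ (G.transform S).Aᵀ (fun k => ((G.transform S).N k)ᵀ) (G.transform S).Aᵀ
        (fun k => ((G.transform S).N k)ᵀ) (Matrix.diagonal σ)
      = -((G.transform S).Cᵀ * (G.transform S).C) := by
  rw [← hS.obs, transform_sylv_transpose hS.isUnit_det, hQ.lyapunov]
  simp [BilinearSystem.transform, Matrix.mul_assoc]

theorem IsBalancing.reach_lyapunov (hS : IsBalancing S P Q σ)
    (hP : IsGramian γ G.A G.N (G.X₀ * G.X₀ᵀ) P) :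
    sylv γ (G.transform S).A (G.transform S).N (G.transform S).A (G.transform S).N
        (Matrix.diagonal σ) = -((G.transform S).X₀ * (G.transform S).X₀ᵀ) := by
  rw [← hS.reach, transform_sylv hS.isUnit_det, hP.lyapunov]
  simp [BilinearSystem.transform, Matrix.mul_assoc]

theorem dotProduct_diagonal_mulVec (d v w : Fin n → ℝ) :
    v ⬝ᵥ (Matrix.diagonal d *ᵥ w) = ∑ i, d i * (v i * w i) := by
  simp only [dotProduct, Matrix.mulVec_diagonal]
  exact Finset.sum_congr rfl fun i _ => by ring

theorem dotProduct_self_mulVec {κ ι : Type*} [Fintype κ] [Fintype ι] (M : Matrix κ ι ℝ)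
    (v : ι → ℝ) : v ⬝ᵥ ((Mᵀ * M) *ᵥ v) = (M *ᵥ v) ⬝ᵥ (M *ᵥ v) := by
  rw [← Matrix.mulVec_mulVec, Matrix.dotProduct_mulVec, Matrix.vecMul_transpose]

theorem IsBalancing.pos (hS : IsBalancing S P Q σ) (hP : P.PosDef) (i : Fin n) : 0 < σ i := by
  have h1 : (Matrix.diagonal σ).PosDef := by
    rw [← hS.reach]
    have := hP.mul_mul_conjTranspose_same (B := S)
      (Matrix.vecMul_injective_of_isUnit ((Matrix.isUnit_iff_isUnit_det _).2 hS.isUnit_det))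
    simpa using this
  exact Matrix.posDef_diagonal_iff.1 h1 i

/-- Observability is the transformed equation for `Q`. Reachability is the matrix inequality for
`P⁻¹ = Sᵀ Σ⁻¹ S`, where the quadratic term `-|g|²` absorbs the input through `2 g · z ≤ |g|² +
|z|²`. -/
theorem IsBalancing.isBalancedRealization (hS : IsBalancing S P Q σ)
    (hQ : IsGramian γ G.Aᵀ (fun k => (G.N k)ᵀ) (G.Cᵀ * G.C) Q)
    (hP : IsLMIGramian γ G.A G.N G.B P) : IsBalancedRealization γ (G.transform S) σ := by
  have hpos := hS.pos hP.1
  refine ⟨hpos, fun e => ?_, fun e z => ?_⟩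
  · have h1 := quadForm_sylv_transpose γ (G.transform S).A (G.transform S).N
      (Matrix.diagonal_transpose σ) e
    rw [hS.obs_lyapunov hQ, Matrix.neg_mulVec, dotProduct_neg, dotProduct_self_mulVec] at h1
    simp only [dotProduct_diagonal_mulVec, ← sq] at h1
    exact h1.symm.le
  · set D : Matrix (Fin n) (Fin n) ℝ := Matrix.diagonal fun i => (σ i)⁻¹ with hD
    have hinv : P⁻¹ = Sᵀ * D * S := by
      refine Matrix.inv_eq_right_inv ?_
      have e1 : S * P * Sᵀ * D = 1 := by
        rw [hS.reach, hD, Matrix.diagonal_mul_diagonal, ← Matrix.diagonal_one]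
        congr 1
        ext i
        exact mul_inv_cancel₀ (hpos i).ne'
      have e2 : S⁻¹ * (S * P * Sᵀ * D) * S = 1 := by
        rw [e1, Matrix.mul_one, Matrix.nonsing_inv_mul _ hS.isUnit_det]
      rw [← e2]
      simp only [Matrix.mul_assoc, Matrix.nonsing_inv_mul_cancel_left _ _ hS.isUnit_det]
    have hSS : ∀ M : Matrix (Fin n) (Fin n) ℝ,
        S *ᵥ (M *ᵥ (S⁻¹ *ᵥ e)) = (S * M * S⁻¹) *ᵥ e := fun M => by
      simp only [Matrix.mulVec_mulVec, Matrix.mul_assoc]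
    have hform : ∀ v w : Fin n → ℝ, v ⬝ᵥ (P⁻¹ *ᵥ w) = ∑ i, (σ i)⁻¹ * ((S *ᵥ v) i * (S *ᵥ w) i) :=
      fun v w => by
        rw [hinv, ← Matrix.mulVec_mulVec, ← Matrix.mulVec_mulVec, Matrix.dotProduct_mulVec,
          Matrix.vecMul_transpose, dotProduct_diagonal_mulVec]
    have hSe : S *ᵥ (S⁻¹ *ᵥ e) = e := by
      rw [Matrix.mulVec_mulVec, Matrix.mul_nonsing_inv _ hS.isUnit_det, Matrix.one_mulVec]
    have hPsym : (P⁻¹)ᵀ = P⁻¹ := by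
      rw [hinv]
      simp [Matrix.transpose_mul, Matrix.mul_assoc, hD]
    have h1 := (posSemidef_iff_quadForm.1 hP.2).2 (S⁻¹ *ᵥ e)
    have h2 := quadForm_sylv_transpose γ G.A G.N hPsym (S⁻¹ *ᵥ e)
    have h3 : sylv γ G.Aᵀ (fun k => (G.N k)ᵀ) G.Aᵀ (fun k => (G.N k)ᵀ) P⁻¹
        = G.Aᵀ * P⁻¹ + P⁻¹ * G.A + (1 / γ ^ 2) • ∑ k, (G.N k)ᵀ * P⁻¹ * G.N k := by
      simp only [sylv_apply, Matrix.transpose_transpose]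
    have h4 : P⁻¹ * G.B * G.Bᵀ * P⁻¹ = (G.Bᵀ * P⁻¹)ᵀ * (G.Bᵀ * P⁻¹) := by
      simp only [Matrix.transpose_mul, Matrix.transpose_transpose, hPsym, Matrix.mul_assoc]
    rw [← h3, h4, Matrix.sub_mulVec, dotProduct_sub, h2, Matrix.neg_mulVec, dotProduct_neg,
      dotProduct_self_mulVec] at h1
    simp only [hform, hSe, hSS, ← sq] at h1
    set g := (G.Bᵀ * P⁻¹) *ᵥ (S⁻¹ *ᵥ e) with hg
    have h5 : ∑ i, (σ i)⁻¹ * (e i * ((S * G.B) *ᵥ z) i) = g ⬝ᵥ z := by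
      have h6 := hform (S⁻¹ *ᵥ e) (G.B *ᵥ z)
      have h9 : P⁻¹ * G.B = (G.Bᵀ * P⁻¹)ᵀ := by
        rw [Matrix.transpose_mul, Matrix.transpose_transpose, hPsym]
      simp only [hSe, Matrix.mulVec_mulVec] at h6
      rw [h9, Matrix.dotProduct_mulVec, Matrix.vecMul_transpose] at h6
      exact h6.symm
    have h7 := dotProduct_self_nonneg' (g - z)
    rw [sub_dotProduct, dotProduct_sub, dotProduct_sub, dotProduct_comm z g] at h7
    have h8 : ∑ i, (σ i)⁻¹ * (e i * ((G.transform S).A *ᵥ e + (G.transform S).B *ᵥ z) i)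
        = ∑ i, (σ i)⁻¹ * (e i * ((S * G.A * S⁻¹) *ᵥ e) i)
          + ∑ i, (σ i)⁻¹ * (e i * ((S * G.B) *ᵥ z) i) := by
      rw [← Finset.sum_add_distrib]
      refine Finset.sum_congr rfl fun i _ => ?_
      rw [Pi.add_apply, mul_add, mul_add]
      rfl
    rw [h8, h5]
    simp only [BilinearSystem.transform]
    linarith

theorem transform_N_eq_zero {k : Fin m} (h : G.N k = 0) : (G.transform S).N k = 0 := by
  simp [BilinearSystem.transform, h]

end Balanced

/-! ### Square integrable signals -/

section SquareIntegrable

variable {d : ℕ} {f : ℝ → Fin d → ℝ}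

theorem norm_toLp_sq (v : Fin d → ℝ) : ‖WithLp.toLp 2 v‖ ^ 2 = v ⬝ᵥ v := by
  rw [EuclideanSpace.real_norm_sq_eq]
  exact Finset.sum_congr rfl fun i _ => sq _

theorem SquareIntegrable.integrableOn (hf : SquareIntegrable f) :
    IntegrableOn (fun t => f t ⬝ᵥ f t) (Set.Ioi 0) := by
  have := (memLp_two_iff_integrable_sq_norm hf.1).1 hf
  simp only [norm_toLp_sq] at this
  exact this

theorem SquareIntegrable.l2Norm_sq (hf : SquareIntegrable f) :
    l2Norm f ^ 2 = ∫ t in Set.Ioi (0 : ℝ), f t ⬝ᵥ f t := by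
  have h0 : 0 ≤ ∫ t in Set.Ioi (0 : ℝ), ‖WithLp.toLp 2 (f t)‖ ^ (2 : ℝ) :=
    integral_nonneg fun t => by positivity
  rw [l2Norm, hf.eLpNorm_eq_integral_rpow_norm two_ne_zero ENNReal.ofNat_ne_top,
    ENNReal.toReal_ofReal (by positivity), ENNReal.toReal_ofNat, ← Real.rpow_natCast,
    ← Real.rpow_mul h0]
  norm_num [norm_toLp_sq]

theorem l2Norm_nonneg (f : ℝ → Fin d → ℝ) : 0 ≤ l2Norm f := ENNReal.toReal_nonneg

theorem SquareIntegrable.integral_le (hf : SquareIntegrable f) {T : ℝ} (hT : 0 ≤ T) :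
    ∫ t in (0 : ℝ)..T, f t ⬝ᵥ f t ≤ l2Norm f ^ 2 := by
  rw [hf.l2Norm_sq, intervalIntegral.integral_of_le hT]
  exact setIntegral_mono_set hf.integrableOn
    (Eventually.of_forall fun t => dotProduct_self_nonneg' _)
    (Eventually.of_forall Set.Ioc_subset_Ioi_self)

/-- Passage from all finite horizons to the half line by exhaustion with `(0, N]`. -/
theorem squareIntegrable_of_integral_le (hf : ∀ i, LocL2 fun t => f t i) {K : ℝ} (hK : 0 ≤ K)
    (h : ∀ T, 0 ≤ T → ∫ t in (0 : ℝ)..T, f t ⬝ᵥ f t ≤ K ^ 2) :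
    SquareIntegrable f ∧ l2Norm f ≤ K := by
  have hnat : Tendsto (fun N : ℕ => (N : ℝ)) atTop atTop := tendsto_natCast_atTop_atTop
  have hsq : SquareIntegrable f := by
    refine MemLp.of_eval_piLp fun i => ?_
    have hm : AEStronglyMeasurable (fun t => f t i) (volume.restrict (Set.Ioi (0 : ℝ))) := by
      have hU : (⋃ N : ℕ, Set.Ioc (0 : ℝ) N) = Set.Ioi 0 :=
        Set.iUnion_Ioc_eq_Ioi_self_iff.2 fun x _ => exists_nat_ge x
      rw [← hU]
      exact aestronglyMeasurable_iUnion_iff.2 fun N => (hf i N N.cast_nonneg).1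
    refine (memLp_two_iff_integrable_sq hm).2 ?_
    refine integrableOn_Ioi_of_intervalIntegral_norm_bounded (K ^ 2) 0 (l := atTop)
      (fun N : ℕ => (hf i N N.cast_nonneg).integrable_sq) hnat (Eventually.of_forall fun N => ?_)
    refine (intervalIntegral.integral_mono_on N.cast_nonneg ?_
      (locInt_dotProduct_self hf N N.cast_nonneg) fun t _ => ?_).trans (h N N.cast_nonneg)
    · have := (hf i).mul (hf i) N N.cast_nonneg
      simpa [← sq] using this
    · rw [Real.norm_eq_abs, abs_of_nonneg (sq_nonneg _), sq]
      exact Finset.single_le_sum (f := fun i => f t i * f t i) (fun j _ => mul_self_nonneg _)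
        (Finset.mem_univ i)
  refine ⟨hsq, le_of_sq_le_sq ?_ hK⟩
  rw [hsq.l2Norm_sq]
  exact le_of_tendsto (intervalIntegral_tendsto_integral_Ioi 0 hsq.integrableOn hnat)
    (Eventually.of_forall fun N => h N N.cast_nonneg)

variable {n m : ℕ} {N : Fin m → Matrix (Fin n) (Fin n) ℝ} {u : ℝ → Fin m → ℝ}

theorem bilinearControl_eq (N : Fin m → Matrix (Fin n) (Fin n) ℝ) (u : ℝ → Fin m → ℝ) (t : ℝ)
    (k : Fin m) : N k = 0 ∨ bilinearControl N u t k = u t k := by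
  unfold bilinearControl
  split_ifs with h
  · exact Or.inl h
  · exact Or.inr rfl

theorem locL2_bilinearControl (hu : ∀ k, LocL2 fun t => u t k) (k : Fin m) :
    LocL2 fun t => bilinearControl N u t k := by
  unfold bilinearControl
  split_ifs with h
  · exact locL2_of_continuousOn continuousOn_const
  · exact hu k

theorem integral_bilinearControl_le (N : Fin m → Matrix (Fin n) (Fin n) ℝ) (γ : ℝ)
    (hu : SquareIntegrable u) {T : ℝ} (hT : 0 ≤ T) :
    ∫ t in (0 : ℝ)..T, ∑ k, γ ^ 2 * bilinearControl N u t k ^ 2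
      ≤ l2Norm (fun t k => γ * bilinearControl N u t k) ^ 2 := by
  have huL := locL2_of_squareIntegrable hu
  have hL : ∀ k, LocL2 fun t => γ * bilinearControl N u t k :=
    fun k => (locL2_bilinearControl huL k).const_mul γ
  have hsq : SquareIntegrable fun t k => γ * bilinearControl N u t k := by
    refine (squareIntegrable_of_integral_le hL
      (mul_nonneg (abs_nonneg γ) (l2Norm_nonneg u)) fun T hT => ?_).1
    rw [mul_pow, sq_abs]
    refine le_trans ?_ (mul_le_mul_of_nonneg_left (hu.integral_le hT) (sq_nonneg γ))
    rw [← intervalIntegral.integral_const_mul]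
    refine intervalIntegral.integral_mono_on hT (locInt_dotProduct_self hL T hT)
      ((locInt_dotProduct_self huL).const_mul _ T hT) fun t _ => ?_
    rw [dotProduct, dotProduct, Finset.mul_sum]
    refine Finset.sum_le_sum fun k _ => ?_
    unfold bilinearControl
    split_ifs
    · have := mul_nonneg (sq_nonneg γ) (mul_self_nonneg (u t k))
      simpa using this
    · exact le_of_eq (by ring)
  have h1 := hsq.integral_le hT
  have h2 : ∀ t, (fun k => γ * bilinearControl N u t k) ⬝ᵥ (fun k => γ * bilinearControl N u t k)
      = ∑ k, γ ^ 2 * bilinearControl N u t k ^ 2 := fun t =>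
    Finset.sum_congr rfl fun k _ => by ring
  simpa only [h2] using h1

end SquareIntegrable

/-! ### Superposition of the subsystems -/

section Superposition

variable {n m q p : ℕ} {G : BilinearSystem n m q p} {γ : ℝ} {θ : Fin n → ℝ}

/-- No sign is assumed for the truncated `θ i`; it follows because the diagonal matrix solves a
Lyapunov equation whose flow decays. -/
theorem nonneg_of_reach_lyapunov
    (hst : ∀ Z : ℝ → Matrix (Fin n) (Fin n) ℝ, IsMatrixFlow (sylv γ G.A G.N G.A G.N) Z →
      ∀ i j, Tendsto (fun t => Z t i j) atTop (𝓝 0))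
    (hP : sylv γ G.A G.N G.A G.N (Matrix.diagonal θ) = -(G.X₀ * G.X₀ᵀ)) (i : Fin n) :
    0 ≤ θ i := by
  obtain ⟨H, hH0, hHd⟩ := exists_matrixFlow (sylv γ G.A G.N G.A G.N) (Matrix.diagonal θ)
  have hH := isMatrixFlow_of_hasDerivAt hHd
  have h1 := posSemidef_of_lyapunov_of_tendsto (Matrix.diagonal_transpose θ)
    (by rw [hP, neg_neg]; simpa using Matrix.posSemidef_self_mul_conjTranspose G.X₀) hH hH0
    (hst H hH)
  simpa using diag_nonneg_of_posSemidef h1 i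

theorem isReducedSignal_transform {S : Matrix (Fin n) (Fin n) ℝ} (hS : IsUnit S.det)
    {u : ℝ → Fin m → ℝ} (hu : ∀ k, LocL2 fun t => u t k) {x : ℝ → Fin n → ℝ}
    (hx : IsSolution G.A G.B G.N 0 0 u x) (α β : ℝ) :
    IsReducedSignal (G.transform S) α β n u (fun t => S *ᵥ x t) := by
  refine ⟨fun i => locL2_mulVec S hx.locL2 i, fun i _ => ?_, fun i _ => ?_, fun i hi => ?_⟩
  · rw [hx.initial, Matrix.mulVec_zero, Pi.zero_apply]
  · exact transform_isPrimitive hS (hx.isPrimitive hu) i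
  · exact absurd i.isLt (not_lt.2 hi)

theorem homogeneous_part_isPrimitive {u : ℝ → Fin m → ℝ} (hu : ∀ k, LocL2 fun t => u t k)
    {x₀ x₀' : Fin n → ℝ} {x x' : ℝ → Fin n → ℝ} (hx : IsSolution G.A G.B G.N 0 x₀ u x)
    (hx' : IsSolution G.A G.B G.N 0 x₀' u x') (i : Fin n) :
    IsPrimitive (fun t => (x t - x' t) i)
      (fun t => controlRHS G.A 0 G.N 0 (u t) (x t - x' t) i) := by
  refine ((hx.isPrimitive hu i).sub (hx'.isPrimitive hu i)).congr (fun _ _ => rfl) fun t _ => ?_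
  rw [controlRHS_sub]
  simp [controlRHS, Finset.sum_apply]

end Superposition

end BilinearMOR

end

/-! ### The error bound for the combined reduced model -/

theorem theorem4p5 {n m q p : ℕ} (G : BilinearSystem n m q p) (γ : ℝ) (hγ : 0 < γ)
    (hA : IsHurwitz G.A) (hstab : MeanSquareStable γ G.A G.N)
    -- the Gramians
    (P₀ Q P_B : Matrix (Fin n) (Fin n) ℝ)
    (hP₀ : IsGramian γ G.A G.N (G.X₀ * G.X₀ᵀ) P₀)
    (hQ : IsGramian γ G.Aᵀ (fun k => (G.N k)ᵀ) (G.Cᵀ * G.C) Q)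
    (hP_B : IsLMIGramian γ G.A G.N G.B P_B)
    -- the balancing transformations and the Hankel singular values of both subsystems
    (T S : Matrix (Fin n) (Fin n) ℝ) (θ σ : Fin n → ℝ)
    (hT : IsBalancing T P₀ Q θ) (hS : IsBalancing S P_B Q σ)
    -- the reduced dimensions and the reduction schemes
    (r_x r_B : ℕ) (hr_x : r_x ≤ n) (hr_B : r_B ≤ n) (μ ν : Method)
    (hθ : ∀ i : Fin n, (i : ℕ) < r_x → 0 < θ i)
    (hμ : μ = Method.spa → IsUnit (block₂₂ hr_x (G.transform T).A).det)
    (hν : ν = Method.spa → IsUnit (block₂₂ hr_B (G.transform S).A).det)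
    (R_x : HomogeneousROM r_x m q p) (hR_x : R_x = homogeneousROM hr_x (G.transform T) μ)
    (R_B : InhomogeneousROM r_B m p) (hR_B : R_B = inhomogeneousROM hr_B (G.transform S) ν)
    -- existence of the reduced Gramian is assumed for SPA only
    (hPt : μ = Method.spa → ∃ Pt, IsGramian γ R_x.A R_x.N (R_x.X₀ * R_x.X₀ᵀ) Pt) :
    ∃ (Pt : Matrix (Fin r_x) (Fin r_x) ℝ) (Y : Matrix (Fin n) (Fin r_x) ℝ),
      IsGramian γ R_x.A R_x.N (R_x.X₀ * R_x.X₀ᵀ) Pt ∧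
      MixedEquation γ (G.transform T) R_x Y ∧
      (∀ Y', MixedEquation γ (G.transform T) R_x Y' → Y' = Y) ∧
      0 ≤ (truncatedDiag hr_x θ * weight hr_x γ (G.transform T) μ Y Pt).trace ∧
      ∀ (v₀ : Fin q → ℝ) (u : ℝ → Fin m → ℝ), SquareIntegrable u →
        ∀ (x : ℝ → Fin n → ℝ) (xt_x : ℝ → Fin r_x → ℝ) (xt_B : ℝ → Fin r_B → ℝ),
          IsSolution G.A G.B G.N 0 (G.X₀ *ᵥ v₀) u x →
          IsSolution R_x.A 0 R_x.N 0 (R_x.X₀ *ᵥ v₀) u xt_x →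
          IsSolution R_B.A R_B.B R_B.N R_B.E 0 u xt_B →
          ∀ y yt : ℝ → Fin p → ℝ,
            (∀ t, y t = G.C *ᵥ x t) →
            (∀ t, yt t = R_x.C *ᵥ xt_x t + (R_B.C *ᵥ xt_B t + R_B.D *ᵥ u t)) →
            SquareIntegrable (fun t => y t - yt t) ∧
            l2Norm (fun t => y t - yt t) ≤
              (Real.sqrt
                  (truncatedDiag hr_x θ * weight hr_x γ (G.transform T) μ Y Pt).trace
                  * ‖WithLp.toLp 2 v₀‖
                + (2 * ∑ i : Fin (n - r_B), σ (idx₂ hr_B i)) * l2Norm u)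
              * Real.exp (1 / 2 * l2Norm (fun t k => γ * bilinearControl G.N u t k) ^ 2) := by
  subst hR_x hR_B
  have hstT := fun Z => transform_flow_tendsto_zero hT.isUnit_det
    (fun _ hZ => hstab.flow_tendsto_zero hZ) (Z := Z)
  have hc := isCompression_homogeneousROM hr_x (G.transform T) μ hμ
  have hP := hT.reach_lyapunov hP₀
  have hQT := hT.obs_lyapunov hQ
  have hθ0 := nonneg_of_reach_lyapunov hstT hP
  have hθr : ∀ i, 0 < θ (idx₁ hr_x i) := fun i => hθ _ (by rw [idx₁_val]; exact i.isLt)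
  obtain ⟨Pt, hPt'⟩ : ∃ Pt, IsGramian γ (homogeneousROM hr_x (G.transform T) μ).A
      (homogeneousROM hr_x (G.transform T) μ).N ((homogeneousROM hr_x (G.transform T) μ).X₀
        * (homogeneousROM hr_x (G.transform T) μ).X₀ᵀ) Pt := by
    cases μ with
    | bt => exact exists_isGramian_bt hr_x (G.transform T) hθ0 hP
    | spa => exact hPt rfl
  have hΘ := hc.adjoint_lyapunov_le hθ0 hQT
  have hinj := mixed_injective hstT hθr hΘ
  -- Finite dimension turns injectivity of the mixed operator into existence.
  obtain ⟨Y, hY⟩ := LinearMap.injective_iff_surjective.1 hinj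
    (-((G.transform T).X₀ * (homogeneousROM hr_x (G.transform T) μ).X₀ᵀ))
  have hY' : MixedEquation γ (G.transform T) (homogeneousROM hr_x (G.transform T) μ) Y := hY
  have hPe := errorGramian_posSemidef (h := hr_x) hstT hP hθr hΘ hPt' hY'
  have htr := hc.trace_eq hP hQT hPt'.lyapunov hY'
  have htr0 : 0 ≤ (truncatedDiag hr_x θ * weight hr_x γ (G.transform T) μ Y Pt).trace := by
    -- The weight is the trace of `𝒞 𝒫 𝒞ᵀ` for the error Gramian `𝒫 ≥ 0`.
    rw [← htr, ← trace_errorGramian]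
    simpa using (hPe.mul_mul_conjTranspose_same _).trace_nonneg
  refine ⟨Pt, Y, hPt', hY', fun Y' hY'' => hinj (hY''.trans hY.symm), htr0, ?_⟩
  intro v₀ u hu x xt_x xt_B hx hxt_x hxt_B y yt hy hyt
  have huL := locL2_of_squareIntegrable hu
  -- The inhomogeneous part of the state; the difference `x - x_B` solves the homogeneous equation
  -- with the same control and starts in `X₀ v₀`.
  obtain ⟨x_B, hx_B⟩ := exists_isSolution G.A G.B G.N 0 huL 0
  obtain ⟨α, β, hα, hβ, hαβ, z, hz, hzC⟩ :=
    exists_isReducedSignal_of_isSolution hr_B (G.transform S) ν hν huL hxt_B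
  have hfull := isReducedSignal_transform hS.isUnit_det huL hx_B α β
  have hxh := homogeneous_part_isPrimitive huL hx hx_B
  have hxT := transform_isPrimitive hT.isUnit_det hxh
  rw [Matrix.mul_zero] at hxT
  have hwL : ∀ k, LocL2 fun t => bilinearControl G.N u t k := locL2_bilinearControl huL
  have hy_eq : ∀ t, y t - yt t
      = ((G.transform T).C *ᵥ (T *ᵥ (x t - x_B t))
          - (homogeneousROM hr_x (G.transform T) μ).C *ᵥ xt_x t)
        + (G.transform S).C *ᵥ (S *ᵥ x_B t - z t) := fun t => by
    rw [hy, hyt, Matrix.mulVec_sub (G.transform S).C, hzC, transform_output hT.isUnit_det,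
      transform_output hS.isUnit_det, Matrix.mulVec_sub]
    abel
  have hxhL : ∀ i, LocL2 fun t => (T *ᵥ (x t - x_B t)) i := fun i =>
    locL2_of_continuousOn (hxT i).continuousOn
  have hL₁ : ∀ i, LocL2 fun t => ((G.transform T).C *ᵥ (T *ᵥ (x t - x_B t))
      - (homogeneousROM hr_x (G.transform T) μ).C *ᵥ xt_x t) i := fun i =>
    (locL2_mulVec (G.transform T).C hxhL i).sub (locL2_mulVec _ hxt_x.locL2 i)
  have hL₂ : ∀ i, LocL2 fun t => ((G.transform S).C *ᵥ (S *ᵥ x_B t - z t)) i :=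
    locL2_mulVec (G.transform S).C fun i => (hfull.locL2 i).sub (hz.locL2 i)
  have hL : ∀ i, LocL2 fun t => (y t - yt t) i := fun i => by
    simp only [hy_eq]
    exact (hL₁ i).add (hL₂ i)
  have hσ := (hS.isBalancedRealization hQ hP_B)
  have hσ0 : 0 ≤ 2 * ∑ i : Fin (n - r_B), σ (idx₂ hr_B i) :=
    mul_nonneg zero_le_two (Finset.sum_nonneg fun i _ => (hσ.pos _).le)
  -- The energy estimates bound squared norms by the full exponential, hence its square root `e`
  -- here.
  set e := Real.exp (1 / 2 * l2Norm (fun t k => γ * bilinearControl G.N u t k) ^ 2) with he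
  have he2 : e ^ 2 = Real.exp (l2Norm (fun t k => γ * bilinearControl G.N u t k) ^ 2) := by
    rw [he, ← Real.exp_nat_mul]
    congr 1
    push_cast
    ring
  set τ := (truncatedDiag hr_x θ * weight hr_x γ (G.transform T) μ Y Pt).trace
  have ha : 0 ≤ Real.sqrt τ * ‖WithLp.toLp 2 v₀‖ * e := by positivity
  have hb : 0 ≤ (2 * ∑ i : Fin (n - r_B), σ (idx₂ hr_B i)) * l2Norm u * e :=
    mul_nonneg (mul_nonneg hσ0 (l2Norm_nonneg u)) (Real.exp_pos _).le
  rw [add_mul]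
  refine squareIntegrable_of_integral_le hL (add_nonneg ha hb) fun t ht => ?_
  have hexp := Real.exp_le_exp.2 (integral_bilinearControl_le G.N γ hu ht)
  rw [← he2] at hexp
  simp only [hy_eq]
  refine integral_dotProduct_add_le hL₁ hL₂ ht ha hb ?_ ?_
  · have h1 := homogeneous_output_error_le hγ hPe hP hPt'.lyapunov hY' hwL (u := u)
      (v₀ := v₀) (xt := xt_x)
      (fun t k => (bilinearControl_eq G.N u t k).imp_left fun h0 => by
        have h2 : (G.transform T).N k = 0 := transform_N_eq_zero h0
        refine ⟨h2, ?_⟩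
        rw [← hc.N₁, h2, Matrix.zero_mul]
        rfl)
      hxT (by
        rw [hx.initial, hx_B.initial, sub_zero, Matrix.mulVec_mulVec]
        rfl)
      (hxt_x.isPrimitive huL) hxt_x.initial ht
    rw [htr] at h1
    refine h1.trans ((mul_le_mul_of_nonneg_right hexp
      (mul_nonneg htr0 (dotProduct_self_nonneg' _))).trans (le_of_eq ?_))
    rw [mul_pow, mul_pow, Real.sq_sqrt htr0, norm_toLp_sq]
    ring
  · have h1 := reduction_error_le hγ hσ hα hβ hαβ huL hwL
      (fun t k => (bilinearControl_eq G.N u t k).imp_left transform_N_eq_zero) hr_B hfull hz ht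
    rw [sum_trailing hr_B] at h1
    refine h1.trans ?_
    have hU : 0 ≤ ∫ s in (0 : ℝ)..t, u s ⬝ᵥ u s := intervalIntegral.integral_nonneg ht
      fun s _ => dotProduct_self_nonneg' _
    rw [mul_pow _ (Real.sqrt _), Real.sq_sqrt (by positivity), mul_assoc, mul_pow _ (_ * e)]
    refine mul_le_mul_of_nonneg_left ?_ (sq_nonneg _)
    rw [mul_pow, mul_comm (l2Norm u ^ 2)]
    exact mul_le_mul hexp (hu.integral_le ht) hU (sq_nonneg e)
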